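/- **Setting.** Fix a first-order signature and a theory $CT$ over it containing Clark's equality theory (function symbols are injective, have disjoint ranges, and satisfy the occurs check). Built-in constraints are $c::=d\mid c\wedge c\mid\exists_x c$ with $d$ atomic (equations included); a finite multiset of them denotes its conjunction, $\mathtt{true}$ is the empty one, and $\mathtt{false}$ is any conjunction inconsistent with $CT$. CHR constraints are atoms $p(\bar t)$ with other predicate symbols. For sequences of CHR constraints, $H=H'$ denotes the set of argument equations, defined when lengths and predicate symbols agree. A goal is a multiset of built-in and CHR constraints. A CHR program $P$ is a finite set of rules $r@H_1\backslash H_2\Leftrightarrow D\mid B$ with distinct names $r$, $H_1,H_2$ sequences of CHR constraints, not both empty, $D$ a multiset of built-in constraints and $B$ a goal. In an annotated rule $r@H_1\backslash H_2\Leftrightarrow D\mid\tilde B;T$ the CHR constraints of the body carry distinct identifiers ($h\#i$), and $T$ is a finite set of tokens $r@i_1,\dots,i_l$; names need not be distinct. $Ann(P)$ numbers the $m$ CHR constraints of each body by $1,\dots,m$ and takes $T=\emptyset$. $chr$ and $id$ denote erasing and extracting identifiers; $inst(\tilde B,T,n)$ increases all identifiers in $\tilde B,T$ by $n$ and also returns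 the greatest resulting identifier ($n$ if there is none). Rules are identified up to renaming of variables and are renamed apart when used. **Semantics $\omega_t$** (configurations $\langle G,\tilde S,C,T\rangle_n$). *Solve*: $\langle\{c\}\uplus G,\tilde S,C,T\rangle_n\to\langle G,\tilde S,C',T\rangle_n$ if $CT\models c\wedge C\leftrightarrow C'$. *Introduce*: $\langle\{h\}\uplus G,\tilde S,C,T\rangle_n\to\langle G,\{h\#n\}\cup\tilde S,C,T\rangle_{n+1}$. *Apply*: for a fresh variant $r@H_1'\backslash H_2'\Leftrightarrow D\mid B$ of a rule of $P$, with $x=Fv(H_1',H_2')$, $$\langle G,\tilde H_1\cup\tilde H_2\cup\tilde S,C,T\rangle_n\to\langle B\uplus G,\tilde H_1\cup\tilde S,(chr(\tilde H_1,\tilde H_2)=(H_1',H_2'))\wedge C,T'\rangle_n$$ if $CT\models C\to\exists_x((chr(\tilde H_1,\tilde H_2)=(H_1',H_2'))\wedge D)$ and $t:=r@id(\tilde H_1,\tilde H_2)\notin T$, where $T'=T\cup\{t\}$ if $\tilde H_2=\emptyset$ and $T'=T$ otherwise. **Semantics $\omega_t'$** (annotated programs, configurations $\langle\tilde S,C,T\rangle_n$).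 *Solve'* is the analogue of Solve. *Apply'* has the same conditions and leads from $\langle\tilde H_1\cup\tilde H_2\cup\tilde G,C,T\rangle_n$ to $\langle\tilde B'\cup\tilde H_1\cup\tilde G,(chr(\tilde H_1,\tilde H_2)=(H_1',H_2'))\wedge C,T'\cup T_r'\rangle_m$, where $(\tilde B',T_r',m)=inst(\tilde B,T_r,n)$, $\tilde B;T_r$ is the body and token store of the rule, and $T'$ is as above. **Qualified answers.** $\mathcal{QA}_P(G)$ consists of the formulas $\exists_{-Fv(G)}(chr(\tilde K)\wedge d)$ such that $\langle G,\emptyset,\mathtt{true},\emptyset\rangle_1\to^*_{\omega_t}\langle\emptyset,\tilde K,d,T\rangle_n\not\to_{\omega_t}$, together with $\mathtt{false}$ if a configuration with inconsistent built-in store is reachable. $\mathcal{QA}'_P(G)$ is defined likewise with $\omega_t'$ from $\langle\tilde G,\mathtt{true},\emptyset\rangle_m$, where $\tilde G$ is $G$ with its $m$ CHR constraints numbered $1,\dots,m$, and final configurations $\langle\tilde K,d,T\rangle_n$ with no built-in constraint left in $\tilde K$. Answers are identified up to renaming of the variables outside $Fv(G)$ and $CT$-equivalence of $d$; all answers with inconsistent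 $d$ are identified with $\mathtt{false}$. **Unfolding.** Let $r@H_1\backslash H_2\Leftrightarrow D\mid\tilde K,\tilde S_1,\tilde S_2,C;T$ be an annotated rule ($C$ the built-in constraints of the body) and $v@H_1'\backslash H_2'\Leftrightarrow D'\mid\tilde B;T'$ another, renamed apart. Suppose $\theta$ is a substitution on $Fv(H_1',H_2')$ with $CT\models(C\wedge D)\to chr(\tilde S_1,\tilde S_2)=(H_1',H_2')\theta$, that $v@id(\tilde S_1,\tilde S_2)\notin T$, and that $D\wedge D''\theta$ is satisfiable, where $D''$ consists of the $c\in D'$ with $CT\not\models(C\wedge D)\to c\theta$. Then $r$ unfolds with $v$, using the atoms with identifiers $id(\tilde S_1,\tilde S_2)$, to $$r@H_1\backslash H_2\Leftrightarrow D,D''\theta\mid\tilde K,\tilde S_1,\tilde B_1,C,\,chr(\tilde S_1,\tilde S_2)=(H_1',H_2');\,T'',$$ where $(\tilde B_1,T_1,m_1)=inst(\tilde B,T',m)$, $m$ is the greatest identifier in $r$, and $T''$ is the union of $T_1$, of the tokens of $T$ all of whose identifiers occur in $\tilde K,\tilde S_1$, and, if $H_2'=\emptyset$, of $\{v@id(\tilde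 S_1)\}$. For an annotated program $P$, $Unf_P(r)$ is the set of all rules obtained by unfolding $r$ with a rule of $P$, and $U^+_P(r)$ is the set of pairs $(v,\bar\imath)$ such that $v$ is a rule of $P$ with which $r$ can be unfolded using the atoms with identifiers $\bar\imath$. $U^{\#}_P(r)$, for $r$ with guard $D$, body $\tilde A$ and token store $T$, is the set of rules $v@H_1'\backslash H_2'\Leftrightarrow D'\mid\tilde B;T'$ of $P$, renamed apart from $r$, for which, with $x=Fv(H_1',H_2')$, there is a conjunction $C'$ of built-in constraints with $Fv(C')\cap Fv(v)=\emptyset$, $D\wedge C'$ satisfiable, and one of the following: (a) there are sequences with $(\tilde A_1,\tilde A_2)\subseteq\tilde A$ such that $CT\models(D\wedge C')\to\exists_x((chr(\tilde A_1,\tilde A_2)=(H_1',H_2'))\wedge D')$, $v@id(\tilde A_1,\tilde A_2)\notin T$ and $(v,id(\tilde A_1,\tilde A_2))\notin U^+_P(r)$; (b) there are non-empty multisets $\tilde A'\subseteq\tilde A$ of identified atoms and $H'$ of CHR constraints, and sequences $K_1,K_2$ that together list $chr(\tilde A')\uplus H'$, such that $CT\models(D\wedge C')\to\exists_x(((K_1,K_2)=(H_1',H_2'))\wedge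 D')$. A rule $r\in P$ with guard $D$ can be *safely replaced* in $P$ if $U^{\#}_P(r)=\emptyset$, $U^+_P(r)\ne\emptyset$, and $CT\models D\leftrightarrow D^*$ for the guard $D^*$ of every rule in $Unf_P(r)$. A *U-sequence* starting from an annotated program $P$ is a sequence $P_0,\dots,P_n$ with $P_0=P$ and, for each $i<n$, $P_{i+1}=(P_i\setminus\{r\})\cup Unf_{P_i}(r)$ for some $r\in P_i$ that can be safely replaced in $P_i$. **Corollary.** Let $P$ be a CHR program and let $P_0,\dots,P_n$ be a U-sequence starting from $Ann(P)$. Then $\mathcal{QA}_P(G)=\mathcal{QA}'_{P_n}(G)$ for every goal $G$. -/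

import Mathlib

open FirstOrder

universe u v

namespace CHR


/-- Built-in constraints `c ::= d | c ∧ c | ∃ x, c` over the signature `L`, where `d` is an equation
or an atomic constraint. Free variables are natural numbers; bound ones are de Bruijn indices,
so `BI L 0` is the type of built-in constraints.
A finite multiset of built-in constraints stands for their conjunction, `0` for `true`. -/
inductive BI (L : FirstOrder.Language.{u, v}) : ℕ → Type (max u v)
  | eq {n : ℕ} (s t : L.Term (ℕ ⊕ Fin n)) : BI L n
  | rel {n k : ℕ} (R : L.Relations k) (ts : Fin k → L.Term (ℕ ⊕ Fin n)) : BI L n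
  | and {n : ℕ} (c d : BI L n) : BI L n
  | ex {n : ℕ} (c : BI L (n + 1)) : BI L n

section BuiltIn

variable {L : FirstOrder.Language.{u, v}}

/-- Truth of a built-in constraint in a structure under an assignment. -/
def BI.Realize {M : Type*} [L.Structure M] (w : ℕ → M) :
    {n : ℕ} → BI L n → (Fin n → M) → Prop
  | _, .eq s t, xs => s.realize (Sum.elim w xs) = t.realize (Sum.elim w xs)
  | _, .rel R ts, xs =>
      Language.Structure.RelMap R (fun i => (ts i).realize (Sum.elim w xs))
  | _, .and c d, xs => c.Realize w xs ∧ d.Realize w xs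
  | _, .ex c, xs => ∃ a : M, c.Realize w (Fin.snoc xs a)

/-- Free variables of a built-in constraint. -/
def BI.fv : {n : ℕ} → BI L n → Set ℕ
  | _, .eq s t => ↑s.varFinsetLeft ∪ ↑t.varFinsetLeft
  | _, .rel _ ts => {x | ∃ i, x ∈ (ts i).varFinsetLeft}
  | _, .and c d => c.fv ∪ d.fv
  | _, .ex c => c.fv

/-- Application of a substitution to the free variables of a built-in constraint. -/
def BI.subst (θ : ℕ → L.Term ℕ) : {n : ℕ} → BI L n → BI L n
  | _, .eq s t => .eq (s.subst (Sum.elim (fun x => (θ x).relabel Sum.inl) (fun i => .var (.inr i))))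
      (t.subst (Sum.elim (fun x => (θ x).relabel Sum.inl) (fun i => .var (.inr i))))
  | _, .rel R ts => .rel R fun j =>
      (ts j).subst (Sum.elim (fun x => (θ x).relabel Sum.inl) (fun i => .var (.inr i)))
  | _, .and c d => .and (c.subst θ) (d.subst θ)
  | _, .ex c => .ex (c.subst θ)

/-- The equation `s = t` as a built-in constraint. -/
def termEq (s t : L.Term ℕ) : BI L 0 := .eq (s.relabel Sum.inl) (t.relabel Sum.inl)

/-- Truth of a conjunction of built-in constraints. -/
def Holds {M : Type*} [L.Structure M] (w : ℕ → M) (C : Multiset (BI L 0)) : Prop :=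
  ∀ c ∈ C, c.Realize w Fin.elim0

/-- Free variables of a conjunction of built-in constraints. -/
def fvs (C : Multiset (BI L 0)) : Set ℕ := {x | ∃ c ∈ C, x ∈ c.fv}

/-- `CT ⊨ C → D`. -/
def Entails (CT : L.Theory) (C D : Multiset (BI L 0)) : Prop :=
  ∀ (M : CT.ModelType.{u, v, max u v}) (w : ℕ → M), Holds w C → Holds w D

/-- `CT ⊨ C → ∃ x, D`, for a set `x` of variables. -/
def EntailsEx (CT : L.Theory) (C : Multiset (BI L 0)) (x : Set ℕ) (D : Multiset (BI L 0)) : Prop :=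
  ∀ (M : CT.ModelType.{u, v, max u v}) (w : ℕ → M), Holds w C →
    ∃ w' : ℕ → M, (∀ y, y ∉ x → w' y = w y) ∧ Holds w' D

/-- `CT ⊨ C ↔ D`. -/
def Equivalent (CT : L.Theory) (C D : Multiset (BI L 0)) : Prop :=
  Entails CT C D ∧ Entails CT D C

/-- `C` is satisfiable with respect to `CT`; otherwise `C` is a form of `false`. -/
def Sat (CT : L.Theory) (C : Multiset (BI L 0)) : Prop :=
  ∃ (M : CT.ModelType.{u, v, max u v}) (w : ℕ → M), Holds w C

/-- The theory `CT` contains Clark's equality theory: equality is true equality, and function symbols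
are free constructors (injectivity, disjointness, occurs check). -/
structure ClarkEquality (CT : L.Theory) : Prop where
  injective : ∀ (M : CT.ModelType.{u, v, max u v}) (n : ℕ) (f : L.Functions n) (a b : Fin n → M),
    Language.Structure.funMap f a = Language.Structure.funMap f b → a = b
  disjoint : ∀ (M : CT.ModelType.{u, v, max u v}) (m n : ℕ) (f : L.Functions m) (g : L.Functions n)
    (a : Fin m → M) (b : Fin n → M), (⟨m, f⟩ : Σ k, L.Functions k) ≠ ⟨n, g⟩ →
    Language.Structure.funMap f a ≠ Language.Structure.funMap g b
  occurs : ∀ (M : CT.ModelType.{u, v, max u v}) (x : ℕ) (t : L.Term ℕ), x ∈ t.varFinset →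
    t ≠ .var x → ∀ w : ℕ → M, t.realize w ≠ w x

end BuiltIn

/-- A CHR constraint `p(t₁, …, tₘ)`; a predicate symbol is a name together with the number of its
arguments. -/
structure Atom (L : FirstOrder.Language.{u, v}) (Q : Type*) where
  pred : Q
  args : List (L.Term ℕ)

/-- An identified CHR constraint `h#i`. -/
abbrev IAtom (L : FirstOrder.Language.{u, v}) (Q : Type*) := Atom L Q × ℕ

/-- A token `r@i₁,…,iₗ`. -/
abbrev Token (N : Type*) := N × List ℕ

section Atoms

variable {L : FirstOrder.Language.{u, v}} {Q : Type*}

def Atom.fv (a : Atom L Q) : Set ℕ := {x | ∃ t ∈ a.args, x ∈ t.varFinset}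

def Atom.subst (θ : ℕ → L.Term ℕ) (a : Atom L Q) : Atom L Q :=
  ⟨a.pred, a.args.map fun t => t.subst θ⟩

/-- A permutation of the variables, as a substitution. -/
def ren (ρ : Equiv.Perm ℕ) : ℕ → L.Term ℕ := fun x => .var (ρ x)

/-- `chr`, on sequences. -/
def chrL (S : List (IAtom L Q)) : List (Atom L Q) := S.map Prod.fst

/-- `id`, on sequences. -/
def idL (S : List (IAtom L Q)) : List ℕ := S.map Prod.snd

/-- Free variables of a sequence of CHR constraints. -/
def fvL (A : List (Atom L Q)) : Set ℕ := {x | ∃ a ∈ A, x ∈ a.fv}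

/-- Free variables of a multiset of identified CHR constraints. -/
def fvI (A : Multiset (IAtom L Q)) : Set ℕ := {x | ∃ a ∈ A, x ∈ a.1.fv}

/-- `H = H'` is defined: equal lengths, and equal predicate symbols in corresponding positions. -/
def SameSymbols (H H' : List (Atom L Q)) : Prop :=
  List.Forall₂ (fun a b => a.pred = b.pred ∧ a.args.length = b.args.length) H H'

/-- The set of equalities `H = H'` (meaningful if `SameSymbols H H'`). -/
def headEqs (H H' : List (Atom L Q)) : Multiset (BI L 0) :=
  ↑(List.zipWith (fun a b => List.zipWith termEq a.args b.args) H H').flatten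

/-- The labelling `I_n^{n+m}`: the constraints are numbered `n+1, …, n+m` in the order in which they
are listed. -/
def label (n : ℕ) (A : List (Atom L Q)) : Multiset (IAtom L Q) := ↑(A.zipIdx (n + 1))

end Atoms

/-- A goal: a multiset of CHR constraints, in some listing (which only serves to number them),
and a multiset of built-in constraints. -/
structure Goal (L : FirstOrder.Language.{u, v}) (Q : Type*) where
  chr : List (Atom L Q)
  bi : Multiset (BI L 0)

def Goal.fv {L : FirstOrder.Language.{u, v}} {Q : Type*} (G : Goal L Q) : Set ℕ := fvL G.chr ∪ fvs G.bi

/-- A simpagation rule `name @ keep \ rem ⇔ guard | body`. Simplification rules have `keep = []`,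
propagation rules have `rem = []`. -/
structure Rule (L : FirstOrder.Language.{u, v}) (Q N : Type*) where
  name : N
  keep : List (Atom L Q)
  rem : List (Atom L Q)
  guard : Multiset (BI L 0)
  body : Goal L Q

/-- A CHR program: a finite set of rules with pairwise distinct names and non-empty heads. -/
structure Program (L : FirstOrder.Language.{u, v}) (Q N : Type*) where
  rules : Set (Rule L Q N)
  finite : rules.Finite
  unique : ∀ r ∈ rules, ∀ s ∈ rules, r.name = s.name → r = s
  head : ∀ r ∈ rules, r.keep ++ r.rem ≠ []

/-- An annotated rule `name @ keep \ rem ⇔ guard | chr, bi ; tok`. -/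
structure ARule (L : FirstOrder.Language.{u, v}) (Q N : Type*) where
  name : N
  keep : List (Atom L Q)
  rem : List (Atom L Q)
  guard : Multiset (BI L 0)
  chr : Multiset (IAtom L Q)
  bi : Multiset (BI L 0)
  tok : Finset (Token N)

section Rules

variable {L : FirstOrder.Language.{u, v}} {Q N : Type*}

def Rule.fv (r : Rule L Q N) : Set ℕ :=
  fvL r.keep ∪ fvL r.rem ∪ fvs r.guard ∪ r.body.fv

/-- The variant of a rule under a permutation of the variables. -/
def Rule.rename (ρ : Equiv.Perm ℕ) (r : Rule L Q N) : Rule L Q N where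
  name := r.name
  keep := r.keep.map (Atom.subst (ren ρ))
  rem := r.rem.map (Atom.subst (ren ρ))
  guard := r.guard.map (BI.subst (ren ρ))
  body := ⟨r.body.chr.map (Atom.subst (ren ρ)), r.body.bi.map (BI.subst (ren ρ))⟩

def ARule.fv (r : ARule L Q N) : Set ℕ :=
  fvL r.keep ∪ fvL r.rem ∪ fvs r.guard ∪ fvI r.chr ∪ fvs r.bi

/-- The variant of an annotated rule under a permutation of the variables. -/
def ARule.rename (ρ : Equiv.Perm ℕ) (r : ARule L Q N) : ARule L Q N where
  name := r.name
  keep := r.keep.map (Atom.subst (ren ρ))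
  rem := r.rem.map (Atom.subst (ren ρ))
  guard := r.guard.map (BI.subst (ren ρ))
  chr := r.chr.map fun a => (a.1.subst (ren ρ), a.2)
  bi := r.bi.map (BI.subst (ren ρ))
  tok := r.tok

/-- `r'` is obtained from `r` by renaming variables. -/
def IsVariant (r r' : ARule L Q N) : Prop := ∃ ρ : Equiv.Perm ℕ, r' = r.rename ρ

/-- The annotated version of a rule. -/
def Rule.ann (r : Rule L Q N) : ARule L Q N where
  name := r.name
  keep := r.keep
  rem := r.rem
  guard := r.guard
  chr := label 0 r.body.chr
  bi := r.body.bi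
  tok := ∅

/-- The annotated version of a program. -/
def Ann (P : Program L Q N) : Set (ARule L Q N) := Rule.ann '' P.rules

/-- The greatest identifier occurring in `B` or `T` (`0` if there is none). -/
def maxId (B : Multiset (IAtom L Q)) (T : Finset (Token N)) : ℕ :=
  max (B.map Prod.snd).sup (T.sup fun t => (t.2 : Multiset ℕ).sup)

/-- `inst (B, T, n)`: all identifiers are increased by `n`; the last component is the greatest
resulting identifier (`n` if there is none). -/
def inst [DecidableEq N] (B : Multiset (IAtom L Q)) (T : Finset (Token N)) (n : ℕ) :
    Multiset (IAtom L Q) × Finset (Token N) × ℕ :=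
  (B.map fun a => (a.1, a.2 + n), T.image fun t => (t.1, t.2.map (· + n)), maxId B T + n)

/-- `clean (B, T)`: the tokens of `T` all of whose identifiers occur in `B`. -/
def clean (B : Multiset (IAtom L Q)) (T : Finset (Token N)) : Finset (Token N) :=
  T.filter fun t => ∀ i ∈ t.2, i ∈ B.map Prod.snd

/-- Addition to `T` of the token for the use of the rule `name` on the sequences `S₁`, `S₂` of
identified constraints, which happens only if `S₂` is empty. -/
def addToken [DecidableEq N] (T : Finset (Token N)) (name : N) (S₁ S₂ : List (IAtom L Q)) :
    Finset (Token N) :=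
  if S₂ = [] then insert (name, idL S₁) T else T

end Rules

section Semantics

variable {L : FirstOrder.Language.{u, v}} {Q N : Type*} [DecidableEq N]

/-- Configurations `⟨G, S, C, T⟩_n` of `ω_t`; `goalChr` and `goalBi` are the two parts of `G`. -/
structure Conf (L : FirstOrder.Language.{u, v}) (Q N : Type*) where
  goalChr : Multiset (Atom L Q)
  goalBi : Multiset (BI L 0)
  store : Multiset (IAtom L Q)
  built : Multiset (BI L 0)
  hist : Finset (Token N)
  next : ℕ

/-- Configurations `⟨S, C, T⟩_n` of `ω_t'`; `chr` and `bi` are the two parts of `S`. -/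
structure AConf (L : FirstOrder.Language.{u, v}) (Q N : Type*) where
  chr : Multiset (IAtom L Q)
  bi : Multiset (BI L 0)
  built : Multiset (BI L 0)
  hist : Finset (Token N)
  last : ℕ

def Conf.fv (σ : Conf L Q N) : Set ℕ :=
  {x | ∃ a ∈ σ.goalChr, x ∈ a.fv} ∪ fvs σ.goalBi ∪ fvI σ.store ∪ fvs σ.built

def AConf.fv (σ : AConf L Q N) : Set ℕ := fvI σ.chr ∪ fvs σ.bi ∪ fvs σ.built

/-- The transitions of `ω_t`. In `apply`, `r` is a variant of a rule of the program whose variables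
are fresh: they occur neither in the configuration nor in `V` (the variables of the initial goal). -/
inductive Step (CT : L.Theory) (P : Program L Q N) (V : Set ℕ) : Conf L Q N → Conf L Q N → Prop
  | solve (A : Multiset (Atom L Q)) (B : Multiset (BI L 0)) (c : BI L 0)
      (S : Multiset (IAtom L Q)) (C C' : Multiset (BI L 0)) (T : Finset (Token N)) (n : ℕ)
      (h : Equivalent CT ({c} + C) C') :
      Step CT P V ⟨A, {c} + B, S, C, T, n⟩ ⟨A, B, S, C', T, n⟩
  | introduce (a : Atom L Q) (A : Multiset (Atom L Q)) (B : Multiset (BI L 0))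
      (S : Multiset (IAtom L Q)) (C : Multiset (BI L 0)) (T : Finset (Token N)) (n : ℕ) :
      Step CT P V ⟨{a} + A, B, S, C, T, n⟩ ⟨A, B, {(a, n)} + S, C, T, n + 1⟩
  | apply (r₀ r : Rule L Q N) (ρ : Equiv.Perm ℕ)
      (A : Multiset (Atom L Q)) (B : Multiset (BI L 0)) (S₁ S₂ : List (IAtom L Q))
      (S : Multiset (IAtom L Q)) (C : Multiset (BI L 0)) (T : Finset (Token N)) (n : ℕ)
      (mem : r₀ ∈ P.rules) (variant : r = r₀.rename ρ)
      (fresh : Disjoint r.fv (V ∪ Conf.fv (⟨A, B, ↑S₁ + ↑S₂ + S, C, T, n⟩ : Conf L Q N)))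
      (keep : SameSymbols (chrL S₁) r.keep) (rem : SameSymbols (chrL S₂) r.rem)
      (entails : EntailsEx CT C (fvL r.keep ∪ fvL r.rem)
        (headEqs (chrL S₁) r.keep + headEqs (chrL S₂) r.rem + r.guard))
      (token : (r.name, idL (S₁ ++ S₂)) ∉ T) :
      Step CT P V ⟨A, B, ↑S₁ + ↑S₂ + S, C, T, n⟩
        ⟨↑r.body.chr + A, r.body.bi + B, ↑S₁ + S,
          headEqs (chrL S₁) r.keep + headEqs (chrL S₂) r.rem + C, addToken T r.name S₁ S₂, n⟩

/-- The transitions of `ω_t'`, for a set `P` of annotated rules. In `apply`, `r` is a variant of a rule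
of `P` whose variables are fresh. -/
inductive AStep (CT : L.Theory) (P : Set (ARule L Q N)) (V : Set ℕ) :
    AConf L Q N → AConf L Q N → Prop
  | solve (S : Multiset (IAtom L Q)) (B : Multiset (BI L 0)) (c : BI L 0)
      (C C' : Multiset (BI L 0)) (T : Finset (Token N)) (n : ℕ)
      (h : Equivalent CT ({c} + C) C') :
      AStep CT P V ⟨S, {c} + B, C, T, n⟩ ⟨S, B, C', T, n⟩
  | apply (r₀ r : ARule L Q N) (ρ : Equiv.Perm ℕ) (S₁ S₂ : List (IAtom L Q))
      (S : Multiset (IAtom L Q)) (B C : Multiset (BI L 0)) (T : Finset (Token N)) (n : ℕ)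
      (mem : r₀ ∈ P) (variant : r = r₀.rename ρ)
      (fresh : Disjoint r.fv (V ∪ AConf.fv (⟨↑S₁ + ↑S₂ + S, B, C, T, n⟩ : AConf L Q N)))
      (keep : SameSymbols (chrL S₁) r.keep) (rem : SameSymbols (chrL S₂) r.rem)
      (entails : EntailsEx CT C (fvL r.keep ∪ fvL r.rem)
        (headEqs (chrL S₁) r.keep + headEqs (chrL S₂) r.rem + r.guard))
      (token : (r.name, idL (S₁ ++ S₂)) ∉ T) :
      AStep CT P V ⟨↑S₁ + ↑S₂ + S, B, C, T, n⟩
        ⟨(inst r.chr r.tok n).1 + ↑S₁ + S, r.bi + B,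
          headEqs (chrL S₁) r.keep + headEqs (chrL S₂) r.rem + C,
          addToken T r.name S₁ S₂ ∪ (inst r.chr r.tok n).2.1, (inst r.chr r.tok n).2.2⟩

/-- The pair `(K, d)` stands for the formula `∃_{-V} (K ∧ d)`. -/
abbrev Answer (L : FirstOrder.Language.{u, v}) (Q : Type*) := Multiset (Atom L Q) × Multiset (BI L 0)

/-- Identification of answers `∃_{-V} (K ∧ d)`: either both are `false` (`d` inconsistent), or they
coincide up to a renaming of the variables outside `V` and up to `CT`-equivalence of `d`. -/
def Answer.Same (CT : L.Theory) (V : Set ℕ) (a b : Answer L Q) : Prop :=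
  (¬ Sat CT a.2 ∧ ¬ Sat CT b.2) ∨
  ∃ ρ : Equiv.Perm ℕ, (∀ x ∈ V, ρ x = x) ∧ b.1 = a.1.map (Atom.subst (ren ρ)) ∧
    Equivalent CT (a.2.map (BI.subst (ren ρ))) b.2

/-- Qualified answers of a CHR program, as a set of answers saturated under `Answer.Same`. -/
def QA (CT : L.Theory) (P : Program L Q N) (G : Goal L Q) : Set (Answer L Q) :=
  {a | ∃ (K : Multiset (IAtom L Q)) (d : Multiset (BI L 0)) (T : Finset (Token N)) (n : ℕ),
    Relation.ReflTransGen (Step CT P G.fv) ⟨↑G.chr, G.bi, 0, 0, ∅, 1⟩ ⟨0, 0, K, d, T, n⟩ ∧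
    (∀ σ, ¬ Step CT P G.fv ⟨0, 0, K, d, T, n⟩ σ) ∧
    Answer.Same CT G.fv (K.map Prod.fst, d) a} ∪
  {a | ¬ Sat CT a.2 ∧ ∃ σ : Conf L Q N, ¬ Sat CT σ.built ∧
    Relation.ReflTransGen (Step CT P G.fv) ⟨↑G.chr, G.bi, 0, 0, ∅, 1⟩ σ}

/-- Qualified answers of an annotated program, as a set of answers saturated under `Answer.Same`. -/
def QA' (CT : L.Theory) (P : Set (ARule L Q N)) (G : Goal L Q) : Set (Answer L Q) :=
  {a | ∃ (K : Multiset (IAtom L Q)) (d : Multiset (BI L 0)) (T : Finset (Token N)) (n : ℕ),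
    Relation.ReflTransGen (AStep CT P G.fv) ⟨label 0 G.chr, G.bi, 0, ∅, G.chr.length⟩
      ⟨K, 0, d, T, n⟩ ∧
    (∀ σ, ¬ AStep CT P G.fv ⟨K, 0, d, T, n⟩ σ) ∧
    Answer.Same CT G.fv (K.map Prod.fst, d) a} ∪
  {a | ¬ Sat CT a.2 ∧ ∃ σ : AConf L Q N, ¬ Sat CT σ.built ∧
    Relation.ReflTransGen (AStep CT P G.fv) ⟨label 0 G.chr, G.bi, 0, ∅, G.chr.length⟩ σ}

end Semantics

section Unfolding

variable {L : FirstOrder.Language.{u, v}} {Q N : Type*} [DecidableEq N]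

open Classical in
/-- `D''`: the constraints `c` of the guard of `v` such that `c θ` is not entailed by the built-in
constraints in the guard and the body of `r`. -/
noncomputable def residualGuard (CT : L.Theory) (r v : ARule L Q N) (θ : ℕ → L.Term ℕ) :
    Multiset (BI L 0) :=
  v.guard.filter fun c => ¬ Entails CT (r.bi + r.guard) {c.subst θ}

/-- `r'` is the result of unfolding `r` with `v` (renamed apart from `r`), using the
sequence of identified atoms of the body of `r` whose identifiers are `ids`. The substitution `θ` acts
on the variables of the head of `v`. -/
def Unfolds (CT : L.Theory) (r v : ARule L Q N) (ids : List ℕ) (r' : ARule L Q N) : Prop :=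
  ∃ (K : Multiset (IAtom L Q)) (S₁ S₂ : List (IAtom L Q)) (θ : ℕ → L.Term ℕ),
    Disjoint v.fv r.fv ∧
    r.chr = K + ↑S₁ + ↑S₂ ∧
    ids = idL (S₁ ++ S₂) ∧
    SameSymbols (chrL S₁) v.keep ∧ SameSymbols (chrL S₂) v.rem ∧
    (∀ x, x ∉ fvL v.keep ∪ fvL v.rem → θ x = .var x) ∧
    Entails CT (r.bi + r.guard)
      (headEqs (chrL S₁) (v.keep.map (Atom.subst θ)) + headEqs (chrL S₂) (v.rem.map (Atom.subst θ))) ∧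
    (v.name, ids) ∉ r.tok ∧
    Sat CT (r.guard + (residualGuard CT r v θ).map (BI.subst θ)) ∧
    r' = {
      name := r.name
      keep := r.keep
      rem := r.rem
      guard := r.guard + (residualGuard CT r v θ).map (BI.subst θ)
      chr := K + ↑S₁ + (inst v.chr v.tok (maxId r.chr r.tok)).1
      bi := v.bi + r.bi + (headEqs (chrL S₁) v.keep + headEqs (chrL S₂) v.rem)
      tok := addToken (clean (K + ↑S₁) r.tok ∪ (inst v.chr v.tok (maxId r.chr r.tok)).2.1)
        v.name S₁ S₂ }

/-- `v` is a variant of a rule of `P`, renamed apart from `r`. -/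
def ApartVariant (P : Set (ARule L Q N)) (r v : ARule L Q N) : Prop :=
  (∃ v₀ ∈ P, IsVariant v₀ v) ∧ Disjoint v.fv r.fv

/-- `U⁺_P(r)`. -/
def UPlus (CT : L.Theory) (P : Set (ARule L Q N)) (r : ARule L Q N) :
    Set (ARule L Q N × List ℕ) :=
  {p | ApartVariant P r p.1 ∧ ∃ r', Unfolds CT r p.1 p.2 r'}

/-- `U^#_P(r)`. The first alternative concerns rules that may fire on atoms of the body of `r` without
giving an unfolding; the second one rules that may fire on some atoms of the
body of `r` together with other constraints `H'`. -/
def USharp (CT : L.Theory) (P : Set (ARule L Q N)) (r : ARule L Q N) : Set (ARule L Q N) :=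
  {v | ApartVariant P r v ∧
    ((∃ (A₁ A₂ : List (IAtom L Q)) (C' : Multiset (BI L 0)),
        (↑A₁ + ↑A₂ : Multiset (IAtom L Q)) ≤ r.chr ∧
        Disjoint (fvs C') v.fv ∧ Sat CT (r.guard + C') ∧
        SameSymbols (chrL A₁) v.keep ∧ SameSymbols (chrL A₂) v.rem ∧
        EntailsEx CT (r.guard + C') (fvL v.keep ∪ fvL v.rem)
          (headEqs (chrL A₁) v.keep + headEqs (chrL A₂) v.rem + v.guard) ∧
        (v.name, idL (A₁ ++ A₂)) ∉ r.tok ∧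
        (v, idL (A₁ ++ A₂)) ∉ UPlus CT P r) ∨
     (∃ (A' : Multiset (IAtom L Q)) (H' : Multiset (Atom L Q)) (C' : Multiset (BI L 0))
        (K₁ K₂ : List (Atom L Q)),
        A' ≤ r.chr ∧ A' ≠ 0 ∧ H' ≠ 0 ∧
        Disjoint (fvs C') v.fv ∧ Sat CT (r.guard + C') ∧
        A'.map Prod.fst + H' = ↑K₁ + ↑K₂ ∧
        SameSymbols K₁ v.keep ∧ SameSymbols K₂ v.rem ∧
        EntailsEx CT (r.guard + C') (fvL v.keep ∪ fvL v.rem)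
          (headEqs K₁ v.keep + headEqs K₂ v.rem + v.guard)))}

/-- `Unf_P(r)`: all rules obtained by unfolding `r` with a rule of `P`. -/
def Unf (CT : L.Theory) (P : Set (ARule L Q N)) (r : ARule L Q N) : Set (ARule L Q N) :=
  {r' | ∃ (v : ARule L Q N) (ids : List ℕ), ApartVariant P r v ∧ Unfolds CT r v ids r'}

/-- The rule `r` can be safely replaced in `P` by its unfolded versions. -/
def SafelyReplaceable (CT : L.Theory) (P : Set (ARule L Q N)) (r : ARule L Q N) : Prop :=
  r ∈ P ∧ USharp CT P r = ∅ ∧ (UPlus CT P r).Nonempty ∧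
    ∀ r' ∈ Unf CT P r, Equivalent CT r.guard r'.guard

/-- `P' = (P \ {r}) ∪ Unf_P(r)` for a safely replaceable rule `r`. As rules are
identified up to renaming of variables, `U` stands for any set of representatives of `Unf_P(r)`
(possibly all of it). -/
def SafeReplacement (CT : L.Theory) (P P' : Set (ARule L Q N)) : Prop :=
  ∃ r, SafelyReplaceable CT P r ∧ ∃ U : Set (ARule L Q N), U ⊆ Unf CT P r ∧
    (∀ r' ∈ Unf CT P r, ∃ u ∈ U, IsVariant u r') ∧ P' = (P \ {r}) ∪ U

/-- `S 0, …, S n` is a U-sequence starting from `P`. -/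
def IsUSequence (CT : L.Theory) (P : Set (ARule L Q N)) (n : ℕ)
    (S : Fin (n + 1) → Set (ARule L Q N)) : Prop :=
  S 0 = P ∧ ∀ i : Fin n, SafeReplacement CT (S i.castSucc) (S i.succ)

end Unfolding

end CHR

open CHR

/-!
Both sets of answers are described by one auxiliary relation, `Reach`, the answers of an *eager*
semantics for annotated rules: built-in constraints enter the store at once, the constraints of a body
get arbitrary unused identifiers, and all variables and identifiers ever used are recorded, so that
later choices avoid them. The answers of the eager semantics do not depend on the names of variables
and identifiers, nor on the recorded sets, nor on tokens with a dead identifier (`Reach.lift`). Hence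
it gives the answers of `ω_t'` for well-formed annotated programs (`mem_QA'_iff`) and, for an annotated
version `Ann P`, those of `ω_t` (`mem_QA_iff`). In both cases it suffices to look at derivations that
solve, and for `ω_t` introduce, everything before the next rule is applied. In particular `Ann P`
has the answers of `P`, and what is left is that one safe replacement preserves the answers of the eager
semantics (`SafeReplacement.QA'_eq`).

Let `r` be safely replaceable. After `r` has fired, the configuration contains its body, and the store
entails the guard of `r`: by injectivity of the function symbols, the equations between the head and
the constraints used determine the variables of the head (`fire_entails_guard`). As long as no
constraint of this body is touched, it stays a `Block`, on which every rule by which `r` unfolds can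
fire (`Block.canFire`); the residual guard of the unfolding is entailed because the unfolded guard is
equivalent to that of `r`. Such a rule exists, so no configuration with a block is final. Conversely,
since `USharp` is empty, a rule that touches the block in a consistent configuration uses constraints
of the block only, and is a rule by which `r` unfolds (`Block.unfoldsBy`, `Block.not_mixed`). Rules firing elsewhere commute with
it. So the application that uses the block may be moved to the front, without making the derivation
longer (`Reach.use_block`).

Firing `r` and then a rule by which it unfolds has the effect of firing the unfolded rule, up to
tokens removed by `clean`, which have a dead identifier (`fire_unfold_iff`). By induction on the number
of rule applications this turns derivations of the old program into derivations of the new one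
(`Reach.replace`). Replacing each unfolded rule by the two rules it comes from gives the converse
(`Reach.of_replace`). Final configurations are the same, since `r` and its unfolded versions have the
same head and equivalent guards.
-/

namespace CHR

/-! ### Terms and built-in constraints under substitution -/

section Terms

variable {L : FirstOrder.Language.{u, v}} {α β γ : Type*}

theorem term_subst_subst (t : L.Term α) (θ : α → L.Term β) (η : β → L.Term γ) :
    (t.subst θ).subst η = t.subst fun x => (θ x).subst η := by
  induction t with
  | var x => rfl
  | func f ts ih => simp only [Language.Term.subst, ih]

theorem term_relabel_eq_subst (t : L.Term α) (g : α → β) :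
    t.relabel g = t.subst fun x => .var (g x) := by
  induction t with
  | var x => rfl
  | func f ts ih => simp only [Language.Term.subst, Language.Term.relabel, ih]

theorem term_subst_var (t : L.Term α) : t.subst .var = t := by
  induction t with
  | var x => rfl
  | func f ts ih => simp only [Language.Term.subst, ih]

theorem term_subst_congr [DecidableEq α] (t : L.Term α) {θ η : α → L.Term β}
    (h : ∀ x ∈ t.varFinset, θ x = η x) : t.subst θ = t.subst η := by
  induction t with
  | var x => exact h x (by simp [Language.Term.varFinset])
  | func f ts ih =>
    simp only [Language.Term.subst]
    congr 1; funext i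
    exact ih i fun x hx => h x (by
      simp only [Language.Term.varFinset, Finset.mem_biUnion]; exact ⟨i, by simp, hx⟩)

theorem term_realize_congr [DecidableEq α] {M : Type*} [L.Structure M] (t : L.Term α)
    {w w' : α → M} (h : ∀ x ∈ t.varFinset, w x = w' x) : t.realize w = t.realize w' := by
  induction t with
  | var x => exact h x (by simp [Language.Term.varFinset])
  | func f ts ih =>
    simp only [Language.Term.realize]
    congr 1; funext i
    exact ih i fun x hx => h x (by
      simp only [Language.Term.varFinset, Finset.mem_biUnion]; exact ⟨i, by simp, hx⟩)

theorem mem_varFinsetLeft [DecidableEq α] (t : L.Term (α ⊕ β)) (x : α) [DecidableEq (α ⊕ β)] :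
    x ∈ t.varFinsetLeft ↔ Sum.inl x ∈ t.varFinset := by
  induction t with
  | var y => cases y <;> simp [Language.Term.varFinset, Language.Term.varFinsetLeft]
  | func f ts ih => simp [Language.Term.varFinset, Language.Term.varFinsetLeft, ih]

theorem mem_varFinset_subst [DecidableEq α] [DecidableEq β] (t : L.Term α) (θ : α → L.Term β)
    (y : β) : y ∈ (t.subst θ).varFinset ↔ ∃ x ∈ t.varFinset, y ∈ (θ x).varFinset := by
  induction t with
  | var x => simp [Language.Term.varFinset, Language.Term.subst]
  | func f ts ih =>
    simp only [Language.Term.varFinset, Language.Term.subst, Finset.mem_biUnion, ih]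
    constructor
    · rintro ⟨i, hi, x, hx, hy⟩; exact ⟨x, ⟨i, hi, hx⟩, hy⟩
    · rintro ⟨x, ⟨i, hi, hx⟩, hy⟩; exact ⟨i, hi, x, hx, hy⟩

theorem mem_varFinset_relabel [DecidableEq α] [DecidableEq β] (t : L.Term α) (g : α → β) (y : β) :
    y ∈ (t.relabel g).varFinset ↔ ∃ x ∈ t.varFinset, g x = y := by
  rw [term_relabel_eq_subst, mem_varFinset_subst]
  simp [Language.Term.varFinset, eq_comm]

/-- The substitution `θ` on free variables, extended by the identity on bound variables. -/
abbrev liftSubst (θ : ℕ → L.Term ℕ) (n : ℕ) : ℕ ⊕ Fin n → L.Term (ℕ ⊕ Fin n) :=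
  Sum.elim (fun x => (θ x).relabel Sum.inl) (fun i => .var (.inr i))

theorem liftSubst_subst (t : L.Term ℕ) (θ : ℕ → L.Term ℕ) (n : ℕ) :
    (t.relabel Sum.inl).subst (liftSubst θ n) = (t.subst θ).relabel Sum.inl := by
  simp only [term_relabel_eq_subst, term_subst_subst]
  congr 1; funext x; simp [Language.Term.subst, term_relabel_eq_subst]

theorem subst_liftSubst_comp {n : ℕ} (t : L.Term (ℕ ⊕ Fin n)) (θ η : ℕ → L.Term ℕ) :
    (t.subst (liftSubst θ n)).subst (liftSubst η n)
      = t.subst (liftSubst (fun x => (θ x).subst η) n) := by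
  rw [term_subst_subst]
  congr 1; funext x
  rcases x with x | i
  · exact liftSubst_subst _ _ _
  · rfl

theorem realize_liftSubst {M : Type*} [L.Structure M] {n : ℕ} (t : L.Term (ℕ ⊕ Fin n))
    (θ : ℕ → L.Term ℕ) (w : ℕ → M) (xs : Fin n → M) :
    (t.subst (liftSubst θ n)).realize (Sum.elim w xs)
      = t.realize (Sum.elim (fun x => (θ x).realize w) xs) := by
  rw [Language.Term.realize_subst]
  congr 1; funext x
  rcases x with x | i
  · simp [Language.Term.realize_relabel]
  · rfl

theorem mem_varFinsetLeft_liftSubst_ren {n : ℕ} (t : L.Term (ℕ ⊕ Fin n)) (ρ : Equiv.Perm ℕ)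
    (x : ℕ) : x ∈ (t.subst (liftSubst (ren ρ) n)).varFinsetLeft ↔ ρ.symm x ∈ t.varFinsetLeft := by
  classical
  rw [mem_varFinsetLeft, mem_varFinsetLeft, mem_varFinset_subst]
  constructor
  · rintro ⟨y | i, hy, h⟩
    · simp [ren, Language.Term.relabel, Language.Term.varFinset] at h
      simpa [h] using hy
    · simp [Language.Term.varFinset] at h
  · intro h
    exact ⟨_, h, by simp [ren, Language.Term.relabel, Language.Term.varFinset]⟩

/-- In a model of Clark's equality theory the value of a term determines the values of its variables. -/
theorem term_realize_inj {CT : L.Theory} (hCT : ClarkEquality CT)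
    (M : CT.ModelType.{u, v, max u v}) (t : L.Term ℕ) {w w' : ℕ → M}
    (h : t.realize w = t.realize w') : ∀ x ∈ t.varFinset, w x = w' x := by
  induction t with
  | var x => intro y hy; simp [Language.Term.varFinset] at hy; subst hy; exact h
  | func f ts ih =>
    intro x hx
    simp only [Language.Term.varFinset, Finset.mem_biUnion] at hx
    obtain ⟨i, -, hx⟩ := hx
    exact ih i (congrFun (hCT.injective M _ f _ _ h) i) x hx

end Terms

section BuiltInSubst

variable {L : FirstOrder.Language.{u, v}}

theorem BI.subst_subst {n : ℕ} (c : BI L n) (θ η : ℕ → L.Term ℕ) :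
    (c.subst θ).subst η = c.subst fun x => (θ x).subst η := by
  induction c with
  | eq s t => simp only [BI.subst]; congr 1 <;> exact subst_liftSubst_comp _ _ _
  | rel R ts => simp only [BI.subst]; congr 1; funext i; exact subst_liftSubst_comp _ _ _
  | and c d hc hd => simp only [BI.subst, hc, hd]
  | ex c hc => simp only [BI.subst, hc]

theorem BI.realize_subst {M : Type*} [L.Structure M] {n : ℕ} (c : BI L n) (θ : ℕ → L.Term ℕ)
    (w : ℕ → M) (xs : Fin n → M) :
    (c.subst θ).Realize w xs ↔ c.Realize (fun x => (θ x).realize w) xs := by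
  induction c with
  | eq s t => simp only [BI.subst, BI.Realize]; erw [realize_liftSubst, realize_liftSubst]
  | rel R ts =>
    simp only [BI.subst, BI.Realize]
    have : ∀ i, ((ts i).subst (liftSubst θ _)).realize (Sum.elim w xs) = _ :=
      fun i => realize_liftSubst (ts i) θ w xs
    simp only [this]
  | and c d hc hd => simp only [BI.subst, BI.Realize, hc, hd]
  | ex c hc => simp only [BI.subst, BI.Realize, hc]

theorem BI.realize_congr {M : Type*} [L.Structure M] {n : ℕ} (c : BI L n) {w w' : ℕ → M}
    (h : ∀ x ∈ c.fv, w x = w' x) (xs : Fin n → M) : c.Realize w xs ↔ c.Realize w' xs := by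
  classical
  have key : ∀ {n : ℕ} (t : L.Term (ℕ ⊕ Fin n)) (xs : Fin n → M),
      (∀ x ∈ t.varFinsetLeft, w x = w' x) →
      t.realize (Sum.elim w xs) = t.realize (Sum.elim w' xs) := by
    intro n t xs ht
    refine term_realize_congr t ?_
    rintro (x | i) hx
    · exact ht x ((mem_varFinsetLeft t x).2 hx)
    · rfl
  induction c with
  | eq s t =>
    simp only [BI.Realize]
    rw [key s xs fun x hx => h x (Or.inl (by simpa using hx)),
      key t xs fun x hx => h x (Or.inr (by simpa using hx))]
  | rel R ts =>
    simp only [BI.Realize]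
    have : ∀ i, (ts i).realize (Sum.elim w xs) = _ := fun i => key (ts i) xs fun x hx => h x ⟨i, hx⟩
    simp only [this]
  | and c d hc hd =>
    simp only [BI.Realize]
    exact and_congr (hc (fun x hx => h x (Or.inl hx)) xs) (hd (fun x hx => h x (Or.inr hx)) xs)
  | ex c hc =>
    simp only [BI.Realize]
    exact exists_congr fun a => hc (fun x hx => h x hx) _

theorem BI.subst_congr {n : ℕ} (c : BI L n) {θ η : ℕ → L.Term ℕ} (h : ∀ x ∈ c.fv, θ x = η x) :
    c.subst θ = c.subst η := by
  classical
  have key : ∀ {n : ℕ} (t : L.Term (ℕ ⊕ Fin n)), (∀ x ∈ t.varFinsetLeft, θ x = η x) →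
      t.subst (liftSubst θ n) = t.subst (liftSubst η n) := by
    intro n t ht
    refine term_subst_congr t ?_
    rintro (x | i) hx
    · simp [ht x ((mem_varFinsetLeft t x).2 hx)]
    · rfl
  induction c with
  | eq s t =>
    simp only [BI.subst]
    congr 1
    · exact key s fun x hx => h x (Or.inl (by simpa using hx))
    · exact key t fun x hx => h x (Or.inr (by simpa using hx))
  | rel R ts => simp only [BI.subst]; congr 1; funext i; exact key (ts i) fun x hx => h x ⟨i, hx⟩
  | and c d hc hd =>
    simp only [BI.subst]
    rw [hc (fun x hx => h x (Or.inl hx)), hd fun x hx => h x (Or.inr hx)]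
  | ex c hc => simp only [BI.subst]; rw [hc fun x hx => h x hx]

theorem BI.subst_var {n : ℕ} (c : BI L n) : c.subst .var = c := by
  have key : ∀ {n : ℕ} (t : L.Term (ℕ ⊕ Fin n)), t.subst (liftSubst .var n) = t := by
    intro n t
    have : liftSubst (L := L) .var n = .var := by funext x; rcases x with x | i <;> rfl
    rw [this, term_subst_var]
  induction c with
  | eq s t => simp only [BI.subst]; congr 1 <;> exact key _
  | rel R ts => simp only [BI.subst]; congr 1; funext i; exact key _
  | and c d hc hd => simp only [BI.subst, hc, hd]
  | ex c hc => simp only [BI.subst, hc]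

theorem BI.mem_fv_ren {n : ℕ} (c : BI L n) (ρ : Equiv.Perm ℕ) (x : ℕ) :
    x ∈ (c.subst (ren ρ)).fv ↔ ρ.symm x ∈ c.fv := by
  induction c with
  | eq s t =>
    simp only [BI.subst, BI.fv, Set.mem_union, Finset.mem_coe]
    erw [mem_varFinsetLeft_liftSubst_ren, mem_varFinsetLeft_liftSubst_ren]
  | rel R ts =>
    simp only [BI.subst, BI.fv, Set.mem_ofPred_eq]
    exact exists_congr fun i => mem_varFinsetLeft_liftSubst_ren _ _ _
  | and c d hc hd => simp only [BI.subst, BI.fv, Set.mem_union, hc, hd]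
  | ex c hc => simpa only [BI.subst, BI.fv] using hc

theorem BI.fv_finite {n : ℕ} (c : BI L n) : c.fv.Finite := by
  induction c with
  | eq s t => exact (Finset.finite_toSet _).union (Finset.finite_toSet _)
  | rel R ts =>
    have : (BI.rel R ts).fv = ⋃ i, ((ts i).varFinsetLeft : Set ℕ) := by
      ext x; simp [BI.fv]
    rw [this]; exact Set.finite_iUnion fun i => Finset.finite_toSet _
  | and c d hc hd => exact hc.union hd
  | ex c hc => exact hc

theorem ren_comp (ρ π : Equiv.Perm ℕ) :
    (fun x => (ren (L := L) ρ x).subst (ren π)) = ren (ρ.trans π) := rfl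

theorem holds_add {M : Type*} [L.Structure M] (w : ℕ → M) (C D : Multiset (BI L 0)) :
    Holds w (C + D) ↔ Holds w C ∧ Holds w D := by
  simp only [Holds, Multiset.mem_add]
  exact ⟨fun h => ⟨fun c hc => h c (Or.inl hc), fun c hc => h c (Or.inr hc)⟩,
    fun h c hc => hc.elim (h.1 c) (h.2 c)⟩

theorem holds_map_subst {M : Type*} [L.Structure M] (w : ℕ → M) (C : Multiset (BI L 0))
    (θ : ℕ → L.Term ℕ) :
    Holds w (C.map (BI.subst θ)) ↔ Holds (fun x => (θ x).realize w) C := by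
  simp only [Holds, Multiset.mem_map, forall_exists_index, and_imp, forall_apply_eq_imp_iff₂,
    BI.realize_subst]

theorem holds_map_ren {M : Type*} [L.Structure M] (w : ℕ → M) (C : Multiset (BI L 0))
    (ρ : Equiv.Perm ℕ) : Holds w (C.map (BI.subst (ren ρ))) ↔ Holds (w ∘ ρ) C :=
  holds_map_subst w C _

theorem holds_congr {M : Type*} [L.Structure M] {w w' : ℕ → M} {C : Multiset (BI L 0)}
    (h : ∀ x ∈ fvs C, w x = w' x) : Holds w C ↔ Holds w' C :=
  forall₂_congr fun c hc => BI.realize_congr c (fun x hx => h x ⟨c, hc, hx⟩) _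

theorem fvs_add (C D : Multiset (BI L 0)) : fvs (C + D) = fvs C ∪ fvs D := by
  ext x; simp only [fvs, Multiset.mem_add, Set.mem_ofPred_eq, Set.mem_union, or_and_right, exists_or]

theorem mem_fvs_ren (C : Multiset (BI L 0)) (ρ : Equiv.Perm ℕ) (x : ℕ) :
    x ∈ fvs (C.map (BI.subst (ren ρ))) ↔ ρ.symm x ∈ fvs C := by
  simp [fvs, BI.mem_fv_ren]

theorem fvs_finite (C : Multiset (BI L 0)) : (fvs C).Finite := by
  classical
  have : fvs C = ⋃ c ∈ C.toFinset, c.fv := by ext x; simp [fvs]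
  rw [this]; exact Set.Finite.biUnion (Finset.finite_toSet _) fun c _ => c.fv_finite

theorem mapBI_ren_trans (C : Multiset (BI L 0)) (ρ π : Equiv.Perm ℕ) :
    (C.map (BI.subst (ren ρ))).map (BI.subst (ren π)) = C.map (BI.subst (ren (ρ.trans π))) := by
  rw [Multiset.map_map]
  exact Multiset.map_congr rfl fun c _ => BI.subst_subst c _ _

theorem mapBI_ren_congr (C : Multiset (BI L 0)) {ρ π : Equiv.Perm ℕ} (h : ∀ x ∈ fvs C, ρ x = π x) :
    C.map (BI.subst (ren ρ)) = C.map (BI.subst (ren π)) :=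
  Multiset.map_congr rfl fun c hc => BI.subst_congr c fun x hx => by
    simp only [ren]; rw [h x ⟨c, hc, hx⟩]

theorem mapBI_refl (C : Multiset (BI L 0)) : C.map (BI.subst (ren (Equiv.refl ℕ))) = C := by
  conv_rhs => rw [← Multiset.map_id C]
  exact Multiset.map_congr rfl fun c _ => BI.subst_var c

end BuiltInSubst

/-! ### Renaming of atoms and equations between heads -/

section AtomLemmas

variable {L : FirstOrder.Language.{u, v}} {Q N : Type*}

theorem Atom.subst_subst (a : Atom L Q) (θ η : ℕ → L.Term ℕ) :
    (a.subst θ).subst η = a.subst fun x => (θ x).subst η := by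
  simp only [Atom.subst, List.map_map]
  congr 1
  exact List.map_congr_left fun t _ => term_subst_subst t _ _

theorem Atom.subst_congr (a : Atom L Q) {θ η : ℕ → L.Term ℕ} (h : ∀ x ∈ a.fv, θ x = η x) :
    a.subst θ = a.subst η := by
  simp only [Atom.subst]
  congr 1
  exact List.map_congr_left fun t ht => term_subst_congr t fun x hx => h x ⟨t, ht, hx⟩

theorem Atom.subst_var (a : Atom L Q) : a.subst .var = a := by
  cases a with | mk p l =>
  simp only [Atom.subst]
  congr 1
  conv_rhs => rw [← List.map_id l]
  exact List.map_congr_left fun t _ => term_subst_var t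

theorem Atom.mem_fv_ren (a : Atom L Q) (ρ : Equiv.Perm ℕ) (x : ℕ) :
    x ∈ (a.subst (ren ρ)).fv ↔ ρ.symm x ∈ a.fv := by
  simp only [Atom.fv, Atom.subst, List.mem_map, Set.mem_ofPred_eq, exists_exists_and_eq_and,
    mem_varFinset_subst]
  refine exists_congr fun t => and_congr_right fun _ => ?_
  constructor
  · rintro ⟨y, hy, h⟩
    simp [ren, Language.Term.varFinset] at h
    simpa [h] using hy
  · intro h; exact ⟨_, h, by simp [ren, Language.Term.varFinset]⟩

theorem Atom.fv_finite (a : Atom L Q) : a.fv.Finite := by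
  classical
  have : a.fv = ⋃ t ∈ a.args.toFinset, (t.varFinset : Set ℕ) := by ext x; simp [Atom.fv]
  rw [this]; exact Set.Finite.biUnion (Finset.finite_toSet _) fun c _ => Finset.finite_toSet _

theorem mem_fvL_ren (H : List (Atom L Q)) (ρ : Equiv.Perm ℕ) (x : ℕ) :
    x ∈ fvL (H.map (Atom.subst (ren ρ))) ↔ ρ.symm x ∈ fvL H := by
  simp [fvL, Atom.mem_fv_ren]

theorem fvL_finite (H : List (Atom L Q)) : (fvL H).Finite := by
  classical
  induction H with
  | nil => simp [fvL]
  | cons a H ih =>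
    have : fvL (a :: H) = a.fv ∪ fvL H := by ext x; simp [fvL]
    rw [this]; exact a.fv_finite.union ih

theorem fvI_add (A B : Multiset (IAtom L Q)) : fvI (A + B) = fvI A ∪ fvI B := by
  ext x; simp only [fvI, Multiset.mem_add, Set.mem_ofPred_eq, Set.mem_union, or_and_right, exists_or]

theorem fvI_coe (S : List (IAtom L Q)) : fvI (S : Multiset (IAtom L Q)) = fvL (chrL S) := by
  ext x; simp only [fvI, fvL, chrL, Multiset.mem_coe, List.mem_map, Set.mem_ofPred_eq]
  constructor
  · rintro ⟨a, ha, hx⟩; exact ⟨a.1, ⟨a, ha, rfl⟩, hx⟩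
  · rintro ⟨_, ⟨a, ha, rfl⟩, hx⟩; exact ⟨a, ha, hx⟩

theorem fvI_finite (A : Multiset (IAtom L Q)) : (fvI A).Finite := by
  induction A using Quotient.inductionOn with
  | h S => exact (fvI_coe S) ▸ fvL_finite _

theorem sameSymbols_ren {H H' : List (Atom L Q)} (θ η : ℕ → L.Term ℕ) :
    SameSymbols (H.map (Atom.subst θ)) (H'.map (Atom.subst η)) ↔ SameSymbols H H' := by
  simp [SameSymbols, Atom.subst, List.forall₂_map_left_iff, List.forall₂_map_right_iff]

/-- The values of the arguments in a sequence of CHR constraints. -/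
def argValues {M : Type*} [L.Structure M] (w : ℕ → M) (H : List (Atom L Q)) : List (List M) :=
  H.map fun a => a.args.map fun t => t.realize w

theorem realize_termEq {M : Type*} [L.Structure M] (w : ℕ → M) (s t : L.Term ℕ) :
    (termEq s t).Realize w Fin.elim0 ↔ s.realize w = t.realize w := by
  simp only [termEq, BI.Realize, Language.Term.realize_relabel]
  rfl

/-- The equations between two sequences say that their arguments have the same values. -/
theorem holds_headEqs {M : Type*} [L.Structure M] (w : ℕ → M) {H H' : List (Atom L Q)}
    (h : SameSymbols H H') : Holds w (headEqs H H') ↔ argValues w H = argValues w H' := by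
  have key : ∀ l l' : List (L.Term ℕ), l.length = l'.length →
      ((∀ c ∈ List.zipWith termEq l l', c.Realize w Fin.elim0) ↔
        l.map (fun t => t.realize w) = l'.map fun t => t.realize w) := by
    intro l
    induction l with
    | nil => intro l' hl; cases l' <;> simp_all
    | cons t l ih =>
      intro l' hl
      cases l' with
      | nil => simp at hl
      | cons t' l' =>
        simp only [List.zipWith_cons_cons, List.mem_cons, forall_eq_or_imp, List.map_cons,
          List.cons.injEq, realize_termEq]
        rw [ih l' (by simpa using hl)]
  induction h with
  | nil => simp [headEqs, argValues, Holds]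
  | @cons a b H H' hab _ ih =>
    simp only [Holds, headEqs, argValues, Multiset.mem_coe] at ih ⊢
    simp only [List.zipWith_cons_cons, List.flatten_cons, List.mem_append, List.map_cons,
      List.cons.injEq, or_imp, forall_and, key _ _ hab.2]
    exact and_congr_right fun _ => ih

theorem argValues_subst {M : Type*} [L.Structure M] (w : ℕ → M) (H : List (Atom L Q))
    (θ : ℕ → L.Term ℕ) :
    argValues w (H.map (Atom.subst θ)) = argValues (fun x => (θ x).realize w) H := by
  simp [argValues, Atom.subst, Language.Term.realize_subst, Function.comp_def]

theorem argValues_congr {M : Type*} [L.Structure M] {w w' : ℕ → M} {H : List (Atom L Q)}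
    (h : ∀ x ∈ fvL H, w x = w' x) : argValues w H = argValues w' H :=
  List.map_congr_left fun a ha => List.map_congr_left fun t ht =>
    term_realize_congr t fun x hx => h x ⟨a, ha, t, ht, hx⟩

/-- In a model of Clark's equality theory the values of the arguments determine those of the
variables. -/
theorem argValues_inj {CT : L.Theory} (hCT : ClarkEquality CT) (M : CT.ModelType.{u, v, max u v})
    {w w' : ℕ → M} {H : List (Atom L Q)} (h : argValues w H = argValues w' H) :
    ∀ x ∈ fvL H, w x = w' x := by
  rintro x ⟨a, ha, t, ht, hx⟩
  exact term_realize_inj hCT M t (List.map_inj_left.1 (List.map_inj_left.1 h a ha) t ht) x hx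

theorem headEqs_map (H H' : List (Atom L Q)) (θ : ℕ → L.Term ℕ) :
    (headEqs H H').map (BI.subst θ)
      = headEqs (H.map (Atom.subst θ)) (H'.map (Atom.subst θ)) := by
  have hterm : ∀ s t : L.Term ℕ, (termEq s t).subst θ = termEq (s.subst θ) (t.subst θ) := by
    intro s t
    simp only [termEq, BI.subst]
    congr 1 <;> exact liftSubst_subst _ _ _
  simp only [headEqs, Multiset.map_coe, List.map_flatten, List.map_zipWith, List.zipWith_map,
    hterm, Atom.subst]

theorem fvs_headEqs {H H' : List (Atom L Q)} (h : SameSymbols H H') :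
    fvs (headEqs H H') = fvL H ∪ fvL H' := by
  classical
  have hterm : ∀ s t : L.Term ℕ, ∀ x, x ∈ (termEq s t).fv ↔ x ∈ s.varFinset ∨ x ∈ t.varFinset := by
    intro s t x
    simp [termEq, BI.fv, mem_varFinsetLeft, mem_varFinset_relabel]
  have key : ∀ l l' : List (L.Term ℕ), l.length = l'.length → ∀ x,
      ((∃ c ∈ List.zipWith termEq l l', x ∈ c.fv) ↔
        (∃ t ∈ l, x ∈ t.varFinset) ∨ ∃ t ∈ l', x ∈ t.varFinset) := by
    intro l
    induction l with
    | nil => intro l' hl; cases l' <;> simp_all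
    | cons t l ih =>
      intro l' hl x
      cases l' with
      | nil => simp at hl
      | cons t' l' =>
        simp only [List.zipWith_cons_cons, List.mem_cons, exists_eq_or_imp, hterm]
        rw [ih l' (by simpa using hl)]
        exact or_or_or_comm
  ext x
  induction h with
  | nil => simp [headEqs, fvs, fvL]
  | @cons a b H H' hab _ ih =>
    simp only [fvs, headEqs, fvL, Multiset.mem_coe, Set.mem_ofPred_eq, Set.mem_union] at ih ⊢
    simp only [List.zipWith_cons_cons, List.flatten_cons, List.mem_append, List.mem_cons,
      or_and_right, exists_or, exists_eq_left]
    rw [ih, key _ _ hab.2]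
    exact or_or_or_comm

end AtomLemmas

/-! ### Permutations extending finite maps -/

/-- A permutation can be changed so as to keep its values on a finite set `A` and to send `g j` to
`g' j` for `j` in a finite set `B`, if this is compatible with injectivity. -/
theorem exists_perm_extend {ι : Type*} (f : Equiv.Perm ℕ) (A : Set ℕ) {B : Set ι} (hB : B.Finite)
    {g g' : ι → ℕ} (hg : Set.InjOn g B) (hg' : Set.InjOn g' B) (hA : ∀ j ∈ B, g j ∉ A)
    (hA' : ∀ j ∈ B, ∀ a ∈ A, f a ≠ g' j) :
    ∃ π : Equiv.Perm ℕ, (∀ a ∈ A, π a = f a) ∧ ∀ j ∈ B, π (g j) = g' j := by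
  induction B, hB using Set.Finite.induction_on with
  | empty => exact ⟨f, fun _ _ => rfl, by simp⟩
  | @insert j B hj _ ih =>
    obtain ⟨π, h₁, h₂⟩ := ih (hg.mono (Set.subset_insert _ _)) (hg'.mono (Set.subset_insert _ _))
      (fun k hk => hA k (Or.inr hk)) fun k hk => hA' k (Or.inr hk)
    -- composing with this transposition corrects the value at `g j` and affects no other prescribed one
    refine ⟨π.trans (Equiv.swap (π (g j)) (g' j)), fun a ha => ?_, ?_⟩
    · have h3 : π a ≠ π (g j) := fun h => hA j (Or.inl rfl) (π.injective h ▸ ha)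
      have h4 : π a ≠ g' j := h₁ a ha ▸ hA' j (Or.inl rfl) a ha
      rw [Equiv.trans_apply, Equiv.swap_apply_of_ne_of_ne h3 h4, h₁ a ha]
    · rintro k (rfl | hk)
      · simp
      · have h5 : k ≠ j := fun h => hj (h ▸ hk)
        have h3 : π (g k) ≠ π (g j) := fun h => h5 (hg (Or.inr hk) (Or.inl rfl) (π.injective h))
        have h4 : π (g k) ≠ g' j := h₂ k hk ▸ fun h => h5 (hg' (Or.inr hk) (Or.inl rfl) h)
        rw [Equiv.trans_apply, Equiv.swap_apply_of_ne_of_ne h3 h4, h₂ k hk]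

/-- A permutation can be changed outside `A` so as to move a finite set `B` off a finite set `Y`. -/
theorem exists_perm_fresh (f : Equiv.Perm ℕ) {A B Y : Set ℕ} (hA : A.Finite) (hB : B.Finite)
    (hY : Y.Finite) (hAB : Disjoint B A) :
    ∃ π : Equiv.Perm ℕ, (∀ a ∈ A, π a = f a) ∧ ∀ j ∈ B, π j ∉ Y := by
  obtain ⟨m, hm⟩ := ((hA.image f).union hY).bddAbove
  have hlt : ∀ j : ℕ, ∀ y ∈ f '' A ∪ Y, y ≠ j + (m + 1) := fun j y hy h => by
    have := hm hy; omega
  obtain ⟨π, h₁, h₂⟩ := exists_perm_extend (g := id) (g' := fun j => j + (m + 1)) f A hB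
    Function.injective_id.injOn (fun i _ j _ h => by simpa using h)
    (fun j hj ha => Set.disjoint_left.1 hAB hj ha)
    (fun j _ a ha => hlt j _ (Or.inl ⟨a, ha, rfl⟩))
  exact ⟨π, h₁, fun j hj hy => hlt j _ (Or.inr hy) (h₂ j hj)⟩


/-! ### Variants of annotated rules -/

section Variants

variable {L : FirstOrder.Language.{u, v}} {Q N : Type*}

/-- The simultaneous renaming of the variables and of the identifier of an identified constraint. -/
def IAtom.act (ρ : Equiv.Perm ℕ) (f : ℕ → ℕ) (a : IAtom L Q) : IAtom L Q :=
  (a.1.subst (ren ρ), f a.2)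

theorem mapAtom_ren_trans (H : List (Atom L Q)) (ρ π : Equiv.Perm ℕ) :
    (H.map (Atom.subst (ren ρ))).map (Atom.subst (ren π)) = H.map (Atom.subst (ren (ρ.trans π))) := by
  rw [List.map_map]
  exact List.map_congr_left fun a _ => Atom.subst_subst a _ _

theorem mapAtom_ren_congr {H : List (Atom L Q)} {ρ π : Equiv.Perm ℕ} (h : ∀ x ∈ fvL H, ρ x = π x) :
    H.map (Atom.subst (ren ρ)) = H.map (Atom.subst (ren π)) :=
  List.map_congr_left fun a ha => Atom.subst_congr a fun x hx => by
    simp only [ren]; rw [h x ⟨a, ha, hx⟩]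

theorem mapAtom_refl (H : List (Atom L Q)) : H.map (Atom.subst (ren (Equiv.refl ℕ))) = H := by
  conv_rhs => rw [← List.map_id H]
  exact List.map_congr_left fun a _ => Atom.subst_var a

theorem act_trans (ρ π : Equiv.Perm ℕ) (f g : ℕ → ℕ) (a : IAtom L Q) :
    (a.act ρ f).act π g = a.act (ρ.trans π) (g ∘ f) :=
  Prod.ext (Atom.subst_subst a.1 _ _) rfl

theorem act_refl (a : IAtom L Q) : a.act (Equiv.refl ℕ) id = a := Prod.ext (Atom.subst_var a.1) rfl

theorem act_congr {A : Multiset (IAtom L Q)} {ρ π : Equiv.Perm ℕ} {f g : ℕ → ℕ}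
    (h : ∀ x ∈ fvI A, ρ x = π x) (h' : ∀ i ∈ A.map Prod.snd, f i = g i) :
    A.map (IAtom.act ρ f) = A.map (IAtom.act π g) :=
  Multiset.map_congr rfl fun a ha => Prod.ext
    (Atom.subst_congr a.1 fun x hx => by simp only [ren]; rw [h x ⟨a, ha, hx⟩])
    (h' _ (Multiset.mem_map_of_mem _ ha))

theorem map_act_refl (A : Multiset (IAtom L Q)) : A.map (IAtom.act (Equiv.refl ℕ) id) = A := by
  conv_rhs => rw [← Multiset.map_id A]
  exact Multiset.map_congr rfl fun a _ => act_refl a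

theorem mem_fvI_act (A : Multiset (IAtom L Q)) (ρ : Equiv.Perm ℕ) (f : ℕ → ℕ) (x : ℕ) :
    x ∈ fvI (A.map (IAtom.act ρ f)) ↔ ρ.symm x ∈ fvI A := by
  simp [fvI, IAtom.act, Atom.mem_fv_ren]

theorem chrL_act (S : List (IAtom L Q)) (ρ : Equiv.Perm ℕ) (f : ℕ → ℕ) :
    chrL (S.map (IAtom.act ρ f)) = (chrL S).map (Atom.subst (ren ρ)) := by
  simp [chrL, IAtom.act, Function.comp_def]

theorem idL_act (S : List (IAtom L Q)) (ρ : Equiv.Perm ℕ) (f : ℕ → ℕ) :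
    idL (S.map (IAtom.act ρ f)) = (idL S).map f := by
  simp [idL, IAtom.act, Function.comp_def]

/-- The identifiers occurring in the body or in the token store of a rule. -/
def ARule.ids (w : ARule L Q N) : Set ℕ :=
  {i | i ∈ w.chr.map Prod.snd ∨ ∃ t ∈ w.tok, i ∈ t.2}

theorem ARule.ids_finite (w : ARule L Q N) : w.ids.Finite := by
  classical
  refine Set.Finite.union (s := {i | i ∈ w.chr.map Prod.snd}) (t := {i | ∃ t ∈ w.tok, i ∈ t.2})
    ?_ ?_
  · exact (Finset.finite_toSet (w.chr.map Prod.snd).toFinset).subset fun i hi => by simpa using hi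
  · exact (Finset.finite_toSet (w.tok.biUnion fun t => t.2.toFinset)).subset fun i hi => by
      simpa using hi

theorem ARule.ids_rename (w : ARule L Q N) (ρ : Equiv.Perm ℕ) : (w.rename ρ).ids = w.ids := by
  simp [ARule.ids, ARule.rename]

theorem ARule.fv_finite (w : ARule L Q N) : w.fv.Finite :=
  ((((fvL_finite _).union (fvL_finite _)).union (fvs_finite _)).union (fvI_finite _)).union
    (fvs_finite _)

theorem rename_chr (w : ARule L Q N) (ρ : Equiv.Perm ℕ) :
    (w.rename ρ).chr = w.chr.map (IAtom.act ρ id) := rfl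

theorem ARule.mem_fv_rename (w : ARule L Q N) (ρ : Equiv.Perm ℕ) (x : ℕ) :
    x ∈ (w.rename ρ).fv ↔ ρ.symm x ∈ w.fv := by
  simp only [ARule.fv, Set.mem_union, rename_chr]
  simp only [ARule.rename, mem_fvL_ren, mem_fvs_ren, mem_fvI_act]

theorem ARule.rename_rename (w : ARule L Q N) (ρ π : Equiv.Perm ℕ) :
    (w.rename ρ).rename π = w.rename (ρ.trans π) := by
  simp only [ARule.rename, mapAtom_ren_trans, mapBI_ren_trans]
  simp only [Multiset.map_map, Function.comp_def, Atom.subst_subst, ren_comp]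

theorem ARule.rename_congr (w : ARule L Q N) {ρ π : Equiv.Perm ℕ} (h : ∀ x ∈ w.fv, ρ x = π x) :
    w.rename ρ = w.rename π := by
  have h3 : (w.chr.map fun a => (a.1.subst (ren ρ), a.2)) =
      w.chr.map fun a => (a.1.subst (ren π), a.2) :=
    act_congr (f := id) (g := id) (fun x hx => h x (Or.inl (Or.inr hx))) fun _ _ => rfl
  simp only [ARule.rename, h3]
  rw [mapAtom_ren_congr (H := w.keep) fun x hx => h x (Or.inl (Or.inl (Or.inl (Or.inl hx)))),
    mapAtom_ren_congr (H := w.rem) fun x hx => h x (Or.inl (Or.inl (Or.inl (Or.inr hx)))),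
    mapBI_ren_congr w.guard fun x hx => h x (Or.inl (Or.inl (Or.inr hx))),
    mapBI_ren_congr w.bi fun x hx => h x (Or.inr hx)]

theorem ARule.rename_refl (w : ARule L Q N) : w.rename (Equiv.refl ℕ) = w := by
  have h3 : (w.chr.map fun a => (a.1.subst (ren (Equiv.refl ℕ)), a.2)) = w.chr := map_act_refl _
  simp only [ARule.rename, mapAtom_refl, mapBI_refl, h3]

theorem ARule.rename_eq_self (w : ARule L Q N) {ρ : Equiv.Perm ℕ} (h : ∀ x ∈ w.fv, ρ x = x) :
    w.rename ρ = w :=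
  (w.rename_congr (π := Equiv.refl ℕ) h).trans w.rename_refl

/-- Rules with a non-empty head, with pairwise distinct identifiers in the body, and with positive
identifiers only. Annotated programs have only such rules, and unfolding preserves this. -/
structure ARule.WF (w : ARule L Q N) : Prop where
  head : w.keep ++ w.rem ≠ []
  nodup : (w.chr.map Prod.snd).Nodup
  pos : ∀ i ∈ w.ids, 0 < i

theorem ARule.WF.rename {w : ARule L Q N} (h : w.WF) (ρ : Equiv.Perm ℕ) : (w.rename ρ).WF where
  head := by simpa [ARule.rename] using h.head
  nodup := by simpa [ARule.rename, Function.comp_def] using h.nodup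
  pos := by simpa only [ARule.ids_rename] using h.pos

end Variants

/-! ### The eager semantics -/

section Eager

variable {L : FirstOrder.Language.{u, v}} {Q N : Type*}

/-- Configurations of the eager semantics. Built-in constraints are put into the store at once. The
sets `vars` and `ids` contain all variables and identifiers used so far; those introduced by a
transition lie outside of them. -/
structure EConf (L : FirstOrder.Language.{u, v}) (Q N : Type*) where
  chr : Multiset (IAtom L Q)
  built : Multiset (BI L 0)
  hist : Set (Token N)
  vars : Set ℕ
  ids : Set ℕ

/-- The rule `w` (already renamed apart) can fire in `σ` on the sequences `S₁` and `S₂`. -/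
structure CanFire (CT : L.Theory) (σ : EConf L Q N) (w : ARule L Q N) (S₁ S₂ : List (IAtom L Q))
    (S : Multiset (IAtom L Q)) : Prop where
  chr : σ.chr = ↑S₁ + ↑S₂ + S
  fresh : Disjoint w.fv σ.vars
  keep : SameSymbols (chrL S₁) w.keep
  rem : SameSymbols (chrL S₂) w.rem
  entails : EntailsEx CT σ.built (fvL w.keep ∪ fvL w.rem)
    (headEqs (chrL S₁) w.keep + headEqs (chrL S₂) w.rem + w.guard)
  token : (w.name, idL (S₁ ++ S₂)) ∉ σ.hist

/-- The assignment `g` of new identifiers to those of `w` is injective and avoids the set `I`. -/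
structure FreshIds (w : ARule L Q N) (g : ℕ → ℕ) (I : Set ℕ) : Prop where
  inj : Set.InjOn g w.ids
  avoid : ∀ i ∈ w.ids, g i ∉ I

/-- The configuration reached from `σ` when `w` fires on `S₁`, `S₂` with the new identifiers `g`. -/
def fire (σ : EConf L Q N) (w : ARule L Q N) (g : ℕ → ℕ) (S₁ S₂ : List (IAtom L Q))
    (S : Multiset (IAtom L Q)) : EConf L Q N where
  chr := (w.chr.map fun a => (a.1, g a.2)) + ↑S₁ + S
  built := headEqs (chrL S₁) w.keep + headEqs (chrL S₂) w.rem + w.bi + σ.built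
  hist := σ.hist ∪ {t | S₂ = [] ∧ t = (w.name, idL S₁)} ∪
    {t | ∃ s ∈ w.tok, t = (s.1, s.2.map g)}
  vars := σ.vars ∪ w.fv
  ids := σ.ids ∪ g '' w.ids

/-- `Reach CT P V a k σ`: the answer `a` can be obtained from `σ` with at most `k` rule applications,
where `false` is obtained from every inconsistent store. The bound `k` serves for inductions in which a
derivation is replaced by another one that is not longer. -/
inductive Reach (CT : L.Theory) (P : Set (ARule L Q N)) (V : Set ℕ) (a : Answer L Q) :
    ℕ → EConf L Q N → Prop
  | unsat {k : ℕ} {σ : EConf L Q N} (h : ¬ Sat CT σ.built) (ha : ¬ Sat CT a.2) : Reach CT P V a k σ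
  | final {k : ℕ} {σ : EConf L Q N} (h : Sat CT σ.built)
      (hf : ∀ w ∈ P, ∀ (ρ : Equiv.Perm ℕ) (S₁ S₂ : List (IAtom L Q)) (S : Multiset (IAtom L Q)),
        ¬ CanFire CT σ (w.rename ρ) S₁ S₂ S)
      (ha : Answer.Same CT V (σ.chr.map Prod.fst, σ.built) a) : Reach CT P V a k σ
  | fire {k : ℕ} {σ : EConf L Q N} {w : ARule L Q N} {ρ : Equiv.Perm ℕ} {g : ℕ → ℕ}
      {S₁ S₂ : List (IAtom L Q)} {S : Multiset (IAtom L Q)} (hw : w ∈ P)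
      (hc : CanFire CT σ (w.rename ρ) S₁ S₂ S) (hg : FreshIds (w.rename ρ) g σ.ids)
      (h : Reach CT P V a k (fire σ (w.rename ρ) g S₁ S₂ S)) : Reach CT P V a (k + 1) σ

/-- Well-formed configurations: identifiers are distinct, everything in use is recorded, and `V`
consists of used variables. -/
structure EConf.WF (V : Set ℕ) (σ : EConf L Q N) : Prop where
  finV : σ.vars.Finite
  finI : σ.ids.Finite
  sub : V ⊆ σ.vars
  chrV : fvI σ.chr ⊆ σ.vars
  builtV : fvs σ.built ⊆ σ.vars
  chrI : ∀ i ∈ σ.chr.map Prod.snd, i ∈ σ.ids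
  histI : ∀ t ∈ σ.hist, ∀ i ∈ t.2, i ∈ σ.ids
  nodup : (σ.chr.map Prod.snd).Nodup

variable {CT : L.Theory} {P : Set (ARule L Q N)} {V : Set ℕ} {a : Answer L Q} {k : ℕ}
  {σ τ : EConf L Q N} {w : ARule L Q N} {ρ : Equiv.Perm ℕ} {f g : ℕ → ℕ}
  {S₁ S₂ : List (IAtom L Q)} {S : Multiset (IAtom L Q)}

theorem Reach.mono (h : Reach CT P V a k σ) : Reach CT P V a (k + 1) σ := by
  induction h with
  | unsat h ha => exact .unsat h ha
  | final h hf ha => exact .final h hf ha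
  | fire hw hc hg _ ih => exact .fire hw hc hg ih

theorem sat_of_add {C D : Multiset (BI L 0)} (h : Sat CT (C + D)) : Sat CT D := by
  obtain ⟨M, w, hw⟩ := h
  exact ⟨M, w, ((holds_add w _ _).1 hw).2⟩

/-- From an inconsistent store only the answer `false` is obtained. -/
theorem Reach.unsat_answer (h : Reach CT P V a k σ) (hσ : ¬ Sat CT σ.built) : ¬ Sat CT a.2 := by
  induction h with
  | unsat _ ha => exact ha
  | final h => exact absurd h hσ
  | fire _ _ _ _ ih => exact ih fun h => hσ (sat_of_add h)

theorem exists_freshIds (w : ARule L Q N) {I : Set ℕ} (hI : I.Finite) : ∃ g, FreshIds w g I := by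
  obtain ⟨m, hm⟩ := hI.bddAbove
  refine ⟨fun i => i + (m + 1), fun i _ j _ h => by simpa using h, fun i _ h => ?_⟩
  have := hm h; omega

theorem map_snd_map_id {A : Multiset (IAtom L Q)} :
    ((A.map fun a => ((a.1, g a.2) : IAtom L Q)).map Prod.snd) = (A.map Prod.snd).map g := by
  simp [Multiset.map_map]

theorem EConf.WF.fire (h : σ.WF V) (hw : w.WF) (hc : CanFire CT σ w S₁ S₂ S)
    (hg : FreshIds w g σ.ids) : (fire σ w g S₁ S₂ S).WF V where
  finV := h.finV.union w.fv_finite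
  finI := h.finI.union (w.ids_finite.image g)
  sub := h.sub.trans Set.subset_union_left
  chrV := by
    have h1 := h.chrV
    rw [hc.chr, fvI_add, fvI_add] at h1
    intro x hx
    simp only [CHR.fire, fvI_add] at hx
    rcases hx with (⟨b, hb, hx⟩ | hx) | hx
    · obtain ⟨a, ha, rfl⟩ := Multiset.mem_map.1 hb
      exact Or.inr (Or.inl (Or.inr ⟨a, ha, hx⟩))
    · exact Or.inl (h1 (Or.inl (Or.inl hx)))
    · exact Or.inl (h1 (Or.inr hx))
  builtV := by
    have h1 := h.chrV
    rw [hc.chr, fvI_add, fvI_add, fvI_coe, fvI_coe] at h1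
    intro x hx
    simp only [CHR.fire, fvs_add, fvs_headEqs hc.keep, fvs_headEqs hc.rem] at hx
    rcases hx with (((hx | hx) | (hx | hx)) | hx) | hx
    · exact Or.inl (h1 (Or.inl (Or.inl hx)))
    · exact Or.inr (Or.inl (Or.inl (Or.inl (Or.inl hx))))
    · exact Or.inl (h1 (Or.inl (Or.inr hx)))
    · exact Or.inr (Or.inl (Or.inl (Or.inl (Or.inr hx))))
    · exact Or.inr (Or.inr hx)
    · exact Or.inl (h.builtV hx)
  chrI := by
    have h1 := h.chrI
    rw [hc.chr] at h1
    intro i hi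
    simp only [CHR.fire, Multiset.map_add, map_snd_map_id, Multiset.mem_add] at hi h1
    rcases hi with (hi | hi) | hi
    · obtain ⟨j, hj, rfl⟩ := Multiset.mem_map.1 hi
      exact Or.inr ⟨j, Or.inl hj, rfl⟩
    · exact Or.inl (h1 i (Or.inl (Or.inl hi)))
    · exact Or.inl (h1 i (Or.inr hi))
  histI := by
    have h1 := h.chrI
    rw [hc.chr] at h1
    rintro t ((ht | ⟨-, rfl⟩) | ⟨s, hs, rfl⟩) i hi
    · exact Or.inl (h.histI t ht i hi)
    · refine Or.inl (h1 i ?_)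
      simp only [Multiset.map_add, Multiset.mem_add, Multiset.map_coe, Multiset.mem_coe]
      exact Or.inl (Or.inl hi)
    · obtain ⟨j, hj, rfl⟩ := List.mem_map.1 hi
      exact Or.inr ⟨j, Or.inr ⟨s, hs, hj⟩, rfl⟩
  nodup := by
    have h1 := h.chrI
    have h2 := h.nodup
    rw [hc.chr] at h1 h2
    simp only [CHR.fire, Multiset.map_add, map_snd_map_id] at h1 h2 ⊢
    rw [add_assoc, Multiset.nodup_add]
    refine ⟨?_, ?_, ?_⟩
    · exact hw.nodup.map_on fun i hi j hj hij => hg.inj (Or.inl hi) (Or.inl hj) hij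
    · refine Multiset.nodup_of_le ?_ h2
      gcongr
      exact Multiset.le_add_right _ _
    · rw [Multiset.disjoint_left]
      intro i hi hi'
      obtain ⟨j, hj, rfl⟩ := Multiset.mem_map.1 hi
      refine hg.avoid j (Or.inl hj) (h1 _ ?_)
      simp only [Multiset.mem_add] at hi' ⊢
      tauto

/-! ### Invariance under renaming of variables and identifiers -/

/-- `τ` is `σ` up to the renamings `ρ` of variables and `f` of identifiers, equivalence of the stores,
and tokens with identifiers that are no longer in use. -/
structure RelBy (CT : L.Theory) (ρ f : Equiv.Perm ℕ) (σ τ : EConf L Q N) : Prop where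
  chr : τ.chr = σ.chr.map (IAtom.act ρ f)
  built : ∀ (M : CT.ModelType.{u, v, max u v}) (w : ℕ → M),
    Holds w τ.built ↔ Holds (w ∘ ρ) σ.built
  hist : ∀ t : Token N, (∀ i ∈ t.2, i ∈ σ.chr.map Prod.snd) →
    (t ∈ σ.hist ↔ (t.1, t.2.map f) ∈ τ.hist)

theorem RelBy.symm {ρ f : Equiv.Perm ℕ} (h : RelBy CT ρ f σ τ) : RelBy CT ρ.symm f.symm τ σ where
  chr := by
    rw [h.chr, Multiset.map_map]
    conv_lhs => rw [← map_act_refl σ.chr]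
    refine Multiset.map_congr rfl fun a _ => ?_
    simp only [Function.comp_apply, act_trans]
    congr 1 <;> ext <;> simp
  built M w := by
    rw [h.built M]
    have : (w ∘ ρ.symm) ∘ ρ = w := by ext; simp
    rw [this]
  hist t ht := by
    have hid : (t.2.map f.symm).map f = t.2 := by simp
    rw [h.hist (t.1, t.2.map f.symm), hid]
    intro i hi
    obtain ⟨j, hj, rfl⟩ := List.mem_map.1 hi
    have h1 := ht j hj
    rw [h.chr, Multiset.map_map] at h1
    obtain ⟨b, hb, rfl⟩ := Multiset.mem_map.1 h1
    simpa [IAtom.act] using ⟨b.1, hb⟩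

theorem RelBy.congr {ρ f ρ' f' : Equiv.Perm ℕ} (h : RelBy CT ρ f σ τ) (hσ : σ.WF V)
    (hρ : ∀ x ∈ σ.vars, ρ' x = ρ x) (hf : ∀ i ∈ σ.chr.map Prod.snd, f' i = f i) :
    RelBy CT ρ' f' σ τ where
  chr := h.chr.trans (act_congr (fun x hx => (hρ x (hσ.chrV hx)).symm) fun i hi => (hf i hi).symm)
  built M w := (h.built M w).trans (holds_congr fun x hx => by simp [hρ x (hσ.builtV hx)])
  hist t ht := by
    rw [h.hist t ht, List.map_congr_left fun i hi => hf i (ht i hi)]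

theorem RelBy.sat {ρ f : Equiv.Perm ℕ} (h : RelBy CT ρ f σ τ) : Sat CT τ.built ↔ Sat CT σ.built := by
  constructor
  · rintro ⟨M, w, hw⟩; exact ⟨M, _, (h.built M w).1 hw⟩
  · rintro ⟨M, w, hw⟩
    refine ⟨M, w ∘ ρ.symm, (h.built M _).2 ?_⟩
    have : (w ∘ ρ.symm) ∘ ρ = w := by ext; simp
    rwa [this]

theorem RelBy.canFire {ρ f : Equiv.Perm ℕ} (h : RelBy CT ρ f σ τ) (hc : CanFire CT σ w S₁ S₂ S)
    (hd : Disjoint (w.rename ρ).fv τ.vars) :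
    CanFire CT τ (w.rename ρ) (S₁.map (IAtom.act ρ f)) (S₂.map (IAtom.act ρ f))
      (S.map (IAtom.act ρ f)) where
  chr := by simp [h.chr, hc.chr]
  fresh := hd
  keep := by rw [chrL_act]; exact (sameSymbols_ren _ _).2 hc.keep
  rem := by rw [chrL_act]; exact (sameSymbols_ren _ _).2 hc.rem
  entails := by
    intro M w₀ hw₀
    obtain ⟨w₁, h1, h2⟩ := hc.entails M _ ((h.built M w₀).1 hw₀)
    refine ⟨w₁ ∘ ρ.symm, fun y hy => ?_, ?_⟩
    · simp only [Function.comp_apply]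
      rw [h1 (ρ.symm y) (by simpa [ARule.rename, mem_fvL_ren] using hy)]
      simp
    · have : headEqs (chrL (S₁.map (IAtom.act ρ f))) (w.rename ρ).keep +
          headEqs (chrL (S₂.map (IAtom.act ρ f))) (w.rename ρ).rem + (w.rename ρ).guard =
          (headEqs (chrL S₁) w.keep + headEqs (chrL S₂) w.rem + w.guard).map
            (BI.subst (ren ρ)) := by
        simp [headEqs_map, chrL_act, ARule.rename]
      rw [this, holds_map_ren]
      have : (w₁ ∘ ρ.symm) ∘ ρ = w₁ := by ext; simp
      rwa [this]
  token := by
    rw [← List.map_append, idL_act]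
    refine fun ht => hc.token ((h.hist (w.name, idL (S₁ ++ S₂)) fun i hi => ?_).2 ht)
    rw [hc.chr]
    simp only [idL, List.map_append, List.mem_append] at hi
    simp only [Multiset.map_add, Multiset.mem_add, Multiset.map_coe, Multiset.mem_coe]
    exact Or.inl hi

theorem RelBy.fire {ρ f : Equiv.Perm ℕ} {g' : ℕ → ℕ} (h : RelBy CT ρ f σ τ) (hσ : σ.WF V)
    (hτ : τ.WF V) (hc : CanFire CT σ w S₁ S₂ S) (hg : FreshIds w g σ.ids)
    (hg' : ∀ i ∈ w.ids, g' i ∉ τ.ids) (hf : ∀ i ∈ w.ids, f (g i) = g' i) :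
    RelBy CT ρ f (fire σ w g S₁ S₂ S) (fire τ (w.rename ρ) g' (S₁.map (IAtom.act ρ f))
      (S₂.map (IAtom.act ρ f)) (S.map (IAtom.act ρ f))) where
  chr := by
    simp only [CHR.fire, Multiset.map_add, Multiset.map_coe, rename_chr, Multiset.map_map,
      add_left_inj]
    refine Multiset.map_congr rfl fun a ha => ?_
    simp [IAtom.act, hf a.2 (Or.inl (Multiset.mem_map_of_mem _ ha))]
  built M w₀ := by
    have : headEqs (chrL (S₁.map (IAtom.act ρ f))) (w.rename ρ).keep +
        headEqs (chrL (S₂.map (IAtom.act ρ f))) (w.rename ρ).rem + (w.rename ρ).bi =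
        (headEqs (chrL S₁) w.keep + headEqs (chrL S₂) w.rem + w.bi).map (BI.subst (ren ρ)) := by
      simp [headEqs_map, chrL_act, ARule.rename]
    simp only [CHR.fire]
    rw [this, holds_add, holds_map_ren, h.built M, ← holds_add]
  hist t ht := by
    have hlive : ∀ i ∈ t.2, i ∈ σ.ids → i ∈ σ.chr.map Prod.snd := by
      intro i hi hi'
      have h1 := ht i hi
      simp only [CHR.fire, Multiset.map_add, map_snd_map_id, Multiset.mem_add] at h1
      rw [hc.chr]
      simp only [Multiset.map_add, Multiset.mem_add]
      rcases h1 with (h1 | h1) | h1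
      · obtain ⟨j, hj, rfl⟩ := Multiset.mem_map.1 h1
        exact absurd hi' (hg.avoid j (Or.inl hj))
      · exact Or.inl (Or.inl h1)
      · exact Or.inr h1
    have hback : ∀ i ∈ t.2, f i ∈ τ.ids → i ∈ σ.chr.map Prod.snd := by
      intro i hi hi'
      have h1 := ht i hi
      simp only [CHR.fire, Multiset.map_add, map_snd_map_id, Multiset.mem_add] at h1
      rw [hc.chr]
      simp only [Multiset.map_add, Multiset.mem_add]
      rcases h1 with (h1 | h1) | h1
      · obtain ⟨j, hj, rfl⟩ := Multiset.mem_map.1 h1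
        rw [hf j (Or.inl hj)] at hi'
        exact absurd hi' (hg' j (Or.inl hj))
      · exact Or.inl (Or.inl h1)
      · exact Or.inr h1
    have hmap : ∀ s ∈ w.tok, (s.2.map g).map f = s.2.map g' := fun s hs => by
      rw [List.map_map]
      exact List.map_congr_left fun i hi => hf i (Or.inr ⟨s, hs, hi⟩)
    simp only [CHR.fire, Set.mem_union, Set.mem_ofPred_eq]
    refine or_congr (or_congr ⟨fun h1 => ?_, fun h1 => ?_⟩ ?_) ?_
    · exact (h.hist t fun i hi => hlive i hi (hσ.histI t h1 i hi)).1 h1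
    · exact (h.hist t fun i hi => hback i hi (hτ.histI _ h1 _ (List.mem_map_of_mem hi))).2 h1
    · rw [idL_act]
      refine and_congr (by simp) ?_
      rw [Prod.ext_iff, Prod.ext_iff]
      exact and_congr Iff.rfl (List.map_injective_iff.2 f.injective).eq_iff.symm
    · refine exists_congr fun s => and_congr_right fun hs => ?_
      have hs : s ∈ w.tok := hs
      rw [Prod.ext_iff, Prod.ext_iff]
      refine and_congr Iff.rfl ?_
      rw [← hmap s hs]
      exact (List.map_injective_iff.2 f.injective).eq_iff.symm

theorem Answer.Same.rename {ρ : Equiv.Perm ℕ} {K : Multiset (Atom L Q)} {d d' : Multiset (BI L 0)}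
    (hs : Sat CT d) (hV : ∀ x ∈ V, ρ x = x)
    (hd : ∀ (M : CT.ModelType.{u, v, max u v}) (w : ℕ → M), Holds w d' ↔ Holds (w ∘ ρ) d)
    (h : Answer.Same CT V (K, d) a) :
    Answer.Same CT V (K.map (Atom.subst (ren ρ)), d') a := by
  rcases h with ⟨h, -⟩ | ⟨π, h1, h2, h3, h4⟩
  · exact absurd hs h
  · have key : ∀ (M : CT.ModelType.{u, v, max u v}) (w : ℕ → M),
        Holds w (d'.map (BI.subst (ren (ρ.symm.trans π)))) ↔ Holds w (d.map (BI.subst (ren π))) := by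
      intro M w
      rw [holds_map_ren, hd, holds_map_ren]
      have : (w ∘ (ρ.symm.trans π)) ∘ ρ = w ∘ π := by ext; simp
      rw [this]
    refine Or.inr ⟨ρ.symm.trans π, fun x hx => ?_, ?_, fun M w hw => h3 M w ((key M w).1 hw),
      fun M w hw => (key M w).2 (h4 M w hw)⟩
    · rw [Equiv.trans_apply, (Equiv.symm_apply_eq ρ).2 (hV x hx).symm, h1 x hx]
    · rw [h2, Multiset.map_map]
      refine Multiset.map_congr rfl fun b _ => ?_
      rw [Function.comp_apply, Atom.subst_subst, ren_comp]
      congr 2; ext; simp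

/-- Answers of the eager semantics do not depend on the names of variables and identifiers, nor on the
record of the used ones. -/
theorem Reach.lift (hP : ∀ w ∈ P, w.WF) (h : Reach CT P V a k σ) :
    ∀ {τ : EConf L Q N} {ρ f : Equiv.Perm ℕ}, σ.WF V → τ.WF V → (∀ x ∈ V, ρ x = x) →
      RelBy CT ρ f σ τ → Reach CT P V a k τ := by
  induction h with
  | unsat h ha => exact fun _ _ _ hr => .unsat (fun h' => h (hr.sat.1 h')) ha
  | @final k σ h hf ha =>
    intro τ ρ f hσ hτ hV hr
    refine .final (hr.sat.2 h) (fun w hw π S₁ S₂ S hc => ?_) ?_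
    · -- a rule firing in `τ` is moved back to `σ`, after its new variables have been moved off `σ.vars`
      obtain ⟨ρ', h1, h2⟩ := exists_perm_fresh ρ.symm hτ.finV (w.rename π).fv_finite hσ.finV hc.fresh
      refine hf w hw (π.trans ρ') _ _ _ (w.rename_rename π ρ' ▸
        (hr.symm.congr hτ h1 fun _ _ => rfl).canFire hc ?_)
      refine Set.disjoint_left.2 fun x hx hx' => ?_
      have := h2 _ ((ARule.mem_fv_rename _ _ _).1 hx)
      rw [Equiv.apply_symm_apply] at this
      exact this hx'
    · have := Answer.Same.rename (d' := τ.built) h hV (fun M w => hr.built M w) ha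
      rw [hr.chr]
      convert this using 2
      simp [Multiset.map_map, Function.comp_def, IAtom.act]
  | @fire k σ w π g S₁ S₂ S hw hc hg _ ih =>
    intro τ ρ f hσ hτ hV hr
    have hwf := (hP w hw).rename π
    obtain ⟨ρ', h1, h2⟩ := exists_perm_fresh ρ hσ.finV (w.rename π).fv_finite hτ.finV hc.fresh
    obtain ⟨g', hg'⟩ := exists_freshIds (w.rename π) hτ.finI
    -- `f` is changed on dead identifiers so as to match the new identifiers in `σ` and `τ`
    have hlive : ∀ i ∈ σ.chr.map Prod.snd, f i ∈ τ.ids := by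
      intro i hi
      refine hτ.chrI _ ?_
      rw [hr.chr, Multiset.map_map]
      obtain ⟨b, hb, rfl⟩ := Multiset.mem_map.1 hi
      exact Multiset.mem_map.2 ⟨b, hb, rfl⟩
    obtain ⟨f', h3, h4⟩ := exists_perm_extend f {i | i ∈ σ.chr.map Prod.snd}
      (w.rename π).ids_finite hg.inj hg'.inj (fun j hj hj' => hg.avoid j hj (hσ.chrI _ hj'))
      (fun j hj i hi hij => hg'.avoid j hj (hij ▸ hlive i hi))
    have hr' := hr.congr hσ h1 h3
    have hd : Disjoint ((w.rename π).rename ρ').fv τ.vars := by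
      refine Set.disjoint_left.2 fun x hx hx' => ?_
      have := h2 _ ((ARule.mem_fv_rename _ _ _).1 hx)
      rw [Equiv.apply_symm_apply] at this
      exact this hx'
    have hc' := hr'.canFire hc hd
    have hr2 := hr'.fire hσ hτ hc hg hg'.avoid h4
    have hg2 : FreshIds ((w.rename π).rename ρ') g' τ.ids :=
      ⟨by rw [ARule.ids_rename]; exact hg'.inj, by rw [ARule.ids_rename]; exact hg'.avoid⟩
    have := ih (hσ.fire hwf hc hg) (hτ.fire (hwf.rename ρ') hc' hg2)
      (fun x hx => by rw [h1 x (hσ.sub hx), hV x hx]) hr2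
    rw [ARule.rename_rename] at hc' hg2 this
    exact .fire hw hc' hg2 this

/-- The special case of `RelBy` without renaming. -/
theorem RelBy.refl (hchr : τ.chr = σ.chr)
    (hb : ∀ (M : CT.ModelType.{u, v, max u v}) (w : ℕ → M), Holds w τ.built ↔ Holds w σ.built)
    (hh : ∀ t : Token N, (∀ i ∈ t.2, i ∈ σ.chr.map Prod.snd) → (t ∈ σ.hist ↔ t ∈ τ.hist)) :
    RelBy CT (Equiv.refl ℕ) (Equiv.refl ℕ) σ τ where
  chr := hchr.trans (map_act_refl σ.chr).symm
  built := hb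
  hist t ht := by simpa using hh t ht

theorem Reach.congr (hP : ∀ w ∈ P, w.WF) (hσ : σ.WF V) (hτ : τ.WF V) (hchr : τ.chr = σ.chr)
    (hb : ∀ (M : CT.ModelType.{u, v, max u v}) (w : ℕ → M), Holds w τ.built ↔ Holds w σ.built)
    (hh : ∀ t : Token N, (∀ i ∈ t.2, i ∈ σ.chr.map Prod.snd) → (t ∈ σ.hist ↔ t ∈ τ.hist))
    (h : Reach CT P V a k σ) : Reach CT P V a k τ :=
  h.lift hP hσ hτ (fun _ _ => rfl) (RelBy.refl hchr hb hh)

/-- The choice of the new identifiers does not matter. -/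
theorem Reach.fire_reid {g' : ℕ → ℕ} (hP : ∀ w ∈ P, w.WF) (hσ : σ.WF V) (hw : w.WF)
    (hc : CanFire CT σ w S₁ S₂ S) (hg : FreshIds w g σ.ids) (hg' : FreshIds w g' σ.ids)
    (h : Reach CT P V a k (CHR.fire σ w g S₁ S₂ S)) :
    Reach CT P V a k (CHR.fire σ w g' S₁ S₂ S) := by
  -- a permutation of the identifiers which fixes the old ones and takes `g` to `g'`
  obtain ⟨f', h3, h4⟩ := exists_perm_extend (Equiv.refl ℕ) σ.ids w.ids_finite hg.inj hg'.inj
    hg.avoid (fun j hj i hi hij => hg'.avoid j hj (hij ▸ hi))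
  have hr : RelBy CT (Equiv.refl ℕ) f' σ σ :=
    (RelBy.refl rfl (fun _ _ => Iff.rfl) fun _ _ => Iff.rfl).congr hσ (fun _ _ => rfl)
      fun i hi => h3 i (hσ.chrI i hi)
  have hr2 := hr.fire hσ hσ hc hg hg'.avoid h4
  have hS : ∀ A : Multiset (IAtom L Q), A ≤ σ.chr → A.map (IAtom.act (Equiv.refl ℕ) f') = A := by
    intro A hA
    refine (act_congr (fun _ _ => rfl) fun i hi => ?_).trans (map_act_refl A)
    exact h3 i (hσ.chrI i (Multiset.mem_of_le (Multiset.map_le_map hA) hi))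
  have hL : ∀ A : List (IAtom L Q), (A : Multiset (IAtom L Q)) ≤ σ.chr →
      A.map (IAtom.act (Equiv.refl ℕ) f') = A := by
    intro A hA
    conv_rhs => rw [← List.map_id A]
    refine List.map_congr_left fun b hb => Prod.ext (Atom.subst_var _) ?_
    exact h3 _ (hσ.chrI _ (Multiset.mem_map_of_mem _ (Multiset.mem_of_le hA hb)))
  have h1 : (S₁ : Multiset (IAtom L Q)) ≤ σ.chr := by
    rw [hc.chr, add_assoc]; exact Multiset.le_add_right _ _
  have h2 : (S₂ : Multiset (IAtom L Q)) ≤ σ.chr := by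
    rw [hc.chr, add_comm (S₁ : Multiset (IAtom L Q)), add_assoc]; exact Multiset.le_add_right _ _
  have h5 : S ≤ σ.chr := by rw [hc.chr]; exact Multiset.le_add_left _ _
  rw [ARule.rename_refl, hS S h5, hL S₁ h1, hL S₂ h2] at hr2
  exact h.lift hP (hσ.fire hw hc hg) (hσ.fire hw hc hg') (fun _ _ => rfl) hr2

end Eager


/-! ### The eager semantics and the semantics `ω_t'` -/

section Annotated

variable {L : FirstOrder.Language.{u, v}} {Q N : Type*}

theorem le_maxId {w : ARule L Q N} {i : ℕ} (hi : i ∈ w.ids) : i ≤ maxId w.chr w.tok := by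
  rcases hi with hi | ⟨t, ht, hi⟩
  · exact (Multiset.le_sup hi).trans (le_max_left _ _)
  · exact ((Multiset.le_sup (s := (t.2 : Multiset ℕ)) hi).trans
      (Finset.le_sup (f := fun t : Token N => (t.2 : Multiset ℕ).sup) ht)).trans (le_max_right _ _)

theorem freshIds_add (w : ARule L Q N) (hw : ∀ i ∈ w.ids, 0 < i) (n : ℕ) {I : Set ℕ}
    (hI : ∀ i ∈ I, i ≤ n) : FreshIds w (· + n) I where
  inj i _ j _ h := by simpa using h
  avoid i hi h := by have h1 := hw i hi; have h2 : i + n ≤ n := hI _ h; omega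

/-- A configuration of `ω_t'` with its pending built-in constraints moved to the store. -/
def AConf.toE (V : Set ℕ) (c : AConf L Q N) : EConf L Q N :=
  ⟨c.chr, c.built + c.bi, {t | t ∈ c.hist}, V ∪ c.fv, {i | i ≤ c.last}⟩

/-- All identifiers in use are at most `last`, and those of the constraints are distinct. -/
structure AConf.WF (c : AConf L Q N) : Prop where
  chrI : ∀ i ∈ c.chr.map Prod.snd, i ≤ c.last
  histI : ∀ t ∈ c.hist, ∀ i ∈ t.2, i ≤ c.last
  nodup : (c.chr.map Prod.snd).Nodup

theorem AConf.WF.toE {V : Set ℕ} {c : AConf L Q N} (h : c.WF) (hV : V.Finite) : (c.toE V).WF V where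
  finV := hV.union (((fvI_finite _).union (fvs_finite _)).union (fvs_finite _))
  finI := Set.finite_Iic c.last
  sub := Set.subset_union_left
  chrV x hx := Or.inr (Or.inl (Or.inl hx))
  builtV x hx := by
    simp only [AConf.toE, fvs_add] at hx
    exact Or.inr (hx.elim Or.inr fun h => Or.inl (Or.inr h))
  chrI := h.chrI
  histI := h.histI
  nodup := h.nodup

theorem fvI_label (n : ℕ) (A : List (Atom L Q)) : fvI (label n A) = fvL A := by
  rw [label, fvI_coe, chrL, List.zipIdx_map_fst]

theorem label_map_fst (n : ℕ) (A : List (Atom L Q)) : (label n A).map Prod.fst = ↑A := by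
  rw [label, Multiset.map_coe, List.zipIdx_map_fst]

theorem label_map_snd (n : ℕ) (A : List (Atom L Q)) :
    (label n A).map Prod.snd = ↑(List.range' (n + 1) A.length) := by
  rw [label, Multiset.map_coe, List.zipIdx_map_snd]

theorem Goal.fv_finite (G : Goal L Q) : G.fv.Finite := (fvL_finite _).union (fvs_finite _)

/-- The initial configuration of the eager semantics. -/
def initE (N : Type*) (G : Goal L Q) : EConf L Q N :=
  ⟨label 0 G.chr, G.bi, ∅, G.fv, {i | i ≤ G.chr.length}⟩

theorem initE_wf (G : Goal L Q) : (initE N G).WF G.fv where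
  finV := G.fv_finite
  finI := Set.finite_Iic _
  sub := subset_rfl
  chrV x hx := Or.inl (by rwa [← fvI_label 0])
  builtV x hx := Or.inr hx
  chrI i hi := by
    simp only [initE, label_map_snd, Multiset.mem_coe, List.mem_range'_1] at hi ⊢
    show i ≤ _
    omega
  histI t ht := absurd ht (Set.notMem_empty t)
  nodup := by
    simp only [initE, label_map_snd, Multiset.coe_nodup]
    exact List.nodup_range'

variable [DecidableEq N]
variable {CT : L.Theory} {P : Set (ARule L Q N)} {V : Set ℕ} {a : Answer L Q} {k : ℕ}

theorem mem_addToken {T : Finset (Token N)} {x : N} {S₁ S₂ : List (IAtom L Q)} {t : Token N} :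
    t ∈ addToken T x S₁ S₂ ↔ t ∈ T ∨ (S₂ = [] ∧ t = (x, idL S₁)) := by
  unfold addToken
  split
  · simp_all [or_comm]
  · simp_all

/-- Firing a rule in `ω_t'` is firing it in the eager semantics. -/
theorem fire_toE {w : ARule L Q N} {S₁ S₂ : List (IAtom L Q)} {S : Multiset (IAtom L Q)}
    {B C : Multiset (BI L 0)} {T : Finset (Token N)} {n : ℕ} (hV : V.Finite)
    (hP : ∀ w ∈ P, w.WF) (hw : w.WF)
    (hwf : (⟨↑S₁ + ↑S₂ + S, B, C, T, n⟩ : AConf L Q N).WF)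
    (hc : CanFire CT ((⟨↑S₁ + ↑S₂ + S, B, C, T, n⟩ : AConf L Q N).toE V) w S₁ S₂ S)
    (B' : Multiset (BI L 0)) (C' : Multiset (BI L 0))
    (hB : B' + C' = headEqs (chrL S₁) w.keep + headEqs (chrL S₂) w.rem + w.bi + (C + B)) :
    (⟨(inst w.chr w.tok n).1 + ↑S₁ + S, B', C', addToken T w.name S₁ S₂ ∪ (inst w.chr w.tok n).2.1,
      (inst w.chr w.tok n).2.2⟩ : AConf L Q N).WF ∧
    (Reach CT P V a k (fire ((⟨↑S₁ + ↑S₂ + S, B, C, T, n⟩ : AConf L Q N).toE V) w (· + n) S₁ S₂ S) ↔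
      Reach CT P V a k ((⟨(inst w.chr w.tok n).1 + ↑S₁ + S, B', C',
        addToken T w.name S₁ S₂ ∪ (inst w.chr w.tok n).2.1,
        (inst w.chr w.tok n).2.2⟩ : AConf L Q N).toE V)) := by
  have hg : FreshIds w (· + n)
      ((⟨↑S₁ + ↑S₂ + S, B, C, T, n⟩ : AConf L Q N).toE V).ids := freshIds_add w hw.pos n fun i h => h
  have h1 := (hwf.toE hV).fire hw hc hg
  have hle : ∀ i ∈ (fire ((⟨↑S₁ + ↑S₂ + S, B, C, T, n⟩ : AConf L Q N).toE V) w (· + n) S₁ S₂ S).ids,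
      i ≤ maxId w.chr w.tok + n := by
    rintro i (hi | ⟨j, hj, rfl⟩)
    · exact le_trans (show i ≤ n from hi) (Nat.le_add_left _ _)
    · have := le_maxId hj; simp only; omega
  have hhist : ∀ t, t ∈ addToken T w.name S₁ S₂ ∪ (inst w.chr w.tok n).2.1 ↔
      t ∈ (fire ((⟨↑S₁ + ↑S₂ + S, B, C, T, n⟩ : AConf L Q N).toE V) w (· + n) S₁ S₂ S).hist := by
    intro t
    simp only [Finset.mem_union, mem_addToken, fire, AConf.toE, inst, Set.mem_union,
      Set.mem_ofPred_eq, Finset.mem_image, eq_comm (a := t)]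
  have h2 : (⟨(inst w.chr w.tok n).1 + ↑S₁ + S, B', C',
      addToken T w.name S₁ S₂ ∪ (inst w.chr w.tok n).2.1,
      (inst w.chr w.tok n).2.2⟩ : AConf L Q N).WF :=
    ⟨fun i hi => hle i (h1.chrI i hi), fun t ht i hi => hle i (h1.histI t ((hhist t).1 ht) i hi),
      h1.nodup⟩
  have hb : C' + B' = (fire ((⟨↑S₁ + ↑S₂ + S, B, C, T, n⟩ : AConf L Q N).toE V) w (· + n)
      S₁ S₂ S).built := by rw [add_comm, hB]; rfl
  refine ⟨h2, fun h => ?_, fun h => ?_⟩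
  · refine h.congr hP h1 (h2.toE hV) rfl (fun M w => ?_) fun t _ => (hhist t).symm
    rw [← hb]; rfl
  · refine h.congr hP (h2.toE hV) h1 rfl (fun M w => ?_) fun t _ => hhist t
    rw [← hb]; rfl

/-- What makes `a` a qualified answer from `c`: a final configuration with this answer, or
inconsistency. -/
def AConf.Yields (CT : L.Theory) (P : Set (ARule L Q N)) (V : Set ℕ) (a : Answer L Q)
    (c : AConf L Q N) : Prop :=
  (c.bi = 0 ∧ (∀ σ, ¬ AStep CT P V c σ) ∧ Answer.Same CT V (c.chr.map Prod.fst, c.built) a) ∨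
    (¬ Sat CT a.2 ∧ ¬ Sat CT c.built)

theorem not_sat_of_same {b : Answer L Q} (h : Answer.Same CT V b a) (hb : ¬ Sat CT b.2) :
    ¬ Sat CT a.2 := by
  rcases h with h | ⟨ρ, -, -, -, h⟩
  · exact h.2
  · rintro ⟨M, w, hw⟩
    exact hb ⟨M, _, (holds_map_ren w _ ρ).1 (h M w hw)⟩

theorem AConf.canFire_of_astep {c c' : AConf L Q N} (h : AStep CT P V c c') (hc : c.bi = 0) :
    ∃ w ∈ P, ∃ (ρ : Equiv.Perm ℕ) (S₁ S₂ : List (IAtom L Q)) (S : Multiset (IAtom L Q)),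
      CanFire CT (c.toE V) (w.rename ρ) S₁ S₂ S := by
  cases h with
  | solve S B c C C' T n h => simp at hc
  | apply r₀ r ρ S₁ S₂ S B C T n mem variant fresh keep rem entails token =>
    subst variant
    refine ⟨r₀, mem, ρ, S₁, S₂, S, rfl, fresh, keep, rem, fun M w hw => entails M w ?_, token⟩
    exact ((holds_add w _ _).1 hw).1

/-- Solving does not change the eager view of a configuration, up to equivalence of the store. -/
theorem AConf.reach_of_steps (hV : V.Finite) (hP : ∀ w ∈ P, w.WF) {c c' : AConf L Q N}
    (h : Relation.ReflTransGen (AStep CT P V) c c') (h' : c'.Yields CT P V a) (hc : c.WF) :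
    ∃ k, Reach CT P V a k (c.toE V) := by
  induction h using Relation.ReflTransGen.head_induction_on with
  | refl =>
    rcases h' with ⟨h1, h2, h3⟩ | ⟨h1, h2⟩
    · refine ⟨0, ?_⟩
      have hb : (c'.toE V).built = c'.built := by simp [AConf.toE, h1]
      by_cases hs : Sat CT c'.built
      · refine .final (hb ▸ hs) (fun w hw ρ S₁ S₂ S h => ?_) (hb ▸ h3)
        obtain ⟨S', B', C', T, n⟩ := c'
        have hch := h.chr
        simp only [AConf.toE] at hch
        subst hch
        refine h2 _ (AStep.apply w _ ρ S₁ S₂ S B' C' T n hw rfl h.fresh h.keep h.rem ?_ h.token)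
        have he := h.entails
        rwa [hb] at he
      · exact .unsat (hb ▸ hs) (not_sat_of_same h3 hs)
    · exact ⟨0, .unsat (fun ⟨M, w, hw⟩ => h2 ⟨M, w, ((holds_add w _ _).1 hw).1⟩) h1⟩
  | @head c d hstep _ ih =>
    cases hstep with
    | solve S B b C C' T n h =>
      have hd : (⟨S, B, C', T, n⟩ : AConf L Q N).WF := ⟨hc.chrI, hc.histI, hc.nodup⟩
      obtain ⟨k, hk⟩ := ih hd
      refine ⟨k, hk.congr hP (hd.toE hV) (hc.toE hV) rfl (fun M w => ?_) fun _ _ => Iff.rfl⟩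
      have h1 := h.1 M w
      have h2 := h.2 M w
      simp only [AConf.toE, holds_add] at h1 h2 ⊢
      tauto
    | apply r₀ r ρ S₁ S₂ S B C T n mem variant fresh keep rem entails token =>
      subst variant
      have hf : CanFire CT ((⟨↑S₁ + ↑S₂ + S, B, C, T, n⟩ : AConf L Q N).toE V) (r₀.rename ρ) S₁ S₂ S :=
        ⟨rfl, fresh, keep, rem, fun M w hw => entails M w ((holds_add w _ _).1 hw).1, token⟩
      have hw := (hP r₀ mem).rename ρ
      obtain ⟨k, hk⟩ := ih (fire_toE (a := a) (k := 0) hV hP hw hc hf _ _ (by abel)).1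
      exact ⟨k + 1, .fire mem hf (freshIds_add _ hw.pos n fun i h => h)
        ((fire_toE hV hP hw hc hf _ _ (by abel)).2.2 hk)⟩

theorem AConf.solve_all (S : Multiset (IAtom L Q)) (B C : Multiset (BI L 0))
    (T : Finset (Token N)) (n : ℕ) :
    Relation.ReflTransGen (AStep CT P V) ⟨S, B, C, T, n⟩ ⟨S, 0, B + C, T, n⟩ := by
  induction B using Multiset.induction_on generalizing C with
  | empty => rw [zero_add]
  | cons b B ih =>
    have h : AStep CT P V ⟨S, {b} + B, C, T, n⟩ ⟨S, B, {b} + C, T, n⟩ :=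
      .solve S B b C _ T n ⟨fun _ _ h => h, fun _ _ h => h⟩
    have := (Relation.ReflTransGen.single h).trans (ih ({b} + C))
    rwa [show B + ({b} + C) = {b} + B + C by abel, Multiset.singleton_add] at this

/-- Conversely, eager derivations are followed by solving all new built-in constraints after each rule
application. -/
theorem AConf.steps_of_reach (hV : V.Finite) (hP : ∀ w ∈ P, w.WF) (k : ℕ) :
    ∀ c : AConf L Q N, c.WF → c.bi = 0 → Reach CT P V a k (c.toE V) →
      ∃ c', Relation.ReflTransGen (AStep CT P V) c c' ∧ c'.Yields CT P V a := by
  induction k with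
  | zero =>
    intro c hc hbi h
    have hb : (c.toE V).built = c.built := by simp [AConf.toE, hbi]
    cases h with
    | unsat h ha => exact ⟨c, .refl, Or.inr ⟨ha, hb ▸ h⟩⟩
    | final h hf ha =>
      refine ⟨c, .refl, Or.inl ⟨hbi, fun σ hσ => ?_, hb ▸ ha⟩⟩
      obtain ⟨w, hw, ρ, S₁, S₂, S, h⟩ := AConf.canFire_of_astep hσ hbi
      exact hf w hw ρ S₁ S₂ S h
  | succ k ih =>
    intro c hc hbi h
    have hb : (c.toE V).built = c.built := by simp [AConf.toE, hbi]
    cases h with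
    | unsat h ha => exact ⟨c, .refl, Or.inr ⟨ha, hb ▸ h⟩⟩
    | final h hf ha =>
      refine ⟨c, .refl, Or.inl ⟨hbi, fun σ hσ => ?_, hb ▸ ha⟩⟩
      obtain ⟨w, hw, ρ, S₁, S₂, S, h⟩ := AConf.canFire_of_astep hσ hbi
      exact hf w hw ρ S₁ S₂ S h
    | @fire _ _ w ρ g S₁ S₂ S mem hf hg h =>
      obtain ⟨S', B, C, T, n⟩ := c
      have hch := hf.chr
      simp only [AConf.toE] at hch hbi
      subst hch hbi
      have he := hf.entails
      rw [hb] at he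
      have hw := (hP w mem).rename ρ
      -- the new identifiers are those prescribed by `inst`
      have h1 := Reach.fire_reid hP (hc.toE hV) hw hf hg (freshIds_add _ hw.pos n fun i h => h) h
      have hfin := fire_toE (a := a) (k := k) hV hP hw hc hf 0
        ((w.rename ρ).bi + (headEqs (chrL S₁) (w.rename ρ).keep +
          headEqs (chrL S₂) (w.rename ρ).rem + C)) (by abel)
      obtain ⟨c', h2, h3⟩ := ih _ hfin.1 rfl (hfin.2.1 h1)
      refine ⟨c', ?_, h3⟩
      refine .head (AStep.apply w _ ρ S₁ S₂ S 0 C T n mem rfl hf.fresh hf.keep hf.rem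
        he hf.token) (.trans ?_ h2)
      rw [add_zero]
      exact AConf.solve_all _ _ _ _ _

/-- The eager semantics gives the qualified answers of `ω_t'`. -/
theorem mem_QA'_iff (hP : ∀ w ∈ P, w.WF) (G : Goal L Q) :
    a ∈ QA' CT P G ↔ ∃ k, Reach CT P G.fv a k (initE N G) := by
  have hwf0 := initE_wf (N := N) G
  have hwf : ∀ B C, (⟨label 0 G.chr, B, C, ∅, G.chr.length⟩ : AConf L Q N).WF := fun B C =>
    ⟨hwf0.chrI, by simp, hwf0.nodup⟩
  have hr : ∀ B C k, B + C = G.bi →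
      (Reach CT P G.fv a k ((⟨label 0 G.chr, B, C, ∅, G.chr.length⟩ : AConf L Q N).toE G.fv) ↔
        Reach CT P G.fv a k (initE N G)) := by
    intro B C k hBC
    have hb : ((⟨label 0 G.chr, B, C, ∅, G.chr.length⟩ : AConf L Q N).toE G.fv).built
      = (initE N G).built := by rw [initE, ← hBC, add_comm]; rfl
    refine ⟨fun h => h.congr hP ((hwf B C).toE G.fv_finite) hwf0 rfl (fun M w => by rw [hb])
      fun t _ => by simp [AConf.toE, initE],
      fun h => h.congr hP hwf0 ((hwf B C).toE G.fv_finite) rfl (fun M w => by rw [hb])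
      fun t _ => by simp [AConf.toE, initE]⟩
  constructor
  · rintro (⟨K, d, T, n, h1, h2, h3⟩ | ⟨h1, σ, h2, h3⟩)
    · obtain ⟨k, hk⟩ := AConf.reach_of_steps G.fv_finite hP h1 (Or.inl ⟨rfl, h2, h3⟩) (hwf _ _)
      exact ⟨k, (hr _ _ k (by simp)).1 hk⟩
    · obtain ⟨k, hk⟩ := AConf.reach_of_steps G.fv_finite hP h3 (Or.inr ⟨h1, h2⟩) (hwf _ _)
      exact ⟨k, (hr _ _ k (by simp)).1 hk⟩
  · rintro ⟨k, hk⟩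
    obtain ⟨c, h1, h2⟩ := AConf.steps_of_reach G.fv_finite hP k _ (hwf 0 (G.bi + 0)) rfl
      ((hr _ _ k (by simp)).2 hk)
    have h3 := (AConf.solve_all (CT := CT) (P := P) (V := G.fv) (label 0 G.chr) G.bi 0 ∅
      G.chr.length).trans h1
    rcases h2 with ⟨h4, h5, h6⟩ | ⟨h4, h5⟩
    · obtain ⟨K, B, d, T, n⟩ := c
      simp only at h4
      subst h4
      exact Or.inl ⟨K, d, T, n, h3, h5, h6⟩
    · exact Or.inr ⟨h4, c, h5, h3⟩

end Annotated


/-! ### The eager semantics and the semantics `ω_t` -/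

section Original

variable {L : FirstOrder.Language.{u, v}} {Q N : Type*}

theorem Rule.ann_rename (r : Rule L Q N) (ρ : Equiv.Perm ℕ) :
    r.ann.rename ρ = (r.rename ρ).ann := by
  simp only [Rule.ann, ARule.rename, Rule.rename, label, List.zipIdx_map, Multiset.map_coe]
  rfl

theorem Rule.fv_ann (r : Rule L Q N) : r.ann.fv = r.fv := by
  simp only [ARule.fv, Rule.ann, Rule.fv, Goal.fv, fvI_label, Set.union_assoc]

theorem Rule.ann_wf (r : Rule L Q N) (h : r.keep ++ r.rem ≠ []) : r.ann.WF where
  head := h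
  nodup := by
    simp only [Rule.ann, label_map_snd, Multiset.coe_nodup]
    exact List.nodup_range'
  pos i hi := by
    simp only [ARule.ids, Rule.ann, label_map_snd, Multiset.mem_coe, List.mem_range'_1,
      Set.mem_ofPred_eq, Finset.notMem_empty, false_and, exists_false, or_false] at hi
    omega

/-- A configuration of `ω_t` with the pending built-in constraints moved to the store, and the pending
CHR constraints introduced with the identifiers given by `B`. -/
def Conf.toE (V : Set ℕ) (c : Conf L Q N) (B : Multiset (IAtom L Q)) : EConf L Q N :=
  ⟨c.store + B, c.built + c.goalBi, {t | t ∈ c.hist}, V ∪ c.fv,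
    {i | i < c.next ∨ i ∈ B.map Prod.snd}⟩

/-- All identifiers in use are less than `next`, which is positive, and those of the constraints are
distinct. -/
structure Conf.WF (c : Conf L Q N) : Prop where
  pos : 0 < c.next
  storeI : ∀ i ∈ c.store.map Prod.snd, i < c.next
  histI : ∀ t ∈ c.hist, ∀ i ∈ t.2, i < c.next
  nodup : (c.store.map Prod.snd).Nodup

/-- `B` lists the pending CHR constraints of `c` with distinct unused identifiers. -/
structure Conf.Numbers (c : Conf L Q N) (B : Multiset (IAtom L Q)) : Prop where
  chr : B.map Prod.fst = c.goalChr
  ge : ∀ i ∈ B.map Prod.snd, c.next ≤ i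
  nodup : (B.map Prod.snd).Nodup

theorem finite_mem_multiset {α : Type*} (A : Multiset α) : {i | i ∈ A}.Finite := by
  classical
  exact (Finset.finite_toSet A.toFinset).subset fun i hi => by simpa using hi

theorem Conf.WF.toE {V : Set ℕ} {c : Conf L Q N} {B : Multiset (IAtom L Q)} (h : c.WF)
    (hB : c.Numbers B) (hV : V.Finite) : (c.toE V B).WF V where
  finV := by
    have h1 : {x | ∃ b ∈ c.goalChr, x ∈ b.fv} = fvI B := by
      rw [← hB.chr]; ext x; simp [fvI]
    refine hV.union (((Set.Finite.union ?_ (fvs_finite _)).union (fvI_finite _)).union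
      (fvs_finite _))
    rw [h1]; exact fvI_finite _
  finI := (Set.finite_Iio c.next).union (finite_mem_multiset _)
  sub := Set.subset_union_left
  chrV x hx := by
    simp only [Conf.toE, fvI_add] at hx
    rcases hx with hx | ⟨b, hb, hx⟩
    · exact Or.inr (Or.inl (Or.inr hx))
    · refine Or.inr (Or.inl (Or.inl (Or.inl ⟨b.1, ?_, hx⟩)))
      rw [← hB.chr]; exact Multiset.mem_map_of_mem _ hb
  builtV x hx := by
    simp only [Conf.toE, fvs_add] at hx
    exact Or.inr (hx.elim Or.inr fun h => Or.inl (Or.inl (Or.inr h)))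
  chrI i hi := by
    simp only [Conf.toE, Multiset.map_add, Multiset.mem_add] at hi
    exact hi.imp (h.storeI i) id
  histI t ht i hi := Or.inl (h.histI t ht i hi)
  nodup := by
    simp only [Conf.toE, Multiset.map_add, Multiset.nodup_add]
    refine ⟨h.nodup, hB.nodup, Multiset.disjoint_left.2 fun {i} hi hi' => ?_⟩
    exact absurd (h.storeI i hi) (not_lt.2 (hB.ge i hi'))

theorem Ann_wf {P : Program L Q N} : ∀ w ∈ Ann P, w.WF := by
  rintro _ ⟨r, hr, rfl⟩
  exact r.ann_wf (P.head r hr)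

variable {CT : L.Theory} {P : Program L Q N} {V : Set ℕ} {a : Answer L Q} {k : ℕ}

/-- Introducing a CHR constraint only changes the identifier by which it is anticipated. -/
theorem reach_introduce {b : Atom L Q} {A : Multiset (Atom L Q)} {B : Multiset (BI L 0)}
    {S : Multiset (IAtom L Q)} {C : Multiset (BI L 0)} {T : Finset (Token N)} {n i : ℕ}
    {D : Multiset (IAtom L Q)} (hV : V.Finite)
    (hc : (⟨{b} + A, B, S, C, T, n⟩ : Conf L Q N).WF)
    (hD : (⟨{b} + A, B, S, C, T, n⟩ : Conf L Q N).Numbers ((b, i) ::ₘ D)) :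
    (⟨A, B, {(b, n)} + S, C, T, n + 1⟩ : Conf L Q N).WF ∧
    (⟨A, B, {(b, n)} + S, C, T, n + 1⟩ : Conf L Q N).Numbers (D.map fun d => (d.1, d.2 + 1)) ∧
    (Reach CT (Ann P) V a k ((⟨A, B, {(b, n)} + S, C, T, n + 1⟩ : Conf L Q N).toE V
        (D.map fun d => (d.1, d.2 + 1))) →
      Reach CT (Ann P) V a k ((⟨{b} + A, B, S, C, T, n⟩ : Conf L Q N).toE V ((b, i) ::ₘ D))) := by
  have h1 : (⟨A, B, {(b, n)} + S, C, T, n + 1⟩ : Conf L Q N).WF := by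
    refine ⟨Nat.succ_pos n, fun j hj => ?_, fun t ht j hj => Nat.lt_succ_of_lt (hc.histI t ht j hj),
      ?_⟩
    · simp only [Multiset.map_add, Multiset.map_singleton, Multiset.mem_add,
        Multiset.mem_singleton] at hj
      rcases hj with rfl | hj
      · exact Nat.lt_succ_self _
      · exact Nat.lt_succ_of_lt (hc.storeI j hj)
    · have : ({((b, n) : IAtom L Q)} + S).map Prod.snd = n ::ₘ S.map Prod.snd := by simp
      simp only [this]
      refine Multiset.nodup_cons.2 ⟨fun h => lt_irrefl _ (hc.storeI n h), hc.nodup⟩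
  have hge := hD.ge
  have hnd := hD.nodup
  have hfst := hD.chr
  simp only [Multiset.map_cons, Multiset.mem_cons, forall_eq_or_imp, Multiset.nodup_cons] at hge hnd
  simp only [Multiset.map_cons, Multiset.singleton_add, Multiset.cons_inj_right] at hfst
  have hsnd : (D.map fun d => ((d.1, d.2 + 1) : IAtom L Q)).map Prod.snd
      = (D.map Prod.snd).map (· + 1) := by simp [Multiset.map_map]
  have h2 : (⟨A, B, {(b, n)} + S, C, T, n + 1⟩ : Conf L Q N).Numbers
      (D.map fun d => (d.1, d.2 + 1)) := by
    refine ⟨by simpa [Multiset.map_map] using hfst, fun j hj => ?_, ?_⟩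
    · rw [hsnd] at hj
      obtain ⟨l, hl, rfl⟩ := Multiset.mem_map.1 hj
      have := hge.2 l hl
      simp only; omega
    · rw [hsnd]
      exact hnd.2.map fun x y h => by simpa using h
  refine ⟨h1, h2, fun h => ?_⟩
  -- a permutation that fixes the old identifiers and takes `n` to `i` and `j + 1` to `j` in `D`
  obtain ⟨π, h3, h4⟩ := exists_perm_extend (Equiv.refl ℕ) {j | j < n}
    (finite_mem_multiset (i ::ₘ D.map Prod.snd)) (g := fun j => if j = i then n else j + 1)
    (g' := id) (fun x hx y hy hxy => by
      have hx' : n ≤ x := by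
        rcases Multiset.mem_cons.1 hx with rfl | hx
        · exact hge.1
        · exact hge.2 x hx
      have hy' : n ≤ y := by
        rcases Multiset.mem_cons.1 hy with rfl | hy
        · exact hge.1
        · exact hge.2 y hy
      simp only at hxy
      split_ifs at hxy <;> omega) Function.injective_id.injOn (fun j hj hj' => by
      have hx' : n ≤ j := by
        rcases Multiset.mem_cons.1 hj with rfl | hj
        · exact hge.1
        · exact hge.2 j hj
      simp only [Set.mem_ofPred_eq] at hj'
      split_ifs at hj' <;> omega) (fun j hj m hm hmj => by
      have hx' : n ≤ j := by
        rcases Multiset.mem_cons.1 hj with rfl | hj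
        · exact hge.1
        · exact hge.2 j hj
      simp only [Set.mem_ofPred_eq, Equiv.refl_apply, id] at hm hmj
      omega)
  have hπn : π n = i := by simpa using h4 i (Multiset.mem_cons_self _ _)
  have hπ : ∀ j ∈ D.map Prod.snd, π (j + 1) = j := fun j hj => by
    have h5 : j ≠ i := fun h => hnd.1 (h ▸ hj)
    simpa [h5] using h4 j (Multiset.mem_cons_of_mem hj)
  refine h.lift (ρ := Equiv.refl ℕ) (f := π) Ann_wf (h1.toE h2 hV) (hc.toE hD hV) (fun _ _ => rfl)
    ⟨?_, fun M w => Iff.rfl, fun t ht => ?_⟩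
  · have e1 : S.map (IAtom.act (Equiv.refl ℕ) π) = S :=
      (act_congr (fun _ _ => rfl) fun j hj => h3 j (hc.storeI j hj)).trans (map_act_refl S)
    have e2 : (D.map fun d => ((d.1, d.2 + 1) : IAtom L Q)).map (IAtom.act (Equiv.refl ℕ) π) = D := by
      rw [Multiset.map_map]
      conv_rhs => rw [← Multiset.map_id D]
      exact Multiset.map_congr rfl fun d hd => Prod.ext (Atom.subst_var _)
        (hπ _ (Multiset.mem_map_of_mem _ hd))
    have e3 : IAtom.act (Equiv.refl ℕ) π ((b, n) : IAtom L Q) = (b, i) :=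
      Prod.ext (Atom.subst_var _) hπn
    simp only [Conf.toE, Multiset.map_add, Multiset.map_singleton, e1, e2, e3]
    rw [← Multiset.singleton_add]
    abel
  · have hfix : (∀ j ∈ t.2, j < n) → (t.1, t.2.map π) = t := fun h => by
      refine Prod.ext rfl ?_
      conv_rhs => rw [← List.map_id t.2]
      exact List.map_congr_left fun j hj => h3 j (h j hj)
    constructor
    · intro h5
      show _ ∈ T
      rw [hfix (hc.histI t h5)]
      exact h5
    · intro h5
      have h6 : ∀ j ∈ t.2, j < n := by
        intro j hj
        have h7 : π j < n := hc.histI _ h5 _ (List.mem_map_of_mem hj)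
        have h8 := ht j hj
        simp only [Conf.toE, Multiset.map_add, Multiset.map_singleton, Multiset.mem_add,
          Multiset.mem_singleton, hsnd] at h8
        rcases h8 with (rfl | h8) | h8
        · rw [hπn] at h7; omega
        · exact hc.storeI j h8
        · obtain ⟨l, hl, rfl⟩ := Multiset.mem_map.1 h8
          rw [hπ l hl] at h7
          have := hge.2 l hl
          omega
      rw [hfix h6] at h5
      exact h5

variable [DecidableEq N]

/-- What makes `a` a qualified answer from `c`: a final configuration with this answer, or
inconsistency. -/
def Conf.Yields (CT : L.Theory) (P : Program L Q N) (V : Set ℕ) (a : Answer L Q)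
    (c : Conf L Q N) : Prop :=
  (c.goalChr = 0 ∧ c.goalBi = 0 ∧ (∀ σ, ¬ Step CT P V c σ) ∧
      Answer.Same CT V (c.store.map Prod.fst, c.built) a) ∨
    (¬ Sat CT a.2 ∧ ¬ Sat CT c.built)

theorem Conf.canFire_of_step {c c' : Conf L Q N} (h : Step CT P V c c') (hc : c.goalChr = 0)
    (hb : c.goalBi = 0) :
    ∃ w ∈ Ann P, ∃ (ρ : Equiv.Perm ℕ) (S₁ S₂ : List (IAtom L Q)) (S : Multiset (IAtom L Q)),
      CanFire CT (c.toE V 0) (w.rename ρ) S₁ S₂ S := by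
  cases h with
  | solve => simp at hb
  | introduce => simp at hc
  | apply r₀ r ρ A B S₁ S₂ S C T n mem variant fresh keep rem entails token =>
    subst variant
    refine ⟨r₀.ann, ⟨r₀, mem, rfl⟩, ρ, S₁, S₂, S, ?_⟩
    rw [Rule.ann_rename]
    refine ⟨add_zero _, ?_, keep, rem, fun M w hw => entails M w ?_, token⟩
    · rw [Rule.fv_ann]; exact fresh
    · exact ((holds_add w _ _).1 hw).1

/-- Firing a rule in `ω_t` is firing its annotated version in the eager semantics, where the
constraints of the body get identifiers at once. -/
theorem reach_apply {r : Rule L Q N} {A : Multiset (Atom L Q)} {B : Multiset (BI L 0)}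
    {S₁ S₂ : List (IAtom L Q)} {S : Multiset (IAtom L Q)} {C : Multiset (BI L 0)}
    {T : Finset (Token N)} {n : ℕ} {D : Multiset (IAtom L Q)} {g : ℕ → ℕ} (hV : V.Finite)
    (hr : r.keep ++ r.rem ≠ [])
    (hc : (⟨A, B, ↑S₁ + ↑S₂ + S, C, T, n⟩ : Conf L Q N).WF)
    (hD : (⟨A, B, ↑S₁ + ↑S₂ + S, C, T, n⟩ : Conf L Q N).Numbers D)
    (hf : CanFire CT ((⟨A, B, ↑S₁ + ↑S₂ + S, C, T, n⟩ : Conf L Q N).toE V D) r.ann S₁ S₂ (S + D))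
    (hg : FreshIds r.ann g ((⟨A, B, ↑S₁ + ↑S₂ + S, C, T, n⟩ : Conf L Q N).toE V D).ids)
    (c : Conf L Q N) (hcw : c.WF) (E : Multiset (IAtom L Q)) (hE : c.Numbers E)
    (hchr : c.store + E = r.ann.chr.map (fun d => (d.1, g d.2)) + (↑S₁ + S + D))
    (hb : c.built + c.goalBi = headEqs (chrL S₁) r.keep + headEqs (chrL S₂) r.rem + C +
      (r.body.bi + B))
    (hT : c.hist = addToken T r.name S₁ S₂) :
    Reach CT (Ann P) V a k (fire ((⟨A, B, ↑S₁ + ↑S₂ + S, C, T, n⟩ : Conf L Q N).toE V D)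
      r.ann g S₁ S₂ (S + D)) ↔ Reach CT (Ann P) V a k (c.toE V E) := by
  have h1 := (hc.toE hD hV).fire (r.ann_wf hr) hf hg
  have h2 := hcw.toE hE hV
  have e1 : (fire ((⟨A, B, ↑S₁ + ↑S₂ + S, C, T, n⟩ : Conf L Q N).toE V D)
      r.ann g S₁ S₂ (S + D)).chr = (c.toE V E).chr := by
    simp only [fire, Conf.toE, hchr]; abel
  have e2 : (fire ((⟨A, B, ↑S₁ + ↑S₂ + S, C, T, n⟩ : Conf L Q N).toE V D)
      r.ann g S₁ S₂ (S + D)).built = (c.toE V E).built := by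
    simp only [fire, Conf.toE, hb, Rule.ann]; abel
  have e3 : ∀ t, t ∈ (fire ((⟨A, B, ↑S₁ + ↑S₂ + S, C, T, n⟩ : Conf L Q N).toE V D)
      r.ann g S₁ S₂ (S + D)).hist ↔ t ∈ (c.toE V E).hist := by
    intro t
    simp [fire, Conf.toE, hT, mem_addToken, Rule.ann]
  exact ⟨fun h => h.congr Ann_wf h1 h2 e1.symm (fun M w => by rw [e2]) fun t _ => e3 t,
    fun h => h.congr Ann_wf h2 h1 e1 (fun M w => by rw [e2]) fun t _ => (e3 t).symm⟩

/-- A derivation in `ω_t` is an eager one, whatever identifiers `D` are anticipated for the pending CHR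
constraints. -/
theorem Conf.reach_of_steps (hV : V.Finite) {c c' : Conf L Q N}
    (h : Relation.ReflTransGen (Step CT P V) c c') (h' : c'.Yields CT P V a) (hc : c.WF) :
    ∀ D, c.Numbers D → ∃ k, Reach CT (Ann P) V a k (c.toE V D) := by
  induction h using Relation.ReflTransGen.head_induction_on with
  | refl =>
    intro D hD
    rcases h' with ⟨h0, h1, h2, h3⟩ | ⟨h1, h2⟩
    · refine ⟨0, ?_⟩
      have hD0 : D = 0 := by
        have := hD.chr
        rwa [h0, Multiset.map_eq_zero] at this
      subst hD0
      have hb : (c'.toE V 0).built = c'.built := by simp [Conf.toE, h1]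
      have hs' : (c'.toE V 0).chr = c'.store := by simp [Conf.toE]
      by_cases hs : Sat CT c'.built
      · refine .final (hb ▸ hs) ?_ (by rw [hb, hs']; exact h3)
        rintro _ ⟨r, hr, rfl⟩ ρ S₁ S₂ S h
        obtain ⟨A, B, S', C, T, n⟩ := c'
        have hch := h.chr
        have he := h.entails
        have hfr := h.fresh
        rw [hb] at he
        rw [Rule.ann_rename] at h he hfr
        rw [Rule.fv_ann] at hfr
        simp only [Conf.toE, add_zero] at hch
        subst hch
        exact h2 _ (Step.apply r _ ρ A B S₁ S₂ S C T n hr rfl hfr h.keep h.rem he h.token)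
      · exact .unsat (hb ▸ hs) (not_sat_of_same h3 hs)
    · exact ⟨0, .unsat (fun ⟨M, w, hw⟩ => h2 ⟨M, w, ((holds_add w _ _).1 hw).1⟩) h1⟩
  | @head c d hstep _ ih =>
    intro D hD
    cases hstep with
    | solve A B b S C C' T n h =>
      have hd : (⟨A, B, S, C', T, n⟩ : Conf L Q N).WF := ⟨hc.pos, hc.storeI, hc.histI, hc.nodup⟩
      have hD' : (⟨A, B, S, C', T, n⟩ : Conf L Q N).Numbers D := ⟨hD.chr, hD.ge, hD.nodup⟩
      obtain ⟨k, hk⟩ := ih hd D hD'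
      refine ⟨k, hk.congr Ann_wf (hd.toE hD' hV) (hc.toE hD hV) rfl (fun M w => ?_)
        fun _ _ => Iff.rfl⟩
      have h1 := h.1 M w
      have h2 := h.2 M w
      simp only [Conf.toE, holds_add] at h1 h2 ⊢
      tauto
    | introduce b A B S C T n =>
      have hb : b ∈ D.map Prod.fst := by rw [hD.chr]; simp
      obtain ⟨⟨b, i⟩, hbD, rfl⟩ := Multiset.mem_map.1 hb
      obtain ⟨D, rfl⟩ := Multiset.exists_cons_of_mem hbD
      have h1 := fun k => reach_introduce (CT := CT) (P := P) (a := a) (k := k) hV hc hD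
      obtain ⟨k, hk⟩ := ih (h1 0).1 _ (h1 0).2.1
      exact ⟨k, (h1 k).2.2 hk⟩
    | apply r₀ r ρ A B S₁ S₂ S C T n mem variant fresh keep rem entails token =>
      have hr : r.keep ++ r.rem ≠ [] := by
        subst variant
        simpa [Rule.rename] using P.head r₀ mem
      have hf : CanFire CT ((⟨A, B, ↑S₁ + ↑S₂ + S, C, T, n⟩ : Conf L Q N).toE V D) r.ann S₁ S₂
          (S + D) :=
        ⟨by simp only [Conf.toE]; abel, by rw [Rule.fv_ann]; exact fresh, keep, rem,
          fun M w hw => entails M w ((holds_add w _ _).1 hw).1, token⟩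
      -- the constraints of the body are numbered beyond all identifiers in use or anticipated
      obtain ⟨m, hm⟩ := (hc.toE hD hV).finI.bddAbove
      have hle : ∀ i ∈ ((⟨A, B, ↑S₁ + ↑S₂ + S, C, T, n⟩ : Conf L Q N).toE V D).ids, i ≤ m :=
        fun i hi => hm hi
      have hnm : n ≤ m + 1 := by
        have h1 := hc.pos
        have h2 : n - 1 ≤ m := hle _ (Or.inl (by simp only at h1 ⊢; omega))
        omega
      have hg := freshIds_add r.ann (r.ann_wf hr).pos m hle
      have hpos := (r.ann_wf hr).pos
      have hwf' : (⟨↑r.body.chr + A, r.body.bi + B, ↑S₁ + S,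
          headEqs (chrL S₁) r.keep + headEqs (chrL S₂) r.rem + C,
          addToken T r.name S₁ S₂, n⟩ : Conf L Q N).WF := by
        have h1 := hc.storeI
        have h2 := hc.nodup
        simp only [Multiset.map_add, Multiset.mem_add] at h1 h2
        refine ⟨hc.pos, fun i hi => ?_, fun t ht i hi => ?_, ?_⟩
        · simp only [Multiset.map_add, Multiset.mem_add] at hi
          exact h1 i (hi.imp_left Or.inl)
        · rcases mem_addToken.1 ht with ht | ⟨-, rfl⟩
          · exact hc.histI t ht i hi
          · exact h1 i (Or.inl (Or.inl (by simpa [idL] using hi)))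
        · refine Multiset.nodup_of_le ?_ h2
          rw [Multiset.map_add]
          gcongr
          exact Multiset.le_add_right _ _
      have hsnd : (r.ann.chr.map fun d => ((d.1, d.2 + m) : IAtom L Q)).map Prod.snd
          = (r.ann.chr.map Prod.snd).map (· + m) := by simp [Multiset.map_map]
      have hD' : (⟨↑r.body.chr + A, r.body.bi + B, ↑S₁ + S,
          headEqs (chrL S₁) r.keep + headEqs (chrL S₂) r.rem + C,
          addToken T r.name S₁ S₂, n⟩ : Conf L Q N).Numbers
          (r.ann.chr.map (fun d => (d.1, d.2 + m)) + D) := by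
        refine ⟨?_, fun i hi => ?_, ?_⟩
        · simp only [Multiset.map_add, Multiset.map_map, Function.comp_def, hD.chr]
          have : r.ann.chr.map (fun d => d.1) = ↑r.body.chr := label_map_fst 0 _
          rw [this]
        · rw [Multiset.map_add, Multiset.mem_add, hsnd] at hi
          rcases hi with hi | hi
          · obtain ⟨j, hj, rfl⟩ := Multiset.mem_map.1 hi
            have := hpos j (Or.inl hj)
            simp only; omega
          · exact hD.ge i hi
        · rw [Multiset.map_add, hsnd, Multiset.nodup_add]
          refine ⟨(r.ann_wf hr).nodup.map fun x y h => by simpa using h, hD.nodup,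
            Multiset.disjoint_left.2 fun {i} hi hi' => ?_⟩
          obtain ⟨j, hj, rfl⟩ := Multiset.mem_map.1 hi
          exact hg.avoid j (Or.inl hj) (Or.inr hi')
      obtain ⟨k, hk⟩ := ih hwf' _ hD'
      refine ⟨k + 1, ?_⟩
      have h1 := (reach_apply hV hr hc hD hf hg _ hwf' _ hD'
        (by simp only; generalize Multiset.map _ r.ann.chr = X; abel) (by rfl) rfl).2 hk
      subst variant
      rw [← Rule.ann_rename] at h1 hf hg
      exact .fire ⟨r₀, mem, rfl⟩ hf hg h1

theorem Conf.solve_all (A : Multiset (Atom L Q)) (S : Multiset (IAtom L Q)) (B C : Multiset (BI L 0))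
    (T : Finset (Token N)) (n : ℕ) :
    Relation.ReflTransGen (Step CT P V) ⟨A, B, S, C, T, n⟩ ⟨A, 0, S, B + C, T, n⟩ := by
  induction B using Multiset.induction_on generalizing C with
  | empty => rw [zero_add]
  | cons b B ih =>
    have h : Step CT P V ⟨A, {b} + B, S, C, T, n⟩ ⟨A, B, S, {b} + C, T, n⟩ :=
      .solve A B b S C _ T n ⟨fun _ _ h => h, fun _ _ h => h⟩
    have := (Relation.ReflTransGen.single h).trans (ih ({b} + C))
    rwa [show B + ({b} + C) = {b} + B + C by abel, Multiset.singleton_add] at this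

theorem Conf.introduce_all (l : List (Atom L Q)) (B : Multiset (BI L 0)) (S : Multiset (IAtom L Q))
    (C : Multiset (BI L 0)) (T : Finset (Token N)) (n : ℕ) :
    Relation.ReflTransGen (Step CT P V) ⟨↑l, B, S, C, T, n⟩
      ⟨0, B, ↑(l.zipIdx n) + S, C, T, n + l.length⟩ := by
  induction l generalizing S n with
  | nil =>
    have : ((([] : List (Atom L Q)).zipIdx n : List (IAtom L Q)) : Multiset (IAtom L Q)) + S = S := by
      simp
    rw [this]; rfl
  | cons b l ih =>
    have h : Step CT P V ⟨{b} + ↑l, B, S, C, T, n⟩ ⟨↑l, B, {(b, n)} + S, C, T, n + 1⟩ :=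
      .introduce b ↑l B S C T n
    have := (Relation.ReflTransGen.single h).trans (ih ({(b, n)} + S) (n + 1))
    rw [List.zipIdx_cons, List.length_cons]
    have e1 : (((b, n) :: l.zipIdx (n + 1) : List (IAtom L Q)) : Multiset (IAtom L Q)) + S
        = ↑(l.zipIdx (n + 1)) + ({(b, n)} + S) := by
      rw [← Multiset.cons_coe, ← Multiset.singleton_add]; abel
    have e2 : n + (l.length + 1) = n + 1 + l.length := by omega
    rw [e1, e2]
    exact this

/-- Conversely, eager derivations are followed by introducing and solving all new constraints after
each rule application. -/
theorem Conf.steps_of_reach (hV : V.Finite) (k : ℕ) :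
    ∀ c : Conf L Q N, c.WF → c.goalChr = 0 → c.goalBi = 0 → Reach CT (Ann P) V a k (c.toE V 0) →
      ∃ c', Relation.ReflTransGen (Step CT P V) c c' ∧ c'.Yields CT P V a := by
  have hfinal : ∀ c : Conf L Q N, c.goalChr = 0 → c.goalBi = 0 →
      (∀ w ∈ Ann P, ∀ (ρ : Equiv.Perm ℕ) (S₁ S₂ : List (IAtom L Q)) (S : Multiset (IAtom L Q)),
        ¬ CanFire CT (c.toE V 0) (w.rename ρ) S₁ S₂ S) →
      Answer.Same CT V ((c.toE V 0).chr.map Prod.fst, (c.toE V 0).built) a →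
      ∃ c', Relation.ReflTransGen (Step CT P V) c c' ∧ c'.Yields CT P V a := by
    intro c hch hbi hf ha
    refine ⟨c, .refl, Or.inl ⟨hch, hbi, fun σ hσ => ?_, ?_⟩⟩
    · obtain ⟨w, hw, ρ, S₁, S₂, S, h⟩ := Conf.canFire_of_step hσ hch hbi
      exact hf w hw ρ S₁ S₂ S h
    · simpa [Conf.toE, hbi] using ha
  induction k with
  | zero =>
    intro c hc hch hbi h
    cases h with
    | unsat h ha => exact ⟨c, .refl, Or.inr ⟨ha, by simpa [Conf.toE, hbi] using h⟩⟩
    | final h hf ha => exact hfinal c hch hbi hf ha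
  | succ k ih =>
    intro c hc hch hbi h
    cases h with
    | unsat h ha => exact ⟨c, .refl, Or.inr ⟨ha, by simpa [Conf.toE, hbi] using h⟩⟩
    | final h hf ha => exact hfinal c hch hbi hf ha
    | @fire _ _ w ρ g S₁ S₂ S mem hf hg h =>
      obtain ⟨r₀, hr₀, rfl⟩ := mem
      obtain ⟨A, B, S', C, T, n⟩ := c
      have hch' := hf.chr
      simp only [Conf.toE, add_zero] at hch' hbi hch
      subst hch' hbi hch
      rw [Rule.ann_rename] at hf hg h
      obtain ⟨n, rfl⟩ : ∃ m, n = m + 1 := ⟨n - 1, by have := hc.pos; simp only at this; omega⟩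
      generalize hr : r₀.rename ρ = r at hf hg h
      have hhead : r.keep ++ r.rem ≠ [] := by
        subst hr
        simpa [Rule.rename] using P.head r₀ hr₀
      have hw := r.ann_wf hhead
      have hD : (⟨0, 0, ↑S₁ + ↑S₂ + S, C, T, n + 1⟩ : Conf L Q N).Numbers 0 := ⟨rfl, by simp, by simp⟩
      have hg' := freshIds_add r.ann hw.pos n
        (I := ((⟨0, 0, ↑S₁ + ↑S₂ + S, C, T, n + 1⟩ : Conf L Q N).toE V 0).ids) fun i hi => by
          rcases hi with hi | hi
          · exact Nat.lt_succ_iff.1 hi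
          · simp at hi
      have h1 := Reach.fire_reid Ann_wf (hc.toE hD hV) hw hf hg hg' h
      -- introducing the constraints of the body in the order in which they are listed yields the
      -- identifiers that the annotation gives them
      have hlab : (r.ann.chr.map fun d => ((d.1, d.2 + n) : IAtom L Q))
          = ↑(r.body.chr.zipIdx (n + 1)) := by
        rw [← List.map_snd_add_zipIdx_eq_zipIdx]
        rfl
      have hlabI : ∀ i ∈ (r.ann.chr.map fun d => ((d.1, d.2 + n) : IAtom L Q)).map Prod.snd,
          i < n + 1 + r.body.chr.length := by
        rw [hlab, Multiset.map_coe, List.zipIdx_map_snd]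
        intro i hi
        exact (List.mem_range'_1.1 hi).2
      have hfw := (hc.toE hD hV).fire hw hf hg'
      have hS : ∀ S', S' = S →
          CanFire CT ((⟨0, 0, ↑S₁ + ↑S₂ + S, C, T, n + 1⟩ : Conf L Q N).toE V 0) r.ann S₁ S₂ S' ∧
          Reach CT (Ann P) V a k (CHR.fire
            ((⟨0, 0, ↑S₁ + ↑S₂ + S, C, T, n + 1⟩ : Conf L Q N).toE V 0) r.ann (· + n) S₁ S₂ S') := by
        rintro _ rfl
        exact ⟨hf, h1⟩
      obtain ⟨hf0, h10⟩ := hS (S + 0) (add_zero S)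
      have hstore : (fire ((⟨0, 0, ↑S₁ + ↑S₂ + S, C, T, n + 1⟩ : Conf L Q N).toE V 0) r.ann (· + n)
          S₁ S₂ S).chr = ↑(r.body.chr.zipIdx (n + 1)) + (↑S₁ + S) := by
        simp only [CHR.fire, hlab]; abel
      have hold : ∀ i ∈ ((↑S₁ : Multiset (IAtom L Q)) + S).map Prod.snd, i < n + 1 := by
        intro i hi
        refine hc.storeI i ?_
        simp only [Multiset.map_add, Multiset.mem_add] at hi ⊢
        exact hi.imp_left Or.inl
      have hcw : (⟨0, 0, ↑(r.body.chr.zipIdx (n + 1)) + (↑S₁ + S), r.body.bi + 0 +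
          (headEqs (chrL S₁) r.keep + headEqs (chrL S₂) r.rem + C),
          addToken T r.name S₁ S₂, n + 1 + r.body.chr.length⟩ : Conf L Q N).WF := by
        refine ⟨by simp only; omega, fun i hi => ?_, fun t ht i hi => ?_, ?_⟩
        · simp only at hi ⊢
          rw [Multiset.map_add, Multiset.mem_add, ← hlab] at hi
          rcases hi with hi | hi
          · exact hlabI i hi
          · have := hold i hi; omega
        · have : i < n + 1 := by
            rcases mem_addToken.1 ht with ht | ⟨-, rfl⟩
            · exact hc.histI t ht i hi
            · refine hold i ?_
              rw [Multiset.map_add, Multiset.mem_add]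
              exact Or.inl (by simpa [idL] using hi)
          simp only; omega
        · have := hfw.nodup
          rwa [hstore] at this
      have hE : (⟨0, 0, ↑(r.body.chr.zipIdx (n + 1)) + (↑S₁ + S), r.body.bi + 0 +
          (headEqs (chrL S₁) r.keep + headEqs (chrL S₂) r.rem + C),
          addToken T r.name S₁ S₂, n + 1 + r.body.chr.length⟩ : Conf L Q N).Numbers 0 :=
        ⟨rfl, by simp, by simp⟩
      obtain ⟨c', h2, h3⟩ := ih _ hcw rfl rfl ((reach_apply hV hhead hc hD hf0 hg' _ hcw 0 hE
        (by simp only [hlab, add_zero]) (by simp only [add_zero]; abel) rfl).1 h10)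
      refine ⟨c', ?_, h3⟩
      have hfr := hf.fresh
      rw [Rule.fv_ann] at hfr
      have he := hf.entails
      simp only [Conf.toE, add_zero] at he
      refine .head (Step.apply r₀ r ρ 0 0 S₁ S₂ S C T (n + 1) hr₀ hr.symm hfr hf.keep hf.rem
        he hf.token) (.trans ?_ h2)
      have h4 := Conf.introduce_all (CT := CT) (P := P) (V := V) r.body.chr (r.body.bi + 0)
        (↑S₁ + S) (headEqs (chrL S₁) r.keep + headEqs (chrL S₂) r.rem + C)
        (addToken T r.name S₁ S₂) (n + 1)
      rw [add_zero (r.body.chr : Multiset (Atom L Q))]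
      exact h4.trans (Conf.solve_all _ _ _ _ _ _)

/-- The eager semantics for the annotated version of a program gives the qualified answers of `ω_t`. -/
theorem mem_QA_iff (G : Goal L Q) :
    a ∈ QA CT P G ↔ ∃ k, Reach CT (Ann P) G.fv a k (initE N G) := by
  have hwf0 := initE_wf (N := N) G
  have hcw : (⟨↑G.chr, G.bi, 0, 0, ∅, 1⟩ : Conf L Q N).WF := ⟨by simp, by simp, by simp, by simp⟩
  have hn : (⟨↑G.chr, G.bi, 0, 0, ∅, 1⟩ : Conf L Q N).Numbers (label 0 G.chr) := by
    refine ⟨label_map_fst 0 _, fun i hi => ?_, ?_⟩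
    · rw [label_map_snd] at hi
      exact (List.mem_range'_1.1 hi).1
    · exact hwf0.nodup
  have hcw' : (⟨0, 0, ↑(G.chr.zipIdx 1) + 0, G.bi + 0, ∅, 1 + G.chr.length⟩ : Conf L Q N).WF := by
    refine ⟨by simp only; omega, fun i hi => ?_, by simp, ?_⟩
    · simp only [add_zero] at hi ⊢
      have := hwf0.chrI i hi
      have : i ≤ G.chr.length := this
      omega
    · simp only [add_zero]
      exact hwf0.nodup
  have hn' : (⟨0, 0, ↑(G.chr.zipIdx 1) + 0, G.bi + 0, ∅, 1 + G.chr.length⟩ : Conf L Q N).Numbers 0 :=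
    ⟨rfl, by simp, by simp⟩
  constructor
  · have key : ∀ k, Reach CT (Ann P) G.fv a k
        ((⟨↑G.chr, G.bi, 0, 0, ∅, 1⟩ : Conf L Q N).toE G.fv (label 0 G.chr)) →
        Reach CT (Ann P) G.fv a k (initE N G) := fun k h =>
      h.congr Ann_wf (hcw.toE hn G.fv_finite) hwf0 (by simp [Conf.toE, initE])
        (fun M w => by simp [Conf.toE, initE]) fun t _ => by simp [Conf.toE, initE]
    rintro (⟨K, d, T, n, h1, h2, h3⟩ | ⟨h1, σ, h2, h3⟩)
    · obtain ⟨k, hk⟩ := Conf.reach_of_steps G.fv_finite h1 (Or.inl ⟨rfl, rfl, h2, h3⟩) hcw _ hn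
      exact ⟨k, key k hk⟩
    · obtain ⟨k, hk⟩ := Conf.reach_of_steps G.fv_finite h3 (Or.inr ⟨h1, h2⟩) hcw _ hn
      exact ⟨k, key k hk⟩
  · rintro ⟨k, hk⟩
    obtain ⟨c, h1, h2⟩ := Conf.steps_of_reach G.fv_finite k _ hcw' rfl rfl
      (hk.congr Ann_wf hwf0 (hcw'.toE hn' G.fv_finite) (by simp [Conf.toE, initE, label])
        (fun M w => by simp [Conf.toE, initE]) fun t _ => by simp [Conf.toE, initE])
    have h3 := ((Conf.introduce_all (CT := CT) (P := P) (V := G.fv) G.chr G.bi 0 0 ∅ 1).trans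
      (Conf.solve_all _ _ _ _ _ _)).trans h1
    rcases h2 with ⟨h0, h4, h5, h6⟩ | ⟨h4, h5⟩
    · obtain ⟨A, B, K, d, T, n⟩ := c
      simp only at h4 h0
      subst h4 h0
      exact Or.inl ⟨K, d, T, n, h3, h5, h6⟩
    · exact Or.inr ⟨h4, c, h5, h3⟩

end Original


/-! ### Unfolding is invariant under renaming -/

section Equivariance

variable {L : FirstOrder.Language.{u, v}} {Q N : Type*} {CT : L.Theory}

/-- The conjugate of a substitution by a permutation of the variables. -/
def conjSubst (π : Equiv.Perm ℕ) (θ : ℕ → L.Term ℕ) : ℕ → L.Term ℕ :=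
  fun y => (θ (π.symm y)).subst (ren π)

theorem BI.subst_conj (c : BI L 0) (π : Equiv.Perm ℕ) (θ : ℕ → L.Term ℕ) :
    (c.subst (ren π)).subst (conjSubst π θ) = (c.subst θ).subst (ren π) := by
  rw [BI.subst_subst, BI.subst_subst]
  congr 1; funext x
  simp [ren, Language.Term.subst, conjSubst]

theorem Atom.subst_conj (b : Atom L Q) (π : Equiv.Perm ℕ) (θ : ℕ → L.Term ℕ) :
    (b.subst (ren π)).subst (conjSubst π θ) = (b.subst θ).subst (ren π) := by
  rw [Atom.subst_subst, Atom.subst_subst]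
  congr 1; funext x
  simp [ren, Language.Term.subst, conjSubst]

theorem entails_rename {C D : Multiset (BI L 0)} (h : Entails CT C D) (π : Equiv.Perm ℕ) :
    Entails CT (C.map (BI.subst (ren π))) (D.map (BI.subst (ren π))) := fun M w hw =>
  (holds_map_ren w D π).2 (h M _ ((holds_map_ren w C π).1 hw))

theorem mapBI_symm (C : Multiset (BI L 0)) (π : Equiv.Perm ℕ) :
    (C.map (BI.subst (ren π))).map (BI.subst (ren π.symm)) = C := by
  rw [mapBI_ren_trans, Equiv.self_trans_symm, mapBI_refl]

theorem entails_rename_iff {C D : Multiset (BI L 0)} (π : Equiv.Perm ℕ) :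
    Entails CT (C.map (BI.subst (ren π))) (D.map (BI.subst (ren π))) ↔ Entails CT C D := by
  refine ⟨fun h => ?_, fun h => entails_rename h π⟩
  have := entails_rename h π.symm
  rwa [mapBI_symm, mapBI_symm] at this

theorem sat_rename {C : Multiset (BI L 0)} (h : Sat CT C) (π : Equiv.Perm ℕ) :
    Sat CT (C.map (BI.subst (ren π))) := by
  obtain ⟨M, w, hw⟩ := h
  refine ⟨M, w ∘ π.symm, (holds_map_ren _ C π).2 ?_⟩
  have : (w ∘ π.symm) ∘ π = w := by ext; simp
  rwa [this]

theorem entailsEx_rename {C D : Multiset (BI L 0)} {x y : Set ℕ} (h : EntailsEx CT C x D)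
    (π : Equiv.Perm ℕ) (hxy : ∀ z, z ∈ y ↔ π.symm z ∈ x) :
    EntailsEx CT (C.map (BI.subst (ren π))) y (D.map (BI.subst (ren π))) := by
  intro M w hw
  obtain ⟨w', h1, h2⟩ := h M _ ((holds_map_ren w C π).1 hw)
  refine ⟨w' ∘ π.symm, fun z hz => ?_, (holds_map_ren _ D π).2 ?_⟩
  · rw [Function.comp_apply, h1 _ (fun h => hz ((hxy z).2 h))]; simp
  · have : (w' ∘ π.symm) ∘ π = w' := by ext; simp
    rwa [this]

theorem residualGuard_rename (r w : ARule L Q N) (θ : ℕ → L.Term ℕ) (π : Equiv.Perm ℕ) :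
    (residualGuard CT (r.rename π) (w.rename π) (conjSubst π θ)).map (BI.subst (conjSubst π θ))
      = ((residualGuard CT r w θ).map (BI.subst θ)).map (BI.subst (ren π)) := by
  unfold residualGuard
  rw [show (w.rename π).guard = w.guard.map (BI.subst (ren π)) from rfl, Multiset.filter_map,
    Multiset.map_map, Multiset.map_map]
  have : ∀ c ∈ w.guard, ((fun c => ¬ Entails CT ((r.rename π).bi + (r.rename π).guard)
      {BI.subst (conjSubst π θ) c}) ∘ BI.subst (ren π)) c ↔
      ¬ Entails CT (r.bi + r.guard) {c.subst θ} := by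
    intro c _
    rw [Function.comp_apply, BI.subst_conj, ← Multiset.map_singleton (BI.subst (ren π))]
    simp only [ARule.rename]
    rw [← Multiset.map_add, entails_rename_iff]
  classical
  exact Multiset.map_congr (by convert Multiset.filter_congr this) fun c _ => BI.subst_conj c π θ

theorem disjoint_rename {w w' : ARule L Q N} (h : Disjoint w.fv w'.fv) (π : Equiv.Perm ℕ) :
    Disjoint (w.rename π).fv (w'.rename π).fv :=
  Set.disjoint_left.2 fun _ hx hx' => Set.disjoint_left.1 h ((ARule.mem_fv_rename _ _ _).1 hx)
    ((ARule.mem_fv_rename _ _ _).1 hx')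

theorem IsVariant.rename {w w' : ARule L Q N} (h : IsVariant w w') (π : Equiv.Perm ℕ) :
    IsVariant w (w'.rename π) := by
  obtain ⟨ρ, rfl⟩ := h
  exact ⟨ρ.trans π, w.rename_rename ρ π⟩

theorem ApartVariant.rename {P : Set (ARule L Q N)} {r w : ARule L Q N} (h : ApartVariant P r w)
    (π : Equiv.Perm ℕ) : ApartVariant P (r.rename π) (w.rename π) := by
  obtain ⟨⟨w₀, h1, h2⟩, h3⟩ := h
  exact ⟨⟨w₀, h1, h2.rename π⟩, disjoint_rename h3 π⟩

theorem maxId_rename (w : ARule L Q N) (π : Equiv.Perm ℕ) :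
    maxId (w.rename π).chr (w.rename π).tok = maxId w.chr w.tok := by
  simp only [maxId, ARule.rename, Multiset.map_map, Function.comp_def]

theorem rename_symm_rename (w : ARule L Q N) (π : Equiv.Perm ℕ) :
    (w.rename π).rename π.symm = w := by
  rw [ARule.rename_rename, Equiv.self_trans_symm, ARule.rename_refl]

variable [DecidableEq N]

/-- The data of an unfolding: `r` unfolds with `w` to `u` by means of the atoms `S₁`, `S₂` of its
body and of the substitution `θ`, while the atoms `K` are not used. -/
structure UnfoldsBy (CT : L.Theory) (r w : ARule L Q N) (K : Multiset (IAtom L Q))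
    (S₁ S₂ : List (IAtom L Q)) (θ : ℕ → L.Term ℕ) (u : ARule L Q N) : Prop where
  apart : Disjoint w.fv r.fv
  chr : r.chr = K + ↑S₁ + ↑S₂
  keep : SameSymbols (chrL S₁) w.keep
  rem : SameSymbols (chrL S₂) w.rem
  supp : ∀ x, x ∉ fvL w.keep ∪ fvL w.rem → θ x = .var x
  entails : Entails CT (r.bi + r.guard) (headEqs (chrL S₁) (w.keep.map (Atom.subst θ)) +
    headEqs (chrL S₂) (w.rem.map (Atom.subst θ)))
  token : (w.name, idL (S₁ ++ S₂)) ∉ r.tok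
  sat : Sat CT (r.guard + (residualGuard CT r w θ).map (BI.subst θ))
  eq : u = {
    name := r.name
    keep := r.keep
    rem := r.rem
    guard := r.guard + (residualGuard CT r w θ).map (BI.subst θ)
    chr := K + ↑S₁ + (inst w.chr w.tok (maxId r.chr r.tok)).1
    bi := w.bi + r.bi + (headEqs (chrL S₁) w.keep + headEqs (chrL S₂) w.rem)
    tok := addToken (clean (K + ↑S₁) r.tok ∪ (inst w.chr w.tok (maxId r.chr r.tok)).2.1)
      w.name S₁ S₂ }

theorem unfolds_iff {r w u : ARule L Q N} {ids : List ℕ} :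
    Unfolds CT r w ids u ↔ ∃ K S₁ S₂ θ, UnfoldsBy CT r w K S₁ S₂ θ u ∧ ids = idL (S₁ ++ S₂) := by
  constructor
  · rintro ⟨K, S₁, S₂, θ, h1, h2, h3, h4, h5, h6, h7, h8, h9, h10⟩
    subst h3
    exact ⟨K, S₁, S₂, θ, ⟨h1, h2, h4, h5, h6, h7, h8, h9, h10⟩, rfl⟩
  · rintro ⟨K, S₁, S₂, θ, h, rfl⟩
    exact ⟨K, S₁, S₂, θ, h.apart, h.chr, rfl, h.keep, h.rem, h.supp, h.entails, h.token, h.sat, h.eq⟩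

/-- The unfolding of a variant is a variant of the unfolding, with the conjugate substitution. -/
theorem UnfoldsBy.rename {r w u : ARule L Q N} {K : Multiset (IAtom L Q)} {S₁ S₂ : List (IAtom L Q)}
    {θ : ℕ → L.Term ℕ} (h : UnfoldsBy CT r w K S₁ S₂ θ u) (π : Equiv.Perm ℕ) :
    UnfoldsBy CT (r.rename π) (w.rename π) (K.map (IAtom.act π id)) (S₁.map (IAtom.act π id))
      (S₂.map (IAtom.act π id)) (conjSubst π θ) (u.rename π) := by
  have hconj : ∀ H : List (Atom L Q), (H.map (Atom.subst (ren π))).map (Atom.subst (conjSubst π θ))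
      = (H.map (Atom.subst θ)).map (Atom.subst (ren π)) := by
    intro H
    rw [List.map_map, List.map_map]
    exact List.map_congr_left fun b _ => Atom.subst_conj b π θ
  have hid : ∀ S : List (IAtom L Q), idL (S.map (IAtom.act π id)) = idL S := fun S => by
    rw [idL_act, List.map_id]
  constructor
  · exact disjoint_rename h.apart π
  · rw [rename_chr, h.chr]; simp
  · rw [chrL_act]; exact (sameSymbols_ren _ _).2 h.keep
  · rw [chrL_act]; exact (sameSymbols_ren _ _).2 h.rem
  · intro x hx
    have h1 := h.supp (π.symm x) (fun hx' => hx (by simpa [ARule.rename, mem_fvL_ren] using hx'))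
    simp [conjSubst, h1, Language.Term.subst, ren]
  · have h1 := entails_rename h.entails π
    rw [Multiset.map_add, Multiset.map_add, headEqs_map, headEqs_map, ← hconj, ← hconj,
      ← chrL_act S₁ π id, ← chrL_act S₂ π id] at h1
    exact h1
  · rw [← List.map_append, hid]; exact h.token
  · rw [residualGuard_rename]
    have h1 := sat_rename h.sat π
    rw [Multiset.map_add] at h1
    exact h1
  · rw [residualGuard_rename, maxId_rename, h.eq]
    have e1 : ∀ A : Multiset (IAtom L Q), clean (A.map (IAtom.act π id)) r.tok = clean A r.tok := by
      intro A
      have : (A.map (IAtom.act π id)).map Prod.snd = A.map Prod.snd := by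
        rw [Multiset.map_map]; rfl
      simp only [clean, this]
    simp only [ARule.rename]
    congr 1
    · rw [Multiset.map_add]
    · simp only [inst, Multiset.map_add, Multiset.map_map, Multiset.map_coe]
      rfl
    · simp only [Multiset.map_add, headEqs_map, chrL_act]
    · rw [← Multiset.map_coe, ← Multiset.map_add, e1]
      simp only [addToken, hid, inst, List.map_eq_nil_iff]

theorem Unfolds.rename {r w u : ARule L Q N} {ids : List ℕ} (h : Unfolds CT r w ids u)
    (π : Equiv.Perm ℕ) : Unfolds CT (r.rename π) (w.rename π) ids (u.rename π) := by
  obtain ⟨K, S₁, S₂, θ, hu, rfl⟩ := unfolds_iff.1 h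
  exact unfolds_iff.2 ⟨_, _, _, _, hu.rename π, by rw [← List.map_append, idL_act, List.map_id]⟩

theorem mem_UPlus_rename {P : Set (ARule L Q N)} {r w : ARule L Q N} {ids : List ℕ}
    (π : Equiv.Perm ℕ) (h : (w.rename π, ids) ∈ UPlus CT P (r.rename π)) :
    (w, ids) ∈ UPlus CT P r := by
  obtain ⟨h1, u, h2⟩ := h
  have h1 := h1.rename π.symm
  have h2 := h2.rename π.symm
  simp only [rename_symm_rename] at h1 h2
  exact ⟨h1, _, h2⟩

theorem mem_USharp_rename {P : Set (ARule L Q N)} {r w : ARule L Q N} (h : w ∈ USharp CT P r)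
    (π : Equiv.Perm ℕ) : w.rename π ∈ USharp CT P (r.rename π) := by
  have hd : ∀ C' : Multiset (BI L 0), Disjoint (fvs C') w.fv →
      Disjoint (fvs (C'.map (BI.subst (ren π)))) (w.rename π).fv := fun C' h =>
    Set.disjoint_left.2 fun x hx hx' => Set.disjoint_left.1 h ((mem_fvs_ren _ _ _).1 hx)
      ((ARule.mem_fv_rename _ _ _).1 hx')
  have hs : ∀ C' : Multiset (BI L 0), Sat CT (r.guard + C') →
      Sat CT ((r.rename π).guard + C'.map (BI.subst (ren π))) := fun C' h => by
    have := sat_rename h π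
    rw [Multiset.map_add] at this
    exact this
  have he : ∀ (C' : Multiset (BI L 0)) (K₁ K₂ : List (Atom L Q)),
      EntailsEx CT (r.guard + C') (fvL w.keep ∪ fvL w.rem)
        (headEqs K₁ w.keep + headEqs K₂ w.rem + w.guard) →
      EntailsEx CT ((r.rename π).guard + C'.map (BI.subst (ren π)))
        (fvL (w.rename π).keep ∪ fvL (w.rename π).rem)
        (headEqs (K₁.map (Atom.subst (ren π))) (w.rename π).keep +
          headEqs (K₂.map (Atom.subst (ren π))) (w.rename π).rem + (w.rename π).guard) := by
    intro C' K₁ K₂ h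
    have := entailsEx_rename (y := fvL (w.rename π).keep ∪ fvL (w.rename π).rem) h π
      (by simp [ARule.rename, mem_fvL_ren])
    simp only [Multiset.map_add, headEqs_map] at this
    exact this
  obtain ⟨hv, h⟩ := h
  refine ⟨hv.rename π, h.imp ?_ ?_⟩
  · rintro ⟨A₁, A₂, C', h1, h2, h3, h4, h5, h6, h7, h8⟩
    have hid : idL (A₁.map (IAtom.act π id) ++ A₂.map (IAtom.act π id)) = idL (A₁ ++ A₂) := by
      rw [← List.map_append, idL_act, List.map_id]
    refine ⟨A₁.map (IAtom.act π id), A₂.map (IAtom.act π id), C'.map (BI.subst (ren π)), ?_, hd _ h2,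
      hs _ h3, ?_, ?_, ?_, ?_, ?_⟩
    · rw [rename_chr, ← Multiset.map_coe, ← Multiset.map_coe, ← Multiset.map_add]
      exact Multiset.map_le_map h1
    · rw [chrL_act]; exact (sameSymbols_ren _ _).2 h4
    · rw [chrL_act]; exact (sameSymbols_ren _ _).2 h5
    · rw [chrL_act, chrL_act]; exact he _ _ _ h6
    · rw [hid]; exact h7
    · rw [hid]; exact fun h => h8 (mem_UPlus_rename π h)
  · rintro ⟨A', H', C', K₁, K₂, h1, h2, h3, h4, h5, h6, h7, h8, h9⟩
    refine ⟨A'.map (IAtom.act π id), H'.map (Atom.subst (ren π)), C'.map (BI.subst (ren π)),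
      K₁.map (Atom.subst (ren π)), K₂.map (Atom.subst (ren π)), ?_, ?_, ?_, hd _ h4, hs _ h5, ?_,
      ?_, ?_, he _ _ _ h9⟩
    · rw [rename_chr]; exact Multiset.map_le_map h1
    · simpa using h2
    · simpa using h3
    · rw [← Multiset.map_coe, ← Multiset.map_coe, ← Multiset.map_add, ← h6, Multiset.map_add,
        Multiset.map_map, Multiset.map_map]
      rfl
    · exact (sameSymbols_ren _ _).2 h7
    · exact (sameSymbols_ren _ _).2 h8

/-- What safe replacement of a rule `r` in `P` by `U` means for a variant of `r`. -/
structure Safe (CT : L.Theory) (P U : Set (ARule L Q N)) (r : ARule L Q N) : Prop where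
  sharp : USharp CT P r = ∅
  plus : ∃ w ids u, ApartVariant P r w ∧ Unfolds CT r w ids u
  guard : ∀ w ids u, ApartVariant P r w → Unfolds CT r w ids u → Equivalent CT r.guard u.guard
  unf : ∀ w ids u, ApartVariant P r w → Unfolds CT r w ids u → ∃ u₀ ∈ U, IsVariant u₀ u

theorem safe_of_safelyReplaceable {P U : Set (ARule L Q N)} {r : ARule L Q N}
    (h : SafelyReplaceable CT P r) (hU : ∀ r' ∈ Unf CT P r, ∃ u ∈ U, IsVariant u r')
    (π : Equiv.Perm ℕ) : Safe CT P U (r.rename π) := by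
  have hback : ∀ w ids u, ApartVariant P (r.rename π) w → Unfolds CT (r.rename π) w ids u →
      u.rename π.symm ∈ Unf CT P r := by
    intro w ids u h1 h2
    have h1 := h1.rename π.symm
    have h2 := h2.rename π.symm
    rw [rename_symm_rename] at h1 h2
    exact ⟨_, ids, h1, h2⟩
  obtain ⟨-, h1, ⟨⟨w, ids⟩, h2, u, h3⟩, h4⟩ := h
  refine ⟨?_, ⟨_, ids, _, h2.rename π, h3.rename π⟩, fun w ids u hw hu => ?_,
    fun w ids u hw hu => ?_⟩
  · refine Set.eq_empty_iff_forall_notMem.2 fun w hw => ?_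
    have := mem_USharp_rename hw π.symm
    rw [rename_symm_rename, h1] at this
    exact this
  · have h5 := h4 _ (hback w ids u hw hu)
    have h6 := entails_rename h5.1 π
    have h7 := entails_rename h5.2 π
    have h8 : (u.rename π.symm).guard.map (BI.subst (ren π)) = u.guard := mapBI_symm u.guard π.symm
    rw [h8] at h6 h7
    exact ⟨h6, h7⟩
  · obtain ⟨u₀, h5, h6⟩ := hU _ (hback w ids u hw hu)
    have h7 := h6.rename π
    rw [ARule.rename_rename, Equiv.symm_trans_self, ARule.rename_refl] at h7
    exact ⟨u₀, h5, h7⟩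

/-- The identifiers that come from `w` are positive before they are increased by the greatest one of `r`,
so they differ from those of `r`. -/
theorem UnfoldsBy.wf {r w u : ARule L Q N} {K : Multiset (IAtom L Q)} {S₁ S₂ : List (IAtom L Q)}
    {θ : ℕ → L.Term ℕ} (h : UnfoldsBy CT r w K S₁ S₂ θ u) (hr : r.WF) (hw : w.WF) : u.WF := by
  have hle : K + (S₁ : Multiset (IAtom L Q)) ≤ r.chr := by
    rw [h.chr]; exact Multiset.le_add_right _ _
  have hsnd : (inst w.chr w.tok (maxId r.chr r.tok)).1.map Prod.snd
      = (w.chr.map Prod.snd).map (· + maxId r.chr r.tok) := by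
    simp [inst, Multiset.map_map]
  have hmem : ∀ i ∈ (K + (S₁ : Multiset (IAtom L Q))).map Prod.snd, i ∈ r.ids := fun i hi =>
    Or.inl (Multiset.mem_of_le (Multiset.map_le_map hle) hi)
  rw [h.eq]
  refine ⟨hr.head, ?_, ?_⟩
  · simp only
    rw [Multiset.map_add, Multiset.nodup_add, hsnd]
    refine ⟨Multiset.nodup_of_le (Multiset.map_le_map hle) hr.nodup,
      hw.nodup.map fun x y h => by simpa using h, Multiset.disjoint_left.2 fun {i} hi hi' => ?_⟩
    obtain ⟨j, hj, rfl⟩ := Multiset.mem_map.1 hi'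
    have h1 := le_maxId (hmem _ hi)
    have h2 := hw.pos j (Or.inl hj)
    omega
  · rintro i (hi | ⟨t, ht, hi⟩)
    · simp only at hi
      rw [Multiset.map_add, Multiset.mem_add, hsnd] at hi
      rcases hi with hi | hi
      · exact hr.pos i (hmem i hi)
      · obtain ⟨j, hj, rfl⟩ := Multiset.mem_map.1 hi
        have h2 := hw.pos j (Or.inl hj)
        omega
    · rcases mem_addToken.1 ht with ht | ⟨-, rfl⟩
      · rcases Finset.mem_union.1 ht with ht | ht
        · exact hr.pos i (Or.inr ⟨t, (Finset.mem_filter.1 ht).1, hi⟩)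
        · obtain ⟨s, hs, rfl⟩ := Finset.mem_image.1 ht
          obtain ⟨j, hj, rfl⟩ := List.mem_map.1 hi
          have h2 := hw.pos j (Or.inr ⟨s, hs, hj⟩)
          omega
      · refine hr.pos i (hmem i ?_)
        rw [Multiset.map_add, Multiset.mem_add]
        exact Or.inr (by simpa [idL] using hi)

end Equivariance


/-! ### Postponed and immediate use of the body of a rule -/

section Commutation

variable {L : FirstOrder.Language.{u, v}} {Q N : Type*}

/-- Replacement of the identifier of an identified constraint. -/
abbrev reid (g : ℕ → ℕ) (a : IAtom L Q) : IAtom L Q := (a.1, g a.2)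

theorem chrL_reid (S : List (IAtom L Q)) (g : ℕ → ℕ) : chrL (S.map (reid g)) = chrL S := by
  simp [chrL, Function.comp_def]

theorem idL_reid (S : List (IAtom L Q)) (g : ℕ → ℕ) : idL (S.map (reid g)) = (idL S).map g := by
  simp [idL, Function.comp_def]

theorem map_snd_reid (A : Multiset (IAtom L Q)) (g : ℕ → ℕ) :
    (A.map (reid g)).map Prod.snd = (A.map Prod.snd).map g := by simp [Multiset.map_map]

theorem list_eq_of_map_eq {α β : Type*} {f : α → β} {s : Set α} (hf : Set.InjOn f s) :
    ∀ {l l' : List α}, (∀ i ∈ l, i ∈ s) → (∀ i ∈ l', i ∈ s) → l.map f = l'.map f → l = l'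
  | [], [], _, _, _ => rfl
  | [], _ :: _, _, _, h => by simp at h
  | _ :: _, [], _, _, h => by simp at h
  | i :: l, j :: l', h₁, h₂, h => by
    simp only [List.map_cons, List.cons.injEq, List.mem_cons, forall_eq_or_imp] at h h₁ h₂
    rw [hf h₁.1 h₂.1 h.1, list_eq_of_map_eq hf h₁.2 h₂.2 h.2]

/-- A list of images of elements of `A` lifts to a list of elements of `A`. -/
theorem exists_list_map {α β : Type*} (f : α → β) (A : Multiset α) :
    ∀ T : List β, (∀ b ∈ T, b ∈ A.map f) → ∃ l : List α, l.map f = T ∧ ∀ a ∈ l, a ∈ A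
  | [], _ => ⟨[], rfl, by simp⟩
  | b :: T, h => by
    simp only [List.mem_cons, forall_eq_or_imp] at h
    obtain ⟨a, ha, rfl⟩ := Multiset.mem_map.1 h.1
    obtain ⟨l, rfl, hl⟩ := exists_list_map f A T h.2
    exact ⟨a :: l, rfl, by simpa using ⟨ha, hl⟩⟩

theorem mem_idL_iff {S : List (IAtom L Q)} {i : ℕ} :
    i ∈ idL S ↔ i ∈ (S : Multiset (IAtom L Q)).map Prod.snd := by simp [idL]

variable {CT : L.Theory} {P : Set (ARule L Q N)} {V : Set ℕ} {a : Answer L Q} {k : ℕ}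
  {σ : EConf L Q N} {r w : ARule L Q N} {g gw : ℕ → ℕ}
  {S₁ S₂ T₁ T₂ : List (IAtom L Q)} {S T R R₀ : Multiset (IAtom L Q)}

theorem CanFire.idL_ne_nil (hc : CanFire CT σ w S₁ S₂ S) (hw : w.WF) : idL (S₁ ++ S₂) ≠ [] := by
  intro h
  have h1 := hc.keep.length_eq
  have h2 := hc.rem.length_eq
  simp only [idL, List.map_eq_nil_iff, List.append_eq_nil_iff] at h
  rw [h.1] at h1
  rw [h.2] at h2
  refine hw.head ?_
  rw [List.append_eq_nil_iff]
  exact ⟨List.length_eq_zero_iff.1 h1.symm, List.length_eq_zero_iff.1 h2.symm⟩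

/-- After a rule has fired, the store entails its guard: by injectivity of function symbols, the
equations determine the values of the variables of the head. -/
theorem fire_entails_guard (hCT : ClarkEquality CT) (hσ : σ.WF V) (hc : CanFire CT σ r S₁ S₂ S) :
    Entails CT (fire σ r g S₁ S₂ S).built r.guard := by
  intro M w hw
  simp only [fire, holds_add] at hw
  obtain ⟨⟨⟨h1, h2⟩, -⟩, h3⟩ := hw
  obtain ⟨w', h4, h5⟩ := hc.entails M w h3
  simp only [holds_add] at h5
  rw [holds_headEqs w hc.keep] at h1
  rw [holds_headEqs w hc.rem] at h2
  rw [holds_headEqs w' hc.keep, holds_headEqs w' hc.rem] at h5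
  have hoff : ∀ x ∈ σ.vars, w x = w' x := fun x hx => (h4 x fun hx' => by
    refine Set.disjoint_left.1 hc.fresh ?_ hx
    exact hx'.elim (fun h => Or.inl (Or.inl (Or.inl (Or.inl h))))
      fun h => Or.inl (Or.inl (Or.inl (Or.inr h)))).symm
  have hsub := hσ.chrV
  rw [hc.chr, fvI_add, fvI_add, fvI_coe, fvI_coe] at hsub
  have e1 : argValues w (chrL S₁) = argValues w' (chrL S₁) :=
    argValues_congr fun x hx => hoff x (hsub (Or.inl (Or.inl hx)))
  have e2 : argValues w (chrL S₂) = argValues w' (chrL S₂) :=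
    argValues_congr fun x hx => hoff x (hsub (Or.inl (Or.inr hx)))
  have e3 := argValues_inj hCT M (h1.symm.trans (e1.trans h5.1.1))
  have e4 := argValues_inj hCT M (h2.symm.trans (e2.trans h5.1.2))
  have : w = w' := by
    funext x
    by_cases hx : x ∈ fvL r.keep ∪ fvL r.rem
    · exact hx.elim (e3 x) (e4 x)
    · exact (h4 x hx).symm
  rw [this]
  exact h5.2

/-- The configuration `σ` contains the complete body of the rule `r`, with identifiers given by `g`,
besides the constraints `R`; the guard and the built-in constraints of `r` are entailed by the store. -/
structure Block (CT : L.Theory) (r : ARule L Q N) (g : ℕ → ℕ) (σ : EConf L Q N)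
    (R : Multiset (IAtom L Q)) : Prop where
  chr : σ.chr = r.chr.map (reid g) + R
  vars : r.fv ⊆ σ.vars
  inj : Set.InjOn g r.ids
  ids : ∀ i ∈ r.ids, g i ∈ σ.ids
  rest : ∀ i ∈ r.ids, g i ∉ R.map Prod.snd
  entails : Entails CT σ.built (r.bi + r.guard)
  tok : ∀ (x : N) (l : List ℕ), l ≠ [] → (∀ i ∈ l, i ∈ r.chr.map Prod.snd) →
    ((x, l.map g) ∈ σ.hist ↔ (x, l) ∈ r.tok)

theorem Block.of_fire (hCT : ClarkEquality CT) (hσ : σ.WF V) (hc : CanFire CT σ r S₁ S₂ S)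
    (hg : FreshIds r g σ.ids) : Block CT r g (fire σ r g S₁ S₂ S) (↑S₁ + S) := by
  have hold : ∀ i ∈ ((S₁ : Multiset (IAtom L Q)) + S).map Prod.snd, i ∈ σ.ids := by
    intro i hi
    refine hσ.chrI i ?_
    rw [hc.chr]
    simp only [Multiset.map_add, Multiset.mem_add] at hi ⊢
    exact hi.imp_left Or.inl
  refine ⟨add_assoc _ _ _, Set.subset_union_right, hg.inj, fun i hi => Or.inr ⟨i, hi, rfl⟩,
    fun i hi h => hg.avoid i hi (hold _ h), fun M w hw => ?_, fun x l hl hlr => ?_⟩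
  · refine (holds_add w _ _).2 ⟨?_, fire_entails_guard hCT hσ hc M w hw⟩
    simp only [fire, holds_add] at hw
    exact hw.1.2
  · obtain ⟨i, hi⟩ := List.exists_mem_of_ne_nil l hl
    constructor
    · rintro ((h | ⟨-, h⟩) | ⟨s, hs, h⟩)
      · exact absurd (hσ.histI _ h _ (List.mem_map_of_mem hi)) (hg.avoid i (Or.inl (hlr i hi)))
      · have h1 : g i ∈ idL S₁ := by
          have h2 : l.map g = idL S₁ := (Prod.ext_iff.1 h).2
          rw [← h2]; exact List.mem_map_of_mem hi
        refine absurd (hold _ ?_) (hg.avoid i (Or.inl (hlr i hi)))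
        rw [Multiset.map_add, Multiset.mem_add]
        exact Or.inl (mem_idL_iff.1 h1)
      · have h1 := Prod.ext_iff.1 h
        have h2 : l = s.2 := list_eq_of_map_eq hg.inj (fun i hi => Or.inl (hlr i hi))
          (fun i hi => Or.inr ⟨s, hs, hi⟩) h1.2
        have h3 : ((x, l) : Token N) = s := Prod.ext h1.1 h2
        rw [h3]; exact hs
    · exact fun h => Or.inr ⟨_, h, rfl⟩

/-- A block persists as long as rules fire on other constraints only. -/
theorem Block.fire (hB : Block CT r g σ R) (hR : R = ↑T₁ + ↑T₂ + R₀) (hg : FreshIds w gw σ.ids) :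
    Block CT r g (fire σ w gw T₁ T₂ (r.chr.map (reid g) + R₀))
      (w.chr.map (reid gw) + ↑T₁ + R₀) := by
  have hrest : ∀ i ∈ r.ids, g i ∉ ((T₁ : Multiset (IAtom L Q)) + R₀).map Prod.snd := by
    intro i hi h
    refine hB.rest i hi ?_
    rw [hR]
    simp only [Multiset.map_add, Multiset.mem_add] at h ⊢
    exact h.imp_left Or.inl
  refine ⟨by simp only [CHR.fire]; abel, hB.vars.trans Set.subset_union_left, hB.inj,
    fun i hi => Or.inl (hB.ids i hi), fun i hi h => ?_, fun M w hw => ?_, fun x l hl hlr => ?_⟩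
  · rw [add_assoc, Multiset.map_add, Multiset.mem_add, map_snd_reid] at h
    rcases h with h | h
    · obtain ⟨j, hj, hji⟩ := Multiset.mem_map.1 h
      exact hg.avoid j (Or.inl hj) (hji ▸ hB.ids i hi)
    · exact hrest i hi h
  · simp only [CHR.fire, holds_add] at hw
    exact hB.entails M w hw.2
  · rw [← hB.tok x l hl hlr]
    obtain ⟨i, hi⟩ := List.exists_mem_of_ne_nil l hl
    constructor
    · rintro ((h | ⟨-, h⟩) | ⟨s, hs, h⟩)
      · exact h
      · have h1 : g i ∈ idL T₁ := by
          have h2 : l.map g = idL T₁ := (Prod.ext_iff.1 h).2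
          rw [← h2]; exact List.mem_map_of_mem hi
        refine absurd ?_ (hrest i (Or.inl (hlr i hi)))
        rw [Multiset.map_add, Multiset.mem_add]
        exact Or.inl (mem_idL_iff.1 h1)
      · have h1 : g i ∈ s.2.map gw := by
          have h2 : l.map g = s.2.map gw := (Prod.ext_iff.1 h).2
          rw [← h2]; exact List.mem_map_of_mem hi
        obtain ⟨j, hj, hji⟩ := List.mem_map.1 h1
        exact absurd (hji ▸ hB.ids i (Or.inl (hlr i hi))) (hg.avoid j (Or.inr ⟨s, hs, hj⟩))
    · exact fun h => Or.inl (Or.inl h)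

/-- Two applications of rules to disjoint parts of a configuration commute. -/
theorem fire_comm (σ : EConf L Q N) (w w' : ARule L Q N) (g g' : ℕ → ℕ)
    (S₁ S₂ T₁ T₂ : List (IAtom L Q)) (S T S' T' R : Multiset (IAtom L Q))
    (hT' : T' = w.chr.map (reid g) + ↑S₁ + R) (hS' : S' = w'.chr.map (reid g') + ↑T₁ + R) :
    fire (fire σ w g S₁ S₂ S) w' g' T₁ T₂ T' = fire (fire σ w' g' T₁ T₂ T) w g S₁ S₂ S' := by
  subst hT' hS'
  simp only [fire, EConf.mk.injEq]
  refine ⟨by abel, by abel, ?_, ?_, ?_⟩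
  · ext t; simp only [Set.mem_union]; tauto
  · ext t; simp only [Set.mem_union]; tauto
  · ext t; simp only [Set.mem_union]; tauto

theorem disjoint_of_rename_off {π : Equiv.Perm ℕ} {Y : Set ℕ} (h : ∀ x ∈ w.fv, π x ∉ Y) :
    Disjoint (w.rename π).fv Y := by
  refine Set.disjoint_left.2 fun x hx hx' => ?_
  have := h _ ((ARule.mem_fv_rename _ _ _).1 hx)
  rw [Equiv.apply_symm_apply] at this
  exact this hx'

theorem mem_residualGuard {θ : ℕ → L.Term ℕ} {c : BI L 0} :
    c ∈ residualGuard CT r w θ ↔ c ∈ w.guard ∧ ¬ Entails CT (r.bi + r.guard) {c.subst θ} := by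
  simp only [residualGuard, Multiset.mem_filter]

variable [DecidableEq N] {u : ARule L Q N} {K : Multiset (IAtom L Q)} {A₁ A₂ : List (IAtom L Q)}
  {θ : ℕ → L.Term ℕ} {U : Set (ARule L Q N)}

/-- A rule by which the body of `r` can be unfolded can fire on a block of `r`. -/
theorem Block.canFire (hB : Block CT r g σ R) (hU : UnfoldsBy CT r w K A₁ A₂ θ u)
    (hG : Entails CT r.guard u.guard) (hw : w.WF) (hd : Disjoint w.fv σ.vars) :
    CanFire CT σ w (A₁.map (reid g)) (A₂.map (reid g)) (K.map (reid g) + R) where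
  chr := by
    rw [hB.chr, hU.chr, Multiset.map_add, Multiset.map_add, Multiset.map_coe, Multiset.map_coe]
    abel
  fresh := hd
  keep := by rw [chrL_reid]; exact hU.keep
  rem := by rw [chrL_reid]; exact hU.rem
  entails := by
    intro M w₀ hw₀
    have h1 := hB.entails M w₀ hw₀
    have h2 := hU.entails M w₀ h1
    have h3 := ((holds_add _ _ _).1 h1).2
    have hsk : SameSymbols (chrL A₁) (w.keep.map (Atom.subst θ)) := by
      have := (sameSymbols_ren .var θ).2 hU.keep
      rwa [show (chrL A₁).map (Atom.subst .var) = chrL A₁ from mapAtom_refl _] at this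
    have hsr : SameSymbols (chrL A₂) (w.rem.map (Atom.subst θ)) := by
      have := (sameSymbols_ren .var θ).2 hU.rem
      rwa [show (chrL A₂).map (Atom.subst .var) = chrL A₂ from mapAtom_refl _] at this
    rw [holds_add, holds_headEqs _ hsk, holds_headEqs _ hsr, argValues_subst, argValues_subst] at h2
    have hoff : ∀ y, y ∉ fvL w.keep ∪ fvL w.rem → (θ y).realize w₀ = w₀ y := fun y hy => by
      rw [hU.supp y hy]; rfl
    have hr : ∀ x ∈ r.fv, (θ x).realize w₀ = w₀ x := fun x hx => hoff x fun hx' =>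
      Set.disjoint_left.1 hU.apart (hx'.elim (fun h => Or.inl (Or.inl (Or.inl (Or.inl h))))
        fun h => Or.inl (Or.inl (Or.inl (Or.inr h)))) hx
    have hfv : fvI r.chr ⊆ r.fv := fun x hx => Or.inl (Or.inr hx)
    rw [hU.chr, fvI_add, fvI_add, fvI_coe, fvI_coe] at hfv
    -- the substitution `θ` gives the values of the variables in the head of `w`
    refine ⟨fun x => (θ x).realize w₀, hoff, ?_⟩
    rw [chrL_reid, chrL_reid, holds_add, holds_add, holds_headEqs _ hU.keep,
      holds_headEqs _ hU.rem, ← h2.1, ← h2.2]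
    refine ⟨⟨argValues_congr fun x hx => hr x (hfv (Or.inl (Or.inr hx))),
      argValues_congr fun x hx => hr x (hfv (Or.inr hx))⟩, fun c hc => ?_⟩
    rw [← BI.realize_subst]
    by_cases hres : Entails CT (r.bi + r.guard) {c.subst θ}
    · exact hres M w₀ h1 _ (Multiset.mem_singleton_self _)
    · refine hG M w₀ h3 _ ?_
      rw [hU.eq]
      refine Multiset.mem_add.2 (Or.inr (Multiset.mem_map_of_mem _ ?_))
      exact mem_residualGuard.2 ⟨hc, hres⟩
  token := by
    rw [← List.map_append, idL_reid]
    refine fun h => hU.token ((hB.tok _ _ ?_ fun i hi => ?_).1 h)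
    · intro h0
      simp only [idL, List.map_eq_nil_iff, List.append_eq_nil_iff] at h0
      have h1 := hU.keep.length_eq
      have h2 := hU.rem.length_eq
      rw [h0.1] at h1
      rw [h0.2] at h2
      refine hw.head ?_
      rw [List.append_eq_nil_iff]
      exact ⟨List.length_eq_zero_iff.1 h1.symm, List.length_eq_zero_iff.1 h2.symm⟩
    · rw [mem_idL_iff] at hi
      rw [hU.chr]
      simp only [← Multiset.coe_add, Multiset.map_add, Multiset.mem_add] at hi ⊢
      tauto

/-- Some rule unfolds `r`, and its variables can be chosen fresh. -/
theorem Safe.exists_unfolding (hS : Safe CT P U r) {Y : Set ℕ} (hY : Y.Finite) :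
    ∃ w u K A₁ A₂ θ, ApartVariant P r w ∧ UnfoldsBy CT r w K A₁ A₂ θ u ∧ Disjoint w.fv Y := by
  obtain ⟨w, ids, u, h1, h2⟩ := hS.plus
  obtain ⟨π, h3, h4⟩ := exists_perm_fresh (Equiv.refl ℕ) r.fv_finite w.fv_finite hY h1.2
  obtain ⟨K, A₁, A₂, θ, h5, -⟩ := unfolds_iff.1 h2
  have h6 := h1.rename π
  have h7 := h5.rename π
  rw [r.rename_eq_self h3] at h6 h7
  exact ⟨_, _, _, _, _, _, h6, h7, disjoint_of_rename_off h4⟩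

theorem Safe.guard_unfoldsBy (hS : Safe CT P U r) (hv : ApartVariant P r w)
    (hU : UnfoldsBy CT r w K A₁ A₂ θ u) : Equivalent CT r.guard u.guard :=
  hS.guard _ _ _ hv (unfolds_iff.2 ⟨_, _, _, _, hU, rfl⟩)

/-- A rule that fires in a consistent configuration on constraints of a block only is one by which
`r` unfolds, as the first alternative in `USharp` is excluded. -/
theorem Block.unfoldsBy (hB : Block CT r g σ R) (hS : Safe CT P U r) (hσ : σ.WF V) (hr : r.WF)
    (hsat : Sat CT σ.built) (hw : w.WF) (hwP : ∃ w₀ ∈ P, IsVariant w₀ w)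
    (hc : CanFire CT σ w T₁ T₂ T)
    (hin : ∀ b ∈ (↑T₁ + ↑T₂ : Multiset (IAtom L Q)), b ∈ r.chr.map (reid g)) :
    ∃ K A₁ A₂ θ u, ApartVariant P r w ∧ UnfoldsBy CT r w K A₁ A₂ θ u ∧
      T₁ = A₁.map (reid g) ∧ T₂ = A₂.map (reid g) ∧ T = K.map (reid g) + R := by
  obtain ⟨A₁, rfl, hA₁⟩ := exists_list_map (reid g) r.chr T₁ fun b hb => hin b (by simp [hb])
  obtain ⟨A₂, rfl, hA₂⟩ := exists_list_map (reid g) r.chr T₂ fun b hb => hin b (by simp [hb])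
  have hnd : σ.chr.Nodup := hσ.nodup.of_map
  have hle : (↑A₁ + ↑A₂ : Multiset (IAtom L Q)) ≤ r.chr := by
    have h1 : ((↑A₁ + ↑A₂ : Multiset (IAtom L Q)).map (reid g)).Nodup := by
      refine Multiset.nodup_of_le ?_ hnd
      rw [hc.chr, Multiset.map_add, Multiset.map_coe, Multiset.map_coe]
      exact Multiset.le_add_right _ _
    refine (Multiset.le_iff_subset h1.of_map).2 fun b hb => ?_
    rw [Multiset.mem_add] at hb
    exact hb.elim (hA₁ b) (hA₂ b)
  have hav : ApartVariant P r w := ⟨hwP, hc.fresh.mono_right hB.vars⟩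
  have hids : ∀ i ∈ idL (A₁ ++ A₂), i ∈ r.chr.map Prod.snd := by
    intro i hi
    rw [mem_idL_iff, ← Multiset.coe_add] at hi
    exact Multiset.mem_of_le (Multiset.map_le_map hle) hi
  have hne : idL (A₁ ++ A₂) ≠ [] := by
    have := hc.idL_ne_nil hw
    rw [← List.map_append, idL_reid] at this
    exact fun h => this (by rw [h]; rfl)
  have htok := hc.token
  rw [← List.map_append, idL_reid, hB.tok _ _ hne hids] at htok
  have hk := hc.keep
  have hm := hc.rem
  have he := hc.entails
  rw [chrL_reid] at hk hm
  rw [chrL_reid, chrL_reid] at he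
  -- otherwise `w` belongs to `USharp`, with the store of `σ` as additional constraints `C'`
  have hplus : (w, idL (A₁ ++ A₂)) ∈ UPlus CT P r := by
    by_contra hnot
    have : w ∈ USharp CT P r := by
      refine ⟨hav, Or.inl ⟨A₁, A₂, σ.built, hle, ?_, ?_, hk, hm, ?_, htok, hnot⟩⟩
      · exact (hc.fresh.mono_right hσ.builtV).symm
      · obtain ⟨M, w₀, hw₀⟩ := hsat
        exact ⟨M, w₀, (holds_add _ _ _).2 ⟨((holds_add _ _ _).1 (hB.entails M w₀ hw₀)).2, hw₀⟩⟩
      · exact fun M w₀ hw₀ => he M w₀ ((holds_add _ _ _).1 hw₀).2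
    rw [hS.sharp] at this
    exact this
  obtain ⟨-, u, hu⟩ := hplus
  obtain ⟨K, B₁, B₂, θ, hU, hidl⟩ := unfolds_iff.1 hu
  -- the identifiers determine the constraints, so the unfolding uses the same ones as the firing
  have hinj : Set.InjOn (Prod.snd : IAtom L Q → ℕ) {b | b ∈ r.chr} := fun b hb c hc h =>
    Multiset.inj_on_of_nodup_map hr.nodup b hb c hc h
  have happ : A₁ ++ A₂ = B₁ ++ B₂ := by
    refine list_eq_of_map_eq hinj (fun b hb => ?_) (fun b hb => ?_) hidl
    · exact (List.mem_append.1 hb).elim (hA₁ b) (hA₂ b)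
    · show b ∈ r.chr
      rw [hU.chr]
      simp only [Multiset.mem_add, Multiset.mem_coe]
      exact (List.mem_append.1 hb).imp Or.inr id
  obtain ⟨rfl, rfl⟩ := List.append_inj happ
    (by simpa [chrL] using hk.length_eq.trans hU.keep.length_eq.symm)
  refine ⟨K, A₁, A₂, θ, u, hav, hU, rfl, rfl, ?_⟩
  have h1 := hc.chr
  rw [hB.chr, hU.chr, Multiset.map_add, Multiset.map_add, Multiset.map_coe, Multiset.map_coe] at h1
  refine add_left_cancel (a := (↑(A₁.map (reid g)) + ↑(A₂.map (reid g)) : Multiset (IAtom L Q))) ?_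
  rw [← h1]; abel

/-- A rule that fires in a consistent configuration does not combine constraints of a block with
others, as the second alternative in `USharp` is excluded. -/
theorem Block.not_mixed (hB : Block CT r g σ R) (hS : Safe CT P U r) (hσ : σ.WF V)
    (hsat : Sat CT σ.built) (hwP : ∃ w₀ ∈ P, IsVariant w₀ w) (hc : CanFire CT σ w T₁ T₂ T)
    {b c : IAtom L Q} (hb : b ∈ (↑T₁ + ↑T₂ : Multiset (IAtom L Q))) (hbr : b ∈ r.chr.map (reid g))
    (hcT : c ∈ (↑T₁ + ↑T₂ : Multiset (IAtom L Q))) (hcr : c ∉ r.chr.map (reid g)) : False := by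
  classical
  have hnd : σ.chr.Nodup := hσ.nodup.of_map
  generalize hX : (↑T₁ + ↑T₂ : Multiset (IAtom L Q)) = X at hb hcT
  have hXnd : X.Nodup := Multiset.nodup_of_le (by rw [hc.chr, hX]; exact Multiset.le_add_right _ _) hnd
  have hBnd : (r.chr.map (reid g)).Nodup :=
    Multiset.nodup_of_le (by rw [hB.chr]; exact Multiset.le_add_right _ _) hnd
  have hA : (r.chr.filter ((· ∈ X) ∘ reid g)).map (reid g) = X.filter (· ∈ r.chr.map (reid g)) := by
    rw [← Multiset.filter_map]
    refine (Multiset.Nodup.ext (hBnd.filter _) (hXnd.filter _)).2 fun d => ?_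
    simp only [Multiset.mem_filter]
    exact and_comm
  have hav : ApartVariant P r w := ⟨hwP, hc.fresh.mono_right hB.vars⟩
  have : w ∈ USharp CT P r := by
    refine ⟨hav, Or.inr ⟨r.chr.filter ((· ∈ X) ∘ reid g),
      (X.filter (· ∉ r.chr.map (reid g))).map Prod.fst, σ.built, chrL T₁, chrL T₂,
      Multiset.filter_le _ _, ?_, ?_, ?_, ?_, ?_, hc.keep, hc.rem, ?_⟩⟩
    · intro h0
      rw [h0, Multiset.map_zero] at hA
      have : b ∈ X.filter (· ∈ r.chr.map (reid g)) := Multiset.mem_filter.2 ⟨hb, hbr⟩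
      rw [← hA] at this
      exact Multiset.notMem_zero _ this
    · intro h0
      rw [Multiset.map_eq_zero] at h0
      have : c ∈ X.filter (· ∉ r.chr.map (reid g)) := Multiset.mem_filter.2 ⟨hcT, hcr⟩
      rw [h0] at this
      exact Multiset.notMem_zero _ this
    · exact (hc.fresh.mono_right hσ.builtV).symm
    · obtain ⟨M, w₀, hw₀⟩ := hsat
      exact ⟨M, w₀, (holds_add _ _ _).2 ⟨((holds_add _ _ _).1 (hB.entails M w₀ hw₀)).2, hw₀⟩⟩
    · have h1 : (r.chr.filter ((· ∈ X) ∘ reid g)).map Prod.fst =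
          ((r.chr.filter ((· ∈ X) ∘ reid g)).map (reid g)).map Prod.fst := by
        rw [Multiset.map_map]; rfl
      rw [h1, hA, ← Multiset.map_add, Multiset.filter_add_not, ← hX, Multiset.map_add]
      rfl
    · exact fun M w₀ hw₀ => hc.entails M w₀ ((holds_add _ _ _).1 hw₀).2
  rw [hS.sharp] at this
  exact this

/-- Whatever is obtained from a configuration with a block of a safely replaceable rule `r` can be
obtained, without more rule applications, by first firing some rule by which `r` unfolds. -/
theorem Reach.use_block (hP : ∀ w ∈ P, w.WF) (hS : Safe CT P U r) (hr : r.WF)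
    (h : Reach CT P V a k σ) : ∀ R, σ.WF V → Block CT r g σ R →
      ∃ w u gw K A₁ A₂ θ, ApartVariant P r w ∧ UnfoldsBy CT r w K A₁ A₂ θ u ∧
        Disjoint w.fv σ.vars ∧ FreshIds w gw σ.ids ∧
        Reach CT P V a k (CHR.fire σ w gw (A₁.map (reid g)) (A₂.map (reid g))
          (K.map (reid g) + R)) := by
  have hwf : ∀ {w}, ApartVariant P r w → w.WF := by
    rintro w ⟨⟨w₀, h1, ρ, rfl⟩, -⟩
    exact (hP w₀ h1).rename ρ
  have hunsat : ∀ (k : ℕ) (σ : EConf L Q N) (R : Multiset (IAtom L Q)), σ.WF V →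
      ¬ Sat CT σ.built → ¬ Sat CT a.2 →
      ∃ w u gw K A₁ A₂ θ, ApartVariant P r w ∧ UnfoldsBy CT r w K A₁ A₂ θ u ∧
        Disjoint w.fv σ.vars ∧ FreshIds w gw σ.ids ∧
        Reach CT P V a k (CHR.fire σ w gw (A₁.map (reid g)) (A₂.map (reid g))
          (K.map (reid g) + R)) := by
    intro k σ R hσ hs ha
    obtain ⟨w, u, K, A₁, A₂, θ, h1, h2, h3⟩ := hS.exists_unfolding hσ.finV
    obtain ⟨gw, hgw⟩ := exists_freshIds w hσ.finI
    exact ⟨w, u, gw, K, A₁, A₂, θ, h1, h2, h3, hgw, .unsat (fun h => hs (sat_of_add h)) ha⟩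
  induction h with
  | unsat hs ha => exact fun R hσ _ => hunsat _ _ R hσ hs ha
  | final hs hf ha =>
    intro R hσ hB
    obtain ⟨w, u, K, A₁, A₂, θ, h1, h2, h3⟩ := hS.exists_unfolding hσ.finV
    have hc := hB.canFire h2 (hS.guard_unfoldsBy h1 h2).1 (hwf h1) h3
    obtain ⟨⟨w₀, hw₀, ρ, rfl⟩, -⟩ := h1
    -- a final configuration contains no block
    exact absurd hc (hf w₀ hw₀ ρ _ _ _)
  | @fire k σ w₀ ρ g₀ T₁ T₂ T hw₀ hc hg h ih =>
    intro R hσ hB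
    generalize hwe : w₀.rename ρ = w at hc hg h ih
    have hww : w.WF := hwe ▸ (hP w₀ hw₀).rename ρ
    have hwP : ∃ w₀ ∈ P, IsVariant w₀ w := ⟨w₀, hw₀, ρ, hwe.symm⟩
    by_cases hsat : Sat CT σ.built
    swap
    · exact hunsat _ _ R hσ hsat (h.unsat_answer fun h => hsat (sat_of_add h))
    by_cases hin : ∀ b ∈ (↑T₁ + ↑T₂ : Multiset (IAtom L Q)), b ∈ r.chr.map (reid g)
    · -- the next rule application uses the block
      obtain ⟨K, A₁, A₂, θ, u, h1, h2, rfl, rfl, rfl⟩ :=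
        hB.unfoldsBy hS hσ hr hsat hww hwP hc hin
      exact ⟨w, u, g₀, K, A₁, A₂, θ, h1, h2, hc.fresh, hg, h.mono⟩
    · -- the next rule application takes place outside of the block, and commutes with the one that
      -- uses the block and comes first in the rest of the derivation
      push Not at hin
      obtain ⟨c, hcT, hcr⟩ := hin
      have hout : ∀ b ∈ (↑T₁ + ↑T₂ : Multiset (IAtom L Q)), b ∉ r.chr.map (reid g) :=
        fun b hb hbr => hB.not_mixed hS hσ hsat hwP hc hb hbr hcT hcr
      have hnd : σ.chr.Nodup := hσ.nodup.of_map
      have hle : (↑T₁ + ↑T₂ : Multiset (IAtom L Q)) ≤ R := by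
        refine (Multiset.le_iff_subset (Multiset.nodup_of_le ?_ hnd)).2 fun b hb => ?_
        · rw [hc.chr]; exact Multiset.le_add_right _ _
        · have h1 : b ∈ σ.chr := by rw [hc.chr]; exact Multiset.mem_add.2 (Or.inl hb)
          rw [hB.chr] at h1
          exact (Multiset.mem_add.1 h1).resolve_left (hout b hb)
      obtain ⟨R₀, hR⟩ := Multiset.le_iff_exists_add.1 hle
      have hT : T = r.chr.map (reid g) + R₀ := by
        have h1 := hc.chr
        rw [hB.chr, hR] at h1
        refine add_left_cancel (a := (↑T₁ + ↑T₂ : Multiset (IAtom L Q))) ?_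
        rw [← h1]; abel
      subst hT
      obtain ⟨w', u, gw, K, A₁, A₂, θ, h1, h2, h3, h4, h5⟩ :=
        ih _ (hσ.fire hww hc hg) (hB.fire hR hg)
      have h3' : Disjoint w'.fv σ.vars := h3.mono_right Set.subset_union_left
      have h4' : FreshIds w' gw σ.ids := ⟨h4.inj, fun i hi h => h4.avoid i hi (Or.inl h)⟩
      refine ⟨w', u, gw, K, A₁, A₂, θ, h1, h2, h3', h4', ?_⟩
      have hc' := hB.canFire h2 (hS.guard_unfoldsBy h1 h2).1 (hwf h1) h3'
      have hne := hc.idL_ne_nil hww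
      obtain ⟨i, hi⟩ := List.exists_mem_of_ne_nil _ hne
      have hiR : i ∈ R.map Prod.snd := by
        rw [hR, Multiset.map_add, Multiset.mem_add]
        rw [mem_idL_iff, ← Multiset.coe_add] at hi
        exact Or.inl hi
      have hiσ : i ∈ σ.ids := hσ.chrI i (by
        rw [hB.chr, Multiset.map_add, Multiset.mem_add]; exact Or.inr hiR)
      have hcw : CanFire CT (CHR.fire σ w' gw (A₁.map (reid g)) (A₂.map (reid g))
          (K.map (reid g) + R)) w T₁ T₂
          (w'.chr.map (reid gw) + ↑(A₁.map (reid g)) + (K.map (reid g) + R₀)) := by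
        refine ⟨by simp only [CHR.fire, hR]; abel, ?_, hc.keep, hc.rem, fun M w₁ hw₁ => ?_, ?_⟩
        · refine Set.disjoint_union_right.2 ⟨hc.fresh, ?_⟩
          exact (h3.mono_right Set.subset_union_right).symm
        · simp only [CHR.fire] at hw₁
          exact hc.entails M w₁ ((holds_add _ _ _).1 hw₁).2
        · rintro ((h | ⟨-, h⟩) | ⟨s, hs, h⟩)
          · exact hc.token h
          · have h6 := (Prod.ext_iff.1 h).2
            simp only at h6
            rw [h6, idL_reid] at hi
            obtain ⟨j, hj, rfl⟩ := List.mem_map.1 hi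
            refine hB.rest j (Or.inl ?_) hiR
            rw [mem_idL_iff] at hj
            rw [h2.chr, Multiset.map_add, Multiset.map_add, Multiset.mem_add, Multiset.mem_add]
            exact Or.inl (Or.inr hj)
          · have h6 := (Prod.ext_iff.1 h).2
            simp only at h6
            rw [h6] at hi
            obtain ⟨j, hj, rfl⟩ := List.mem_map.1 hi
            exact h4.avoid j (Or.inr ⟨s, hs, hj⟩) (Or.inl hiσ)
      have hgw : FreshIds w g₀ (CHR.fire σ w' gw (A₁.map (reid g)) (A₂.map (reid g))
          (K.map (reid g) + R)).ids := by
        refine ⟨hg.inj, ?_⟩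
        rintro i hi (h | ⟨j, hj, h⟩)
        · exact hg.avoid i hi h
        · exact h4.avoid j hj (Or.inr ⟨i, hi, h.symm⟩)
      have h6 := fire_comm σ w' w gw g₀ (A₁.map (reid g)) (A₂.map (reid g)) T₁ T₂
        (K.map (reid g) + R) (r.chr.map (reid g) + R₀) _ _ (K.map (reid g) + R₀) rfl rfl
      have h7 : K.map (reid g) + (w.chr.map (reid g₀) + ↑T₁ + R₀) =
          w.chr.map (reid g₀) + ↑T₁ + (K.map (reid g) + R₀) := by abel
      rw [h7, ← h6] at h5
      subst hwe
      exact .fire hw₀ hcw hgw h5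

end Commutation


/-! ### Replacing a rule by its unfolded versions -/

section Replacement

variable {L : FirstOrder.Language.{u, v}} {Q N : Type*} {CT : L.Theory} {P U : Set (ARule L Q N)}
  {V : Set ℕ} {a : Answer L Q} {k : ℕ} {σ : EConf L Q N} {r r₀ w w' u : ARule L Q N}
  {g gw : ℕ → ℕ} {S₁ S₂ : List (IAtom L Q)} {S : Multiset (IAtom L Q)}

/-- Whether a rule can fire depends only on its name, its head and its guard up to equivalence. -/
theorem CanFire.of_guard (hc : CanFire CT σ w S₁ S₂ S) (hn : w'.name = w.name)
    (hk : w'.keep = w.keep) (hr : w'.rem = w.rem) (hG : Entails CT w.guard w'.guard)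
    (hd : Disjoint w'.fv σ.vars) : CanFire CT σ w' S₁ S₂ S where
  chr := hc.chr
  fresh := hd
  keep := hk ▸ hc.keep
  rem := hr ▸ hc.rem
  entails M w₀ hw₀ := by
    obtain ⟨w₁, h1, h2⟩ := hc.entails M w₀ hw₀
    rw [hk, hr]
    rw [holds_add] at h2
    exact ⟨w₁, h1, (holds_add _ _ _).2 ⟨h2.1, hG M w₁ h2.2⟩⟩
  token := hn ▸ hc.token

theorem map_act_eq_self {A : Multiset (IAtom L Q)} {π : Equiv.Perm ℕ} (h : ∀ x ∈ fvI A, π x = x) :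
    A.map (IAtom.act π id) = A :=
  (act_congr (π := Equiv.refl ℕ) h fun _ _ => rfl).trans (map_act_refl A)

theorem listMap_act_eq_self {A : List (IAtom L Q)} {π : Equiv.Perm ℕ}
    (h : ∀ x ∈ fvL (chrL A), π x = x) : A.map (IAtom.act π id) = A := by
  conv_rhs => rw [← List.map_id A]
  refine List.map_congr_left fun b hb => Prod.ext ((Atom.subst_congr b.1 fun x hx => ?_).trans
    (Atom.subst_var _)) rfl
  rw [ren, h x ⟨b.1, List.mem_map_of_mem hb, hx⟩]

open Classical in
/-- The assignment of identifiers for an unfolded rule which corresponds to assignments `g` for the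
original rule and `gw` for the rule it is unfolded with. -/
noncomputable def unfoldIds (r : ARule L Q N) (g gw : ℕ → ℕ) (i : ℕ) : ℕ :=
  if i ∈ r.ids then g i else gw (i - maxId r.chr r.tok)

theorem unfoldIds_left {i : ℕ} (hi : i ∈ r.ids) : unfoldIds r g gw i = g i := by
  rw [unfoldIds, if_pos hi]

theorem unfoldIds_right (hw : w.WF) {i : ℕ} (hi : i ∈ w.ids) :
    unfoldIds r g gw (i + maxId r.chr r.tok) = gw i := by
  have : i + maxId r.chr r.tok ∉ r.ids := fun h => by
    have h1 := le_maxId h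
    have h2 := hw.pos i hi
    omega
  rw [unfoldIds, if_neg this, Nat.add_sub_cancel]

variable [DecidableEq N] {K : Multiset (IAtom L Q)} {A₁ A₂ : List (IAtom L Q)} {θ : ℕ → L.Term ℕ}

theorem UnfoldsBy.name_eq (h : UnfoldsBy CT r w K A₁ A₂ θ u) : u.name = r.name := by rw [h.eq]

theorem UnfoldsBy.keep_eq (h : UnfoldsBy CT r w K A₁ A₂ θ u) : u.keep = r.keep := by rw [h.eq]

theorem UnfoldsBy.rem_eq (h : UnfoldsBy CT r w K A₁ A₂ θ u) : u.rem = r.rem := by rw [h.eq]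

theorem UnfoldsBy.entails_guard (h : UnfoldsBy CT r w K A₁ A₂ θ u) :
    Entails CT u.guard r.guard := by
  rw [h.eq]
  exact fun M w₀ hw₀ => ((holds_add _ _ _).1 hw₀).1

theorem UnfoldsBy.fv_subset (h : UnfoldsBy CT r w K A₁ A₂ θ u) : r.fv ⊆ u.fv := by
  rw [h.eq]
  rintro x ((((hx | hx) | hx) | hx) | hx)
  · exact Or.inl (Or.inl (Or.inl (Or.inl hx)))
  · exact Or.inl (Or.inl (Or.inl (Or.inr hx)))
  · refine Or.inl (Or.inl (Or.inr ?_))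
    simp only [fvs_add]
    exact Or.inl hx
  · rw [h.chr, fvI_add, fvI_coe A₂] at hx
    rcases hx with hx | hx
    · refine Or.inl (Or.inr ?_)
      simp only [fvI_add] at hx ⊢
      exact Or.inl hx
    · refine Or.inr ?_
      simp only [fvs_add, fvs_headEqs h.rem]
      exact Or.inr (Or.inr (Or.inl hx))
  · refine Or.inr ?_
    simp only [fvs_add]
    exact Or.inl (Or.inr hx)

/-- A renaming that fixes the variables of the unfolded rule may be applied to the rest of the data
of an unfolding. -/
theorem UnfoldsBy.rename_right (h : UnfoldsBy CT r w K A₁ A₂ θ u) {π : Equiv.Perm ℕ}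
    (hπ : ∀ x ∈ r.fv, π x = x) :
    UnfoldsBy CT r (w.rename π) K A₁ A₂ (conjSubst π θ) (u.rename π) := by
  have h1 := h.rename π
  have hfv : fvI r.chr ⊆ r.fv := fun x hx => Or.inl (Or.inr hx)
  rw [h.chr, fvI_add, fvI_add, fvI_coe, fvI_coe] at hfv
  rwa [r.rename_eq_self hπ, map_act_eq_self fun x hx => hπ x (hfv (Or.inl (Or.inl hx))),
    listMap_act_eq_self fun x hx => hπ x (hfv (Or.inl (Or.inr hx))),
    listMap_act_eq_self fun x hx => hπ x (hfv (Or.inr hx))] at h1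

/-- The variables that the unfolding substitution brings into the guard can be chosen fresh. -/
theorem UnfoldsBy.exists_fresh (h : UnfoldsBy CT r w K A₁ A₂ θ u) {Y : Set ℕ} (hY : Y.Finite)
    (hr : Disjoint r.fv Y) (hw : Disjoint w.fv Y) :
    ∃ θ' u', UnfoldsBy CT r w K A₁ A₂ θ' u' ∧ Disjoint u'.fv Y := by
  obtain ⟨π, h1, h2⟩ := exists_perm_fresh (Equiv.refl ℕ) (r.fv_finite.union w.fv_finite)
    (u.fv_finite.subset (Set.sdiff_subset (t := r.fv ∪ w.fv))) hY Set.disjoint_sdiff_left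
  have h3 := h.rename_right fun x hx => h1 x (Or.inl hx)
  rw [w.rename_eq_self fun x hx => h1 x (Or.inr hx)] at h3
  refine ⟨_, _, h3, disjoint_of_rename_off fun x hx => ?_⟩
  by_cases hx' : x ∈ r.fv ∪ w.fv
  · rw [h1 x hx']
    exact hx'.elim (fun h h' => Set.disjoint_left.1 hr h h') fun h h' => Set.disjoint_left.1 hw h h'
  · exact h2 x ⟨hx, hx'⟩

theorem UnfoldsBy.mem_ids (h : UnfoldsBy CT r w K A₁ A₂ θ u) {i : ℕ} (hi : i ∈ u.ids) :
    i ∈ r.ids ∨ ∃ j ∈ w.ids, i = j + maxId r.chr r.tok := by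
  have hle : K + (A₁ : Multiset (IAtom L Q)) ≤ r.chr := by
    rw [h.chr]; exact Multiset.le_add_right _ _
  have hmem : ∀ i ∈ (K + (A₁ : Multiset (IAtom L Q))).map Prod.snd, i ∈ r.ids := fun i hi =>
    Or.inl (Multiset.mem_of_le (Multiset.map_le_map hle) hi)
  rw [h.eq] at hi
  rcases hi with hi | ⟨t, ht, hi⟩
  · rw [Multiset.map_add, Multiset.mem_add] at hi
    rcases hi with hi | hi
    · exact Or.inl (hmem i hi)
    · simp only [inst, Multiset.map_map, Multiset.mem_map] at hi
      obtain ⟨b, hb, rfl⟩ := hi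
      exact Or.inr ⟨b.2, Or.inl (Multiset.mem_map_of_mem _ hb), rfl⟩
  · rcases mem_addToken.1 ht with ht | ⟨-, rfl⟩
    · rcases Finset.mem_union.1 ht with ht | ht
      · exact Or.inl (Or.inr ⟨t, (Finset.mem_filter.1 ht).1, hi⟩)
      · obtain ⟨s, hs, rfl⟩ := Finset.mem_image.1 ht
        obtain ⟨j, hj, rfl⟩ := List.mem_map.1 hi
        exact Or.inr ⟨j, Or.inr ⟨s, hs, hj⟩, rfl⟩
    · refine Or.inl (hmem i ?_)
      rw [Multiset.map_add, Multiset.mem_add]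
      exact Or.inr (by simpa [idL] using hi)

theorem UnfoldsBy.freshIds (h : UnfoldsBy CT r w K A₁ A₂ θ u) (hw : w.WF) {I : Set ℕ}
    (hg : FreshIds r g I) (hgw : FreshIds w gw (I ∪ g '' r.ids)) :
    FreshIds u (unfoldIds r g gw) I := by
  refine ⟨fun i hi j hj hij => ?_, fun i hi => ?_⟩
  · rcases h.mem_ids hi with hi | ⟨i', hi', rfl⟩ <;> rcases h.mem_ids hj with hj | ⟨j', hj', rfl⟩
    · rw [unfoldIds_left hi, unfoldIds_left hj] at hij
      exact hg.inj hi hj hij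
    · rw [unfoldIds_left hi, unfoldIds_right hw hj'] at hij
      exact absurd (Or.inr ⟨i, hi, hij⟩) (hgw.avoid j' hj')
    · rw [unfoldIds_left hj, unfoldIds_right hw hi'] at hij
      exact absurd (Or.inr ⟨j, hj, hij.symm⟩) (hgw.avoid i' hi')
    · rw [unfoldIds_right hw hi', unfoldIds_right hw hj'] at hij
      rw [hgw.inj hi' hj' hij]
  · rcases h.mem_ids hi with hi | ⟨i', hi', rfl⟩
    · rw [unfoldIds_left hi]; exact hg.avoid i hi
    · rw [unfoldIds_right hw hi']; exact fun h => hgw.avoid i' hi' (Or.inl h)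

/-- Firing the unfolded rule has the same effect as firing the original rule and then the rule it
was unfolded with, except for tokens that have become useless. -/
theorem fire_unfold_iff (hCT : ClarkEquality CT) (hP : ∀ w ∈ P, w.WF) (hσ : σ.WF V) (hr : r.WF)
    (hw : w.WF) (hU : UnfoldsBy CT r w K A₁ A₂ θ u) (hG : Entails CT r.guard u.guard)
    (hc : CanFire CT σ r S₁ S₂ S) (hg : FreshIds r g σ.ids)
    (hd : Disjoint w.fv (fire σ r g S₁ S₂ S).vars)
    (hgw : FreshIds w gw (fire σ r g S₁ S₂ S).ids) (hdu : Disjoint u.fv σ.vars) :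
    Reach CT P V a k (fire σ u (unfoldIds r g gw) S₁ S₂ S) ↔
      Reach CT P V a k (fire (fire σ r g S₁ S₂ S) w gw (A₁.map (reid g)) (A₂.map (reid g))
        (K.map (reid g) + (↑S₁ + S))) := by
  have hcu : CanFire CT σ u S₁ S₂ S := hc.of_guard hU.name_eq hU.keep_eq hU.rem_eq hG hdu
  have hB := Block.of_fire hCT hσ hc hg
  have hW := (hσ.fire hr hc hg).fire hw (hB.canFire hU hG hw hd) hgw
  have hWu := hσ.fire (hU.wf hr hw) hcu (hU.freshIds hw hg hgw)
  have hK : ∀ b ∈ K + (A₁ : Multiset (IAtom L Q)), b.2 ∈ r.ids := fun b hb =>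
    Or.inl (Multiset.mem_map_of_mem _ (by rw [hU.chr]; exact Multiset.mem_add.2 (Or.inl hb)))
  have hidA : (idL A₁).map (unfoldIds r g gw) = idL (A₁.map (reid g)) := by
    rw [idL_reid]
    refine List.map_congr_left fun i hi => unfoldIds_left ?_
    obtain ⟨b, hb, rfl⟩ := List.mem_map.1 hi
    exact hK b (Multiset.mem_add.2 (Or.inr hb))
  have hright : ∀ s ∈ w.tok, (s.2.map (· + maxId r.chr r.tok)).map (unfoldIds r g gw) = s.2.map gw := by
    intro s hs
    rw [List.map_map]
    exact List.map_congr_left fun i hi => unfoldIds_right hw (Or.inr ⟨s, hs, hi⟩)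
  have hleft : ∀ s ∈ r.tok, s.2.map (unfoldIds r g gw) = s.2.map g := fun s hs =>
    List.map_congr_left fun i hi => unfoldIds_left (Or.inr ⟨s, hs, hi⟩)
  have hchr : (fire (fire σ r g S₁ S₂ S) w gw (A₁.map (reid g)) (A₂.map (reid g))
      (K.map (reid g) + (↑S₁ + S))).chr = (fire σ u (unfoldIds r g gw) S₁ S₂ S).chr := by
    have h1 : (K + (A₁ : Multiset (IAtom L Q))).map (reid (unfoldIds r g gw)) =
        (K + (A₁ : Multiset (IAtom L Q))).map (reid g) :=
      Multiset.map_congr rfl fun b hb => Prod.ext rfl (unfoldIds_left (hK b hb))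
    have h2 : ((inst w.chr w.tok (maxId r.chr r.tok)).1).map (reid (unfoldIds r g gw)) =
        w.chr.map (reid gw) := by
      simp only [inst, Multiset.map_map]
      exact Multiset.map_congr rfl fun b hb => Prod.ext rfl
        (unfoldIds_right hw (Or.inl (Multiset.mem_map_of_mem _ hb)))
    have h3 : u.chr = K + ↑A₁ + (inst w.chr w.tok (maxId r.chr r.tok)).1 := by rw [hU.eq]
    show w.chr.map (reid gw) + _ + _ = u.chr.map (reid (unfoldIds r g gw)) + _ + _
    rw [h3, Multiset.map_add, h1, h2, Multiset.map_add, Multiset.map_coe]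
    abel
  have hb : (fire (fire σ r g S₁ S₂ S) w gw (A₁.map (reid g)) (A₂.map (reid g))
      (K.map (reid g) + (↑S₁ + S))).built = (fire σ u (unfoldIds r g gw) S₁ S₂ S).built := by
    simp only [fire, chrL_reid, hU.keep_eq, hU.rem_eq]
    have h1 : u.bi = w.bi + r.bi + (headEqs (chrL A₁) w.keep + headEqs (chrL A₂) w.rem) := by
      rw [hU.eq]
    rw [h1]
    abel
  have htok : ∀ t : Token N, t ∈ u.tok ↔ (t ∈ clean (K + (A₁ : Multiset (IAtom L Q))) r.tok ∨
      ∃ s ∈ w.tok, (s.1, s.2.map (· + maxId r.chr r.tok)) = t) ∨ (A₂ = [] ∧ t = (w.name, idL A₁)) := by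
    intro t
    have h1 : u.tok = addToken (clean (K + (A₁ : Multiset (IAtom L Q))) r.tok ∪
        (inst w.chr w.tok (maxId r.chr r.tok)).2.1) w.name A₁ A₂ := by rw [hU.eq]
    rw [h1, mem_addToken, Finset.mem_union, inst, Finset.mem_image]
  have hh : ∀ t : Token N, (∀ i ∈ t.2, i ∈ (fire σ u (unfoldIds r g gw) S₁ S₂ S).chr.map Prod.snd) →
      (t ∈ (fire σ u (unfoldIds r g gw) S₁ S₂ S).hist ↔
        t ∈ (fire (fire σ r g S₁ S₂ S) w gw (A₁.map (reid g)) (A₂.map (reid g))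
          (K.map (reid g) + (↑S₁ + S))).hist) := by
    intro t ht
    constructor
    · rintro ((h | ⟨h, rfl⟩) | ⟨s, hs, rfl⟩)
      · exact Or.inl (Or.inl (Or.inl (Or.inl h)))
      · exact Or.inl (Or.inl (Or.inl (Or.inr ⟨h, by rw [hU.name_eq]⟩)))
      · rcases (htok s).1 hs with (hs | ⟨s', hs', rfl⟩) | ⟨hA, rfl⟩
        · have hs := (Finset.mem_filter.1 hs).1
          exact Or.inl (Or.inl (Or.inr ⟨s, hs, by rw [hleft s hs]⟩))
        · exact Or.inr ⟨s', hs', Prod.ext rfl (hright s' hs')⟩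
        · exact Or.inl (Or.inr ⟨by simp [hA], Prod.ext rfl hidA⟩)
    · rintro ((((h | ⟨h, rfl⟩) | ⟨s, hs, rfl⟩) | ⟨h, rfl⟩) | ⟨s, hs, rfl⟩)
      · exact Or.inl (Or.inl h)
      · exact Or.inl (Or.inr ⟨h, by rw [hU.name_eq]⟩)
      · -- a token of `r` all of whose identifiers are still in use is kept by the unfolding
        refine Or.inr ⟨s, (htok s).2 (Or.inl (Or.inl (Finset.mem_filter.2 ⟨hs, fun i hi => ?_⟩))),
          by rw [hleft s hs]⟩
        have hir : i ∈ r.ids := Or.inr ⟨s, hs, hi⟩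
        have h1 := ht (g i) (List.mem_map_of_mem hi)
        rw [← hchr] at h1
        change g i ∈ (w.chr.map (reid gw) + _ + _ : Multiset (IAtom L Q)).map Prod.snd at h1
        have h2 : ((K + (A₁ : Multiset (IAtom L Q))).map (reid g)).map Prod.snd =
            ((K + (A₁ : Multiset (IAtom L Q))).map Prod.snd).map g := map_snd_reid _ _
        simp only [Multiset.map_add, Multiset.mem_add, map_snd_reid] at h1
        have hin : g i ∈ ((K + (A₁ : Multiset (IAtom L Q))).map Prod.snd).map g := by
          rcases h1 with (h1 | h1) | h1 | h1
          · obtain ⟨j, hj, hji⟩ := Multiset.mem_map.1 h1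
            exact absurd (Or.inr ⟨i, hir, hji.symm⟩) (hgw.avoid j (Or.inl hj))
          · rw [← h2, Multiset.map_add, Multiset.map_add, Multiset.mem_add]
            exact Or.inr h1
          · rw [Multiset.map_add, Multiset.map_add, Multiset.mem_add]
            exact Or.inl h1
          · refine absurd (hσ.chrI _ ?_) (hg.avoid i hir)
            rw [hc.chr]
            simp only [Multiset.map_add, Multiset.mem_add]
            exact h1.imp_left Or.inl
        obtain ⟨j, hj, hji⟩ := Multiset.mem_map.1 hin
        obtain ⟨b, hb, rfl⟩ := Multiset.mem_map.1 hj
        rw [← hg.inj (hK b hb) hir hji]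
        exact hj
      · refine Or.inr ⟨(w.name, idL A₁), (htok _).2 (Or.inr ⟨by simpa using h, rfl⟩),
          Prod.ext rfl hidA.symm⟩
      · exact Or.inr ⟨_, (htok _).2 (Or.inl (Or.inr ⟨s, hs, rfl⟩)), Prod.ext rfl (hright s hs).symm⟩
  exact ⟨fun h => h.congr hP hWu hW hchr (fun M w₀ => by rw [hb]) hh,
    fun h => h.congr hP hW hWu hchr.symm (fun M w₀ => by rw [hb]) fun t ht =>
      (hh t fun i hi => hchr ▸ ht i hi).symm⟩

/-- Answers are preserved by safe replacement: a use of the replaced rule is followed by the use of a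
rule by which it unfolds, and both become one use of an unfolded rule. -/
theorem Reach.replace (hCT : ClarkEquality CT) (hP : ∀ w ∈ P, w.WF) (hr₀ : r₀ ∈ P)
    (hS : ∀ π, Safe CT P U (r₀.rename π)) (hU : U ⊆ Unf CT P r₀) :
    ∀ {k : ℕ} {σ : EConf L Q N}, σ.WF V → Reach CT P V a k σ →
      Reach CT ((P \ {r₀}) ∪ U) V a k σ := by
  -- an unfolded rule fires only where `r₀` does
  have hfinal : ∀ {σ : EConf L Q N}, (∀ w ∈ P, ∀ (ρ : Equiv.Perm ℕ) (S₁ S₂ : List (IAtom L Q))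
      (S : Multiset (IAtom L Q)), ¬ CanFire CT σ (w.rename ρ) S₁ S₂ S) →
      ∀ w ∈ (P \ {r₀}) ∪ U, ∀ (ρ : Equiv.Perm ℕ) (S₁ S₂ : List (IAtom L Q))
      (S : Multiset (IAtom L Q)), ¬ CanFire CT σ (w.rename ρ) S₁ S₂ S := by
    rintro σ hf w (hw | hw) ρ S₁ S₂ S hc
    · exact hf w hw.1 ρ S₁ S₂ S hc
    · obtain ⟨v, ids, -, hv⟩ := hU hw
      obtain ⟨K, A₁, A₂, θ, h1, -⟩ := unfolds_iff.1 hv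
      have h2 := h1.rename ρ
      exact hf r₀ hr₀ ρ S₁ S₂ S (hc.of_guard h2.name_eq.symm h2.keep_eq.symm h2.rem_eq.symm
        h2.entails_guard (hc.fresh.mono_left h2.fv_subset))
  intro k
  induction k with
  | zero =>
    intro σ hσ h
    cases h with
    | unsat h ha => exact .unsat h ha
    | final h hf ha => exact .final h (hfinal hf) ha
  | succ k ih =>
    intro σ hσ h
    cases h with
    | unsat h ha => exact .unsat h ha
    | final h hf ha => exact .final h (hfinal hf) ha
    | @fire _ _ w ρ g S₁ S₂ S hw hc hg h =>
      by_cases hwr : w = r₀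
      · subst hwr
        have hr := (hP w hw).rename ρ
        -- the application that uses the body of `r₀` is moved to the front
        obtain ⟨v, u, gw, K, A₁, A₂, θ, h1, h2, h3, h4, h5⟩ :=
          h.use_block hP (hS ρ) hr _ (hσ.fire hr hc hg) (Block.of_fire hCT hσ hc hg)
        obtain ⟨θ', u', h6, h7⟩ :=
          h2.exists_fresh hσ.finV hc.fresh (h3.mono_right Set.subset_union_left)
        have hv : v.WF := by
          obtain ⟨⟨v₀, hv₀, π, rfl⟩, -⟩ := h1
          exact (hP v₀ hv₀).rename π
        have hG := ((hS ρ).guard_unfoldsBy h1 h6).1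
        have hcu : CanFire CT σ u' S₁ S₂ S := hc.of_guard h6.name_eq h6.keep_eq h6.rem_eq hG h7
        have hgu := h6.freshIds hv hg h4
        have h8 := (fire_unfold_iff hCT hP hσ hr hv h6 hG hc hg h3 h4 h7).2 h5
        have h9 := ih (hσ.fire (h6.wf hr hv) hcu hgu) h8
        obtain ⟨u₀, hu₀, π, rfl⟩ := (hS ρ).unf _ _ _ h1 (unfolds_iff.2 ⟨_, _, _, _, h6, rfl⟩)
        exact .fire (Or.inr hu₀) hcu hgu h9
      · exact .fire (Or.inl ⟨hw, hwr⟩) hc hg (ih (hσ.fire ((hP w hw).rename ρ) hc hg) h)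

/-- Conversely, a use of an unfolded rule can be simulated by two rules of the original program. -/
theorem Reach.of_replace (hCT : ClarkEquality CT) (hP : ∀ w ∈ P, w.WF) (hr₀ : r₀ ∈ P)
    (hS : ∀ π, Safe CT P U (r₀.rename π)) (hU : U ⊆ Unf CT P r₀)
    (h : Reach CT ((P \ {r₀}) ∪ U) V a k σ) : σ.WF V → ∃ k, Reach CT P V a k σ := by
  induction h with
  | unsat h ha => exact fun _ => ⟨0, .unsat h ha⟩
  | @final k σ h hf ha =>
    refine fun hσ => ⟨0, .final h (fun w hw ρ S₁ S₂ S hc => ?_) ha⟩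
    by_cases hwr : w = r₀
    · -- where `r₀` fires, some unfolded rule does
      subst hwr
      obtain ⟨v, u, K, A₁, A₂, θ, h1, h2, h3⟩ := (hS ρ).exists_unfolding hσ.finV
      obtain ⟨θ', u', h6, h7⟩ := h2.exists_fresh hσ.finV hc.fresh h3
      have hcu : CanFire CT σ u' S₁ S₂ S :=
        hc.of_guard h6.name_eq h6.keep_eq h6.rem_eq ((hS ρ).guard_unfoldsBy h1 h6).1 h7
      obtain ⟨u₀, hu₀, π, rfl⟩ := (hS ρ).unf _ _ _ h1 (unfolds_iff.2 ⟨_, _, _, _, h6, rfl⟩)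
      exact hf u₀ (Or.inr hu₀) π _ _ _ hcu
    · exact hf w (Or.inl ⟨hw, hwr⟩) ρ _ _ _ hc
  | @fire k σ w ρ g S₁ S₂ S hw hc hg h ih =>
    intro hσ
    rcases hw with hw | hw
    · obtain ⟨k', h'⟩ := ih (hσ.fire ((hP w hw.1).rename ρ) hc hg)
      exact ⟨k' + 1, .fire hw.1 hc hg h'⟩
    · obtain ⟨v, ids, hv, hvu⟩ := hU hw
      obtain ⟨K, A₁, A₂, θ, h1, -⟩ := unfolds_iff.1 hvu
      have h1 := h1.rename ρ
      have hv := hv.rename ρ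
      -- the variables of the second rule that do not occur in the unfolded rule are renamed apart
      obtain ⟨π, h2, h3⟩ := exists_perm_fresh (Equiv.refl ℕ) (w.rename ρ).fv_finite
        ((v.rename ρ).fv_finite.subset (Set.sdiff_subset (t := (w.rename ρ).fv))) hσ.finV
        Set.disjoint_sdiff_left
      have hfix : ∀ x ∈ (r₀.rename ρ).fv, π x = x := fun x hx => h2 x (h1.fv_subset hx)
      have h4 := h1.rename_right hfix
      rw [(w.rename ρ).rename_eq_self h2] at h4
      have hv := hv.rename π
      rw [(r₀.rename ρ).rename_eq_self hfix] at hv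
      have hdv : Disjoint ((v.rename ρ).rename π).fv σ.vars := disjoint_of_rename_off fun x hx => by
        by_cases hx' : x ∈ (w.rename ρ).fv
        · rw [h2 x hx']
          exact Set.disjoint_left.1 hc.fresh hx'
        · exact h3 x ⟨hx, hx'⟩
      generalize (v.rename ρ).rename π = v' at h4 hv hdv
      have hr := (hP r₀ hr₀).rename ρ
      have hv' : v'.WF := by
        obtain ⟨⟨v₀, hv₀, π, rfl⟩, -⟩ := hv
        exact (hP v₀ hv₀).rename π
      have hG := ((hS ρ).guard_unfoldsBy hv h4).1
      have hcr : CanFire CT σ (r₀.rename ρ) S₁ S₂ S :=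
        hc.of_guard h4.name_eq.symm h4.keep_eq.symm h4.rem_eq.symm h4.entails_guard
          (hc.fresh.mono_left h4.fv_subset)
      obtain ⟨g', hg'⟩ := exists_freshIds (r₀.rename ρ) hσ.finI
      have hσ' := hσ.fire hr hcr hg'
      obtain ⟨gw, hgw⟩ := exists_freshIds v' hσ'.finI
      have hwu := h4.wf hr hv'
      obtain ⟨k', h5⟩ := ih (hσ.fire hwu hc hg)
      have h6 := h5.fire_reid hP hσ hwu hc hg (h4.freshIds hv' hg' hgw)
      have hd : Disjoint v'.fv (CHR.fire σ (r₀.rename ρ) g' S₁ S₂ S).vars :=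
        Set.disjoint_union_right.2 ⟨hdv, hv.2⟩
      have h7 := (fire_unfold_iff hCT hP hσ hr hv' h4 hG hcr hg' hd hgw hc.fresh).1 h6
      have hcv := (Block.of_fire hCT hσ hcr hg').canFire h4 hG hv' hd
      obtain ⟨⟨v₀, hv₀, π', rfl⟩, -⟩ := hv
      exact ⟨k' + 1 + 1, .fire hr₀ hcr hg' (.fire hv₀ hcv hgw h7)⟩

theorem SafeReplacement.wf {P P' : Set (ARule L Q N)} (h : SafeReplacement CT P P')
    (hP : ∀ w ∈ P, w.WF) : ∀ w ∈ P', w.WF := by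
  obtain ⟨r, hr, U, hU, -, rfl⟩ := h
  rintro w (hw | hw)
  · exact hP w hw.1
  · obtain ⟨v, ids, ⟨⟨v₀, hv₀, π, rfl⟩, -⟩, hv⟩ := hU hw
    obtain ⟨K, A₁, A₂, θ, h1, -⟩ := unfolds_iff.1 hv
    exact h1.wf (hP r hr.1) ((hP v₀ hv₀).rename π)

theorem SafeReplacement.QA'_eq {P P' : Set (ARule L Q N)} (hCT : ClarkEquality CT)
    (h : SafeReplacement CT P P') (hP : ∀ w ∈ P, w.WF) (G : Goal L Q) :
    QA' CT P G = QA' CT P' G := by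
  have hP' := h.wf hP
  obtain ⟨r, hr, U, hU, hU', rfl⟩ := h
  have hS : ∀ π, Safe CT P U (r.rename π) := safe_of_safelyReplaceable hr hU'
  ext a
  rw [mem_QA'_iff hP, mem_QA'_iff hP']
  constructor
  · rintro ⟨k, h⟩
    exact ⟨k, h.replace hCT hP hr.1 hS hU (initE_wf G)⟩
  · rintro ⟨k, h⟩
    exact h.of_replace hCT hP hr.1 hS hU (initE_wf G)

end Replacement


end CHR

theorem mainTheorem4 {L : FirstOrder.Language.{u, v}} {Q : Type*} {N : Type*} [DecidableEq N]
    (CT : L.Theory) (hCT : ClarkEquality CT) (P : Program L Q N) (n : ℕ)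
    (S : Fin (n + 1) → Set (ARule L Q N)) (hS : IsUSequence CT (Ann P) n S) (G : Goal L Q) :
    QA CT P G = QA' CT (S (Fin.last n)) G := by
  obtain ⟨h0, hstep⟩ := hS
  have key : ∀ i : Fin (n + 1), (∀ w ∈ S i, w.WF) ∧ QA CT P G = QA' CT (S i) G := by
    intro i
    induction i using Fin.induction with
    | zero =>
      rw [h0]
      refine ⟨Ann_wf, Set.ext fun a => ?_⟩
      rw [mem_QA_iff, mem_QA'_iff Ann_wf]
    | succ i ih => exact ⟨(hstep i).wf ih.1, ih.2.trans ((hstep i).QA'_eq hCT ih.1 G)⟩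
  exact (key (Fin.last n)).2
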